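/- Let ${\cal O}\subset\mathbb R^3$ be a bounded domain with sufficiently smooth boundary $\partial{\cal O}=\Omega\cup S$, where $\Omega\subset\{x_3=0\}$ is a flat, relatively open piece with smooth contour $\partial\Omega$ (identified with an open subset of $\mathbb R^2$) and $S=\partial{\cal O}\setminus\Omega\subset\{x_3\le 0\}$. Let $\nu>0$, $\mu\in(0,1/2)$, and let $k_1,k_2$ be sufficiently smooth functions on $\overline\Omega$. Write $(\cdot,\cdot)_D$ for the inner product of $L_2(D)$ and for the duality that extends it. Let $V$ be the closure in $[H^1({\cal O})]^3$ of the solenoidal vector fields that are $C^\infty$ on $\overline{\cal O}$ and vanish in a neighbourhood of $S$. Put $W=H^1_0(\Omega)\times H^1_0(\Omega)\times H^2_0(\Omega)$ and $\widehat W=\{u=(u^1;u^2;w)\in W:\int_\Omega w\,dx'=0\}$. For $u=(u^1;u^2;w)\in W$ let $$\varepsilon_{11}=u^1_{x_1}+k_1w+\tfrac12 w_{x_1}^2,\quad \varepsilon_{22}=u^2_{x_2}+k_2w+\tfrac12 w_{x_2}^2,\quad \varepsilon_{12}=u^1_{x_2}+u^2_{x_1}+w_{x_1}w_{x_2},$$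 $$N_{11}=\tfrac{2}{1-\mu}(\varepsilon_{11}+\mu\varepsilon_{22}),\quad N_{22}=\tfrac{2}{1-\mu}(\varepsilon_{22}+\mu\varepsilon_{11}),\quad N_{12}=\varepsilon_{12}.$$ For $u\in W$ and $\beta=(\beta^1;\beta^2;\delta)\in W$, with $\bar u=(u^1;u^2)$ and $\bar\beta=(\beta^1;\beta^2)$, put $$r(u,\beta)=(k_1N_{11}+k_2N_{22},\delta)_\Omega+(N_{11}w_{x_1}+N_{12}w_{x_2},\delta_{x_1})_\Omega+(N_{12}w_{x_1}+N_{22}w_{x_2},\delta_{x_2})_\Omega,$$ $$a(\bar u,\bar\beta)=\sum_{i=1}^2(\nabla u^i,\nabla\beta^i)_\Omega+\tfrac{1+\mu}{1-\mu}({\rm div}\,\bar u,{\rm div}\,\bar\beta)_\Omega,$$ $$q(u,\beta)=r(u,\beta)+\tfrac1{1-\mu}\big[(w_{x_1}^2+\mu w_{x_2}^2,\beta^1_{x_1})_\Omega+(w_{x_2}^2+\mu w_{x_1}^2,\beta^2_{x_2})_\Omega\big]+(w_{x_1}w_{x_2},\beta^1_{x_2}+\beta^2_{x_1})_\Omega+\tfrac{2}{1-\mu}\big(w,(k_1+\mu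 k_2)\beta^1_{x_1}+(k_2+\mu k_1)\beta^2_{x_2}\big)_\Omega,$$ $$\bar q(u,\beta)=r(u,\beta)+(N_{11},\beta^1_{x_1})_\Omega+(N_{12},\beta^1_{x_2}+\beta^2_{x_1})_\Omega+(N_{22},\beta^2_{x_2})_\Omega,$$ and $E(v,\psi)=\frac12\sum_{i,j=1}^3(v^j_{x_i}+v^i_{x_j},\psi^j_{x_i}+\psi^i_{x_j})_{\cal O}$ for $v,\psi\in V$. A pair $(v;u)\in V\times W$ is a stationary solution of the fluid–shell problem with volume force $G_f\in V'$ and body force $G_{sh}=(G^1_{sh};G^2_{sh};G^3_{sh})$ on the shell if $v|_{\partial{\cal O}}=0$ and $$\nu E(v,\psi)+(\Delta w,\Delta\delta)_\Omega+a(\bar u,\bar\beta)+q(u,\beta)-(G_f,\psi)_{\cal O}-(G_{sh},\beta)_\Omega=0$$ for all $\psi\in V$ whose trace $\psi|_\Omega=\beta=(\beta^1;\beta^2;\delta)$ belongs to $\widehat W$. Assume that $G_f=0$, $G^1_{sh}=G^2_{sh}=0$ and $G^3_{sh}=g\in H^{-1}(\Omega)$. Then: 1. Every stationary solution has the form $(0;u)$,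 where $u=(u^1;u^2;w)\in W$ satisfies $$(\Delta w,\Delta\delta)_\Omega+\bar q(u,\beta)-(g,\delta)_\Omega=0\qquad\forall\,\beta=(\beta^1;\beta^2;\delta)\in\widehat W.\tag{$*$}$$ 2. There is at least one solution $u$ of $(*)$ in $\widehat W$. 3. If in addition $k_1=k_2=0$ on $\Omega$, then the set of all solutions of $(*)$ that lie in $\widehat W$ is bounded in $\widehat W$. -/

import Mathlib

open MeasureTheory Set

open scoped ContDiff

namespace FluidShell

noncomputable section

/-! ### Sobolev spaces

A function of a Sobolev space of order `k` is represented by the tuple of all its weak derivatives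
of order at most `k` (the function itself included); each of them is an element of `L²(D)`. -/

/-- Euclidean space of dimension `d`. -/
abbrev Eucl (d : ℕ) := EuclideanSpace ℝ (Fin d)

/-- `L²(D)`. -/
abbrev L2 {d : ℕ} (D : Set (Eucl d)) := Lp ℝ 2 (volume.restrict D)

/-- The index `⟨m, I⟩` stands for the derivative `∂_{I 0} ⋯ ∂_{I (m-1)}` of order `m ≤ k`. -/
abbrev JetIdx (d k : ℕ) := Σ m : Fin (k + 1), (Fin m → Fin d)

/-- Tuples of `L²` functions indexed by the derivatives of order at most `k`, with the Hilbert norm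
`‖U‖² = ∑_I ‖U_I‖²`; on the tuple of the derivatives of a function this is the `H^k(D)` norm. -/
abbrev Jet {d : ℕ} (k : ℕ) (D : Set (Eucl d)) := PiLp 2 (fun _ : JetIdx d k => L2 D)

/-- The classical derivative of `φ` with index `I`. -/
def classicalDeriv {d k : ℕ} (φ : Eucl d → ℝ) (I : JetIdx d k) (x : Eucl d) : ℝ :=
  iteratedFDeriv ℝ I.1 φ x (fun j => EuclideanSpace.single (I.2 j) 1)

/-- `U` is the tuple of the derivatives (of order at most `k`) of the smooth function `φ` on `D`. -/
def IsJetOf {d k : ℕ} {D : Set (Eucl d)} (φ : Eucl d → ℝ) (U : Jet k D) : Prop :=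
  ∀ I, (U I : Eucl d → ℝ) =ᵐ[volume.restrict D] classicalDeriv φ I

/-- The elements of `C₀^∞(D)`, represented by their derivatives of order at most `k`. -/
def testJets {d : ℕ} (k : ℕ) (D : Set (Eucl d)) : Set (Jet k D) :=
  {U | ∃ φ : Eucl d → ℝ, ContDiff ℝ ∞ φ ∧ HasCompactSupport φ ∧ tsupport φ ⊆ D ∧ IsJetOf φ U}

/-- `H^k_0(D)`: the closure of `C₀^∞(D)` in the `H^k(D)` norm. -/
def H0 {d : ℕ} (k : ℕ) (D : Set (Eucl d)) : Submodule ℝ (Jet k D) :=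
  (Submodule.span ℝ (testJets k D)).topologicalClosure

namespace Jet

variable {d k : ℕ} {D : Set (Eucl d)}

/-- The function itself. -/
def fn (U : Jet k D) : L2 D := U ⟨⟨0, by omega⟩, Fin.elim0⟩

/-- The first derivative `∂_i`. -/
def pd (U : Jet (k + 1) D) (i : Fin d) : L2 D := U ⟨⟨1, by omega⟩, fun _ => i⟩

/-- The Laplacian. -/
def lap (U : Jet (k + 2) D) (x : Eucl d) : ℝ :=
  ∑ i : Fin d, (U ⟨⟨2, by omega⟩, fun _ => i⟩ : Eucl d → ℝ) x

/-- The inclusion `H^{k+1} → H^k`, which forgets the derivatives of order `k + 1`. -/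
def lower : Jet (k + 1) D →L[ℝ] Jet k D where
  toFun U := WithLp.toLp 2 fun I => U ⟨I.1.castSucc, I.2⟩
  map_add' _ _ := rfl
  map_smul' _ _ := rfl
  cont := by
    refine (PiLp.continuous_toLp 2 _).comp (continuous_pi fun I => ?_)
    fun_prop

end Jet

theorem lower_mem_H0 {d k : ℕ} {D : Set (Eucl d)} {U : Jet (k + 1) D} (hU : U ∈ H0 (k + 1) D) :
    Jet.lower U ∈ H0 k D := by
  have hspan : Submodule.span ℝ (testJets (k + 1) D)
      ≤ (H0 k D).comap (Jet.lower : Jet (k + 1) D →L[ℝ] Jet k D).toLinearMap := by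
    rw [Submodule.span_le]
    rintro V ⟨φ, h1, h2, h3, h4⟩
    refine Submodule.le_topologicalClosure _ (Submodule.subset_span ⟨φ, h1, h2, h3, ?_⟩)
    intro I
    exact h4 ⟨I.1.castSucc, I.2⟩
  refine Submodule.topologicalClosure_minimal _ hspan ?_ hU
  exact (Submodule.isClosed_topologicalClosure _).preimage
    (Jet.lower : Jet (k + 1) D →L[ℝ] Jet k D).continuous

/-- The inclusion `H^{k+1}_0(D) ⊆ H^k_0(D)`. -/
def toLower {d k : ℕ} {D : Set (Eucl d)} (U : H0 (k + 1) D) : H0 k D :=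
  ⟨Jet.lower U.1, lower_mem_H0 U.2⟩

/-- `H^{-1}(D)`, the dual space of `H^1_0(D)`. -/
abbrev Hm1 {d : ℕ} (D : Set (Eucl d)) := H0 1 D →L[ℝ] ℝ

/-- The inner product `(f, g)_D` of `L²(D)`. -/
def ip {d : ℕ} (D : Set (Eucl d)) (f g : Eucl d → ℝ) : ℝ := ∫ x in D, f x * g x

/-! ### The domain -/

/-- `D` lies locally on one side of its boundary, which is a hypersurface of class `C^1`. -/
def HasC1Boundary {d : ℕ} (D : Set (Eucl d)) : Prop :=
  ∀ x ∈ frontier D, ∃ (U : Set (Eucl d)) (ρ : Eucl d → ℝ), IsOpen U ∧ x ∈ U ∧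
    ContDiffOn ℝ 1 ρ U ∧ (∀ y ∈ U, fderiv ℝ ρ y ≠ 0) ∧ D ∩ U = {y ∈ U | ρ y < 0}

/-- The plane `{x₃ = 0}`: `(x₁, x₂) ↦ (x₁, x₂, 0)`. -/
def embed (y : Eucl 2) : Eucl 3 := !₂[y 0, y 1, 0]

/-- The part `S = ∂O \ Ω` of the boundary of the fluid domain. -/
def wall (O : Set (Eucl 3)) (Ω : Set (Eucl 2)) : Set (Eucl 3) := frontier O \ embed '' Ω

/-- `O` is a bounded domain of `ℝ³` with regular boundary `Ω ∪ S`, where `Ω` is a flat piece of the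
plane `{x₃ = 0}` with regular contour and `S` lies in `{x₃ ≤ 0}`. -/
structure IsFluidShellDomain (O : Set (Eucl 3)) (Ω : Set (Eucl 2)) : Prop where
  isOpen_fluid : IsOpen O
  isConnected_fluid : IsConnected O
  isBounded_fluid : Bornology.IsBounded O
  boundary_fluid : HasC1Boundary O
  isOpen_shell : IsOpen Ω
  boundary_shell : HasC1Boundary Ω
  shell_subset : embed '' Ω ⊆ frontier O
  wall_below : ∀ x ∈ wall O Ω, x 2 ≤ 0

/-! ### Fluid velocities -/

/-- `[H^1(O)]³`-tuples: three components, each with its first derivatives. -/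
abbrev VelJet (O : Set (Eucl 3)) := PiLp 2 (fun _ : Fin 3 => Jet 1 O)

/-- The solenoidal vector fields that are `C^∞` on the closure of `O` and vanish in a neighbourhood
of `S`. -/
def smoothFields (O : Set (Eucl 3)) (Ω : Set (Eucl 2)) : Set (Eucl 3 → Eucl 3) :=
  {φ | ContDiff ℝ ∞ φ ∧
    (∃ N : Set (Eucl 3), IsOpen N ∧ wall O Ω ⊆ N ∧ ∀ x ∈ N ∩ closure O, φ x = 0) ∧
    ∀ x ∈ O, ∑ i : Fin 3, fderiv ℝ φ x (EuclideanSpace.single i 1) i = 0}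

/-- The space `V`: the closure of the smooth solenoidal fields in the `H^1(O)` norm. -/
def V (O : Set (Eucl 3)) (Ω : Set (Eucl 2)) : Submodule ℝ (VelJet O) :=
  (Submodule.span ℝ {U | ∃ φ ∈ smoothFields O Ω,
    ∀ j, IsJetOf (fun x => φ x j) (U j)}).topologicalClosure

/-- The graph of the trace operator `v ↦ v|_Ω` from `V` to `[L²(Ω)]³`, the extension by continuity
of the restriction of smooth fields. -/
def traceGraph (O : Set (Eucl 3)) (Ω : Set (Eucl 2)) : Submodule ℝ (VelJet O × (Fin 3 → L2 Ω)) :=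
  (Submodule.span ℝ {p | ∃ φ ∈ smoothFields O Ω,
    (∀ j, IsJetOf (fun x => φ x j) (p.1 j)) ∧
    ∀ j, (p.2 j : Eucl 2 → ℝ) =ᵐ[volume.restrict Ω]
      fun y => φ (embed y) j}).topologicalClosure

/-- `v|_Ω = b`. -/
def HasTrace {O : Set (Eucl 3)} {Ω : Set (Eucl 2)} (v : V O Ω) (b : Fin 3 → L2 Ω) : Prop :=
  ((v : VelJet O), b) ∈ traceGraph O Ω

/-- `E(v, ψ) = ½ ∑_{i,j} (∂_i v^j + ∂_j v^i, ∂_i ψ^j + ∂_j ψ^i)_O`. -/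
def formE {O : Set (Eucl 3)} {Ω : Set (Eucl 2)} (v ψ : V O Ω) : ℝ :=
  1 / 2 * ∑ i : Fin 3, ∑ j : Fin 3,
    ip O (fun x => (v.1 j).pd i x + (v.1 i).pd j x) (fun x => (ψ.1 j).pd i x + (ψ.1 i).pd j x)

/-! ### Shell displacements -/

/-- `W = H^1_0(Ω) × H^1_0(Ω) × H^2_0(Ω)`. -/
abbrev W (Ω : Set (Eucl 2)) := H0 1 Ω × H0 1 Ω × H0 2 Ω

/-- `Ŵ`: the displacements whose transversal component has zero average. -/
def What (Ω : Set (Eucl 2)) : Set (W Ω) := {u | ∫ x in Ω, u.2.2.1.fn x = 0}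

namespace W

variable {Ω : Set (Eucl 2)}

/-- The components of a displacement as functions. -/
def comp (u : W Ω) : Fin 3 → L2 Ω := ![u.1.1.fn, u.2.1.1.fn, u.2.2.1.fn]

/-- `∂_i u¹`. -/
def du1 (u : W Ω) (i : Fin 2) : L2 Ω := u.1.1.pd i

/-- `∂_i u²`. -/
def du2 (u : W Ω) (i : Fin 2) : L2 Ω := u.2.1.1.pd i

/-- The transversal displacement `w`. -/
def w (u : W Ω) : L2 Ω := u.2.2.1.fn

/-- `∂_i w`. -/
def dw (u : W Ω) (i : Fin 2) : L2 Ω := u.2.2.1.pd i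

/-- `Δ w`. -/
def lapw (u : W Ω) : Eucl 2 → ℝ := u.2.2.1.lap

/-- The deformation `ε₁₁`. -/
def eps11 (k1 : Eucl 2 → ℝ) (u : W Ω) (x : Eucl 2) : ℝ :=
  u.du1 0 x + k1 x * u.w x + 1 / 2 * u.dw 0 x ^ 2

/-- The deformation `ε₂₂`. -/
def eps22 (k2 : Eucl 2 → ℝ) (u : W Ω) (x : Eucl 2) : ℝ :=
  u.du2 1 x + k2 x * u.w x + 1 / 2 * u.dw 1 x ^ 2

/-- The deformation `ε₁₂`. -/
def eps12 (u : W Ω) (x : Eucl 2) : ℝ :=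
  u.du1 1 x + u.du2 0 x + u.dw 0 x * u.dw 1 x

/-- The stress `N₁₁`. -/
def N11 (μ : ℝ) (k1 k2 : Eucl 2 → ℝ) (u : W Ω) (x : Eucl 2) : ℝ :=
  2 / (1 - μ) * (u.eps11 k1 x + μ * u.eps22 k2 x)

/-- The stress `N₂₂`. -/
def N22 (μ : ℝ) (k1 k2 : Eucl 2 → ℝ) (u : W Ω) (x : Eucl 2) : ℝ :=
  2 / (1 - μ) * (u.eps22 k2 x + μ * u.eps11 k1 x)

/-- The stress `N₁₂`. -/
def N12 (u : W Ω) (x : Eucl 2) : ℝ := u.eps12 x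

end W

variable {Ω : Set (Eucl 2)}

/-- The bilinear form `a(ū, b̄)` of plane elasticity. -/
def formA (μ : ℝ) (u b : W Ω) : ℝ :=
  (∑ i : Fin 2, ip Ω (u.du1 i) (b.du1 i)) + (∑ i : Fin 2, ip Ω (u.du2 i) (b.du2 i))
    + (1 + μ) / (1 - μ)
      * ip Ω (fun x => u.du1 0 x + u.du2 1 x) (fun x => b.du1 0 x + b.du2 1 x)

/-- The part of the shell forms that is tested with the transversal component:
`(k₁N₁₁ + k₂N₂₂, δ) + (N₁₁w_{x₁} + N₁₂w_{x₂}, δ_{x₁}) + (N₁₂w_{x₁} + N₂₂w_{x₂}, δ_{x₂})`. -/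
def formTrans (μ : ℝ) (k1 k2 : Eucl 2 → ℝ) (u b : W Ω) : ℝ :=
  ip Ω (fun x => k1 x * u.N11 μ k1 k2 x + k2 x * u.N22 μ k1 k2 x) b.w
    + ip Ω (fun x => u.N11 μ k1 k2 x * u.dw 0 x + u.N12 x * u.dw 1 x) (b.dw 0)
    + ip Ω (fun x => u.N12 x * u.dw 0 x + u.N22 μ k1 k2 x * u.dw 1 x) (b.dw 1)

/-- The form `q(u, b)`, with `ϰ₁ = k₁ + μ k₂` and `ϰ₂ = k₂ + μ k₁`. -/
def formQ (μ : ℝ) (k1 k2 : Eucl 2 → ℝ) (u b : W Ω) : ℝ :=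
  formTrans μ k1 k2 u b
    + 1 / (1 - μ) * (ip Ω (fun x => u.dw 0 x ^ 2 + μ * u.dw 1 x ^ 2) (b.du1 0)
      + ip Ω (fun x => u.dw 1 x ^ 2 + μ * u.dw 0 x ^ 2) (b.du2 1))
    + ip Ω (fun x => u.dw 0 x * u.dw 1 x) (fun x => b.du1 1 x + b.du2 0 x)
    + 2 / (1 - μ) * ip Ω u.w
      (fun x => (k1 x + μ * k2 x) * b.du1 0 x + (k2 x + μ * k1 x) * b.du2 1 x)

/-- The form `q̄(u, β)`. -/
def formQbar (μ : ℝ) (k1 k2 : Eucl 2 → ℝ) (u b : W Ω) : ℝ :=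
  formTrans μ k1 k2 u b
    + ip Ω (u.N11 μ k1 k2) (b.du1 0)
    + ip Ω u.N12 (fun x => b.du1 1 x + b.du2 0 x)
    + ip Ω (u.N22 μ k1 k2) (b.du2 1)

/-! ### Stationary solutions -/

/-- `(v; u) ∈ V × W` is a stationary solution for the volume force `Gf ∈ V'` and the body force
`(G1; G2; G3)` on the shell: `v` vanishes on the whole boundary, and the variational equation holds
for all `ψ ∈ V` whose trace `β` on `Ω` lies in `Ŵ`. -/
structure IsStationarySolution {O : Set (Eucl 3)} (ν μ : ℝ) (k1 k2 : Eucl 2 → ℝ)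
    (Gf : V O Ω →L[ℝ] ℝ) (G1 G2 G3 : Hm1 Ω) (v : V O Ω) (u : W Ω) : Prop where
  boundary : HasTrace v 0
  equation : ∀ (ψ : V O Ω), ∀ β ∈ What Ω, HasTrace ψ β.comp →
    ν * formE v ψ + ip Ω u.lapw β.lapw + formA μ u β + formQ μ k1 k2 u β
      - Gf ψ - (G1 β.1 + G2 β.2.1 + G3 (toLower β.2.2)) = 0

/-- `u` solves the stationary von Kármán equation
`(Δw, Δδ) + q̄(u, β) - (g, δ) = 0` for all `β = (β¹; β²; δ) ∈ Ŵ`. -/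
def SolvesVonKarman (μ : ℝ) (k1 k2 : Eucl 2 → ℝ) (g : Hm1 Ω) (u : W Ω) : Prop :=
  ∀ β ∈ What Ω, ip Ω u.lapw β.lapw + formQbar μ k1 k2 u β - g (toLower β.2.2) = 0

end

end FluidShell

/-! Equation (∗) is an Euler–Lagrange equation. The shell energy is ½‖Δw‖² + ½S(ε, ε) − (g, w),
where S is the positive definite form of Hooke's law (`stressForm`) and the strains ε are
affine-quadratic in u; differentiation gives exactly q̄(u, β) = S(ε(u), ε'(u)β) (`formQbar_eq`).
Integration by parts on H¹₀, in the form (∂_i f, ∂_j h) = (∂_j f, ∂_i h), identifies a + q with q̄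
(`formA_add_formQ`).

Assertion 1. Testing with ψ = v and β = 0 leaves E(v, v) = 0, so v has no deformations. The smooth
fields generating V vanish near S and the fluid lies strictly below the plane of Ω; cutting off the
shell by a weight in x₃ gives a Poincaré inequality in the horizontal directions, and this forces v
= 0 (`eq_zero_of_formE_eq_zero`). What remains is the shell equation, but only for those β that are
traces of elements of V. Solenoidal fields in a thin layer under Ω have the traces (c₁; c₂; 0) and
(0; 0; ∂_i c) for arbitrary test functions. A functional of δ that kills all derivatives is locally
a multiple of the integral, and a solenoidal flow through the connected fluid from one point of the
shell to another shows that the multiple is the same everywhere, even if Ω is disconnected. So the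
residual equals κ∫δ, which vanishes on Ŵ (`VanishesOnTraces.eq_zero`).

Assertion 2 is the direct method. The load is linear in Δw, so the energy bounds Δw and the strains,
and these bound u by the plane Korn inequality (`exists_norm_le_of_strain_le`). The energy is convex
in (Δw, ε), and ε is weakly sequentially continuous because H²₀ embeds compactly into H¹₀ and
products of H¹₀ functions are controlled by Ladyzhenskaya's inequality (`weakTendsto_strain`). A
minimizer on Ŵ therefore exists and solves (∗).

Assertion 3. Without curvature the strains are linear in ū and quadratic in w, so the direction (2ū;
w) yields ε'(u)β = 2ε(u). Testing (∗) with it gives ‖Δw‖² + 2S(ε, ε) = (g, w), an a priori bound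
(`isBounded_solutions`). -/

namespace FluidShell

noncomputable section

/-! ### Test functions and their derivatives -/

/-- The directional derivative `∂_i φ`. -/
def partialD {d : ℕ} (i : Fin d) (φ : Eucl d → ℝ) (x : Eucl d) : ℝ :=
  fderiv ℝ φ x (EuclideanSpace.single i 1)

theorem contDiff_partialD {d : ℕ} (i : Fin d) {φ : Eucl d → ℝ} (h : ContDiff ℝ ∞ φ) :
    ContDiff ℝ ∞ (partialD i φ) :=
  (h.fderiv_right (m := ∞) (by simp)).clm_apply contDiff_const

theorem tsupport_partialD_subset {d : ℕ} (i : Fin d) (φ : Eucl d → ℝ) :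
    tsupport (partialD i φ) ⊆ tsupport φ := by
  refine closure_minimal (fun x hx => ?_) (isClosed_tsupport φ)
  refine support_fderiv_subset ℝ (fun h => hx ?_)
  simp [partialD, h]

theorem partialD_mul {d : ℕ} (i : Fin d) {φ ψ : Eucl d → ℝ} {x : Eucl d}
    (hφ : DifferentiableAt ℝ φ x) (hψ : DifferentiableAt ℝ ψ x) :
    partialD i (fun y => φ y * ψ y) x = partialD i φ x * ψ x + φ x * partialD i ψ x := by
  simp only [partialD]
  rw [fderiv_fun_mul hφ hψ]
  simp
  ring

theorem partialD_coord {d : ℕ} (i j : Fin d) (x : Eucl d) :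
    partialD i (fun y => y j) x = if i = j then 1 else 0 := by
  have : (fun y : Eucl d => y j) = (EuclideanSpace.proj j : Eucl d →L[ℝ] ℝ) := by ext; simp
  simp only [partialD]
  rw [this, ContinuousLinearMap.fderiv]
  simp [PiLp.single_apply, eq_comm]

theorem contDiff_coord {d : ℕ} {n : WithTop ℕ∞} (j : Fin d) :
    ContDiff ℝ n (fun y : Eucl d => y j) :=
  (EuclideanSpace.proj j : Eucl d →L[ℝ] ℝ).contDiff

/-- Second derivatives commute. -/
theorem partialD_comm {d : ℕ} (i j : Fin d) {φ : Eucl d → ℝ} (h : ContDiff ℝ ∞ φ) :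
    partialD i (partialD j φ) = partialD j (partialD i φ) := by
  have key : ∀ k l : Fin d, ∀ x, partialD k (partialD l φ) x
      = fderiv ℝ (fderiv ℝ φ) x (EuclideanSpace.single k 1) (EuclideanSpace.single l 1) := by
    intro k l x
    have hd : DifferentiableAt ℝ (fderiv ℝ φ) x :=
      (h.fderiv_right (m := ∞) (by simp)).differentiable (by simp) x
    change fderiv ℝ (fun y => fderiv ℝ φ y (EuclideanSpace.single l 1)) x _ = _
    rw [fderiv_clm_apply hd (differentiableAt_const _)]
    simp
  ext x
  rw [key, key]
  have hs : IsSymmSndFDerivAt ℝ φ x :=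
    h.contDiffAt.isSymmSndFDerivAt (by simpa using WithTop.coe_le_coe.2 (le_top : (2 : ℕ∞) ≤ ⊤))
  exact hs _ _

/-- `C₀^∞(D)`. -/
def testSpace {d : ℕ} (D : Set (Eucl d)) : Submodule ℝ (Eucl d → ℝ) where
  carrier := {φ | ContDiff ℝ ∞ φ ∧ HasCompactSupport φ ∧ tsupport φ ⊆ D}
  add_mem' := by
    rintro a b ⟨h1, h2, h3⟩ ⟨h1', h2', h3'⟩
    exact ⟨h1.add h1', h2.add h2', (tsupport_add a b).trans (union_subset h3 h3')⟩
  zero_mem' := ⟨contDiff_const, HasCompactSupport.zero, by simp [tsupport]⟩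
  smul_mem' := by
    rintro c a ⟨h1, h2, h3⟩
    exact ⟨contDiff_const.smul h1, h2.smul_left (f := fun _ => c),
      (tsupport_smul_subset_right (fun _ => c) a).trans h3⟩

/-- The type of test functions. -/
abbrev Test {d : ℕ} (D : Set (Eucl d)) := ↥(testSpace D)

namespace Test

variable {d : ℕ} {D : Set (Eucl d)}

theorem contDiff (φ : Test D) : ContDiff ℝ ∞ (φ : Eucl d → ℝ) := φ.2.1

theorem compact (φ : Test D) : HasCompactSupport (φ : Eucl d → ℝ) := φ.2.2.1

theorem subset (φ : Test D) : tsupport (φ : Eucl d → ℝ) ⊆ D := φ.2.2.2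

theorem differentiableAt (φ : Test D) (x : Eucl d) : DifferentiableAt ℝ (φ : Eucl d → ℝ) x :=
  φ.contDiff.differentiable (by simp) x

theorem eq_zero (φ : Test D) {x : Eucl d} (hx : x ∉ D) : φ.1 x = 0 :=
  image_eq_zero_of_notMem_tsupport fun h => hx (φ.subset h)

/-- The derivative `∂_i` on test functions. -/
def deriv (i : Fin d) : Test D →ₗ[ℝ] Test D where
  toFun φ := ⟨partialD i φ, contDiff_partialD i φ.contDiff,
    HasCompactSupport.of_support_subset_isCompact φ.compact.isCompact
      (subset_closure.trans (tsupport_partialD_subset i _)),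
    (tsupport_partialD_subset i _).trans φ.subset⟩
  map_add' φ ψ := by
    ext x
    simp only [partialD, Submodule.coe_add]
    rw [fderiv_add (φ.differentiableAt x) (ψ.differentiableAt x)]
    simp [partialD]
  map_smul' c φ := by
    ext x
    simp only [partialD, Submodule.coe_smul]
    rw [fderiv_const_smul (φ.differentiableAt x)]
    simp [partialD]

@[simp]
theorem coe_deriv (i : Fin d) (φ : Test D) : (deriv i φ : Eucl d → ℝ) = partialD i φ := rfl

theorem deriv_comm (i j : Fin d) (φ : Test D) : deriv i (deriv j φ) = deriv j (deriv i φ) :=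
  Subtype.ext (partialD_comm i j φ.contDiff)

/-- The product of a smooth function and a test function. -/
def mul (f : Eucl d → ℝ) (hf : ContDiff ℝ ∞ f) (φ : Test D) : Test D :=
  ⟨fun x => f x * φ.1 x, hf.mul φ.contDiff, φ.compact.mul_left,
    (tsupport_mul_subset_right (f := f)).trans φ.subset⟩

theorem memLp (φ : Test D) (p : ENNReal) (μ : Measure (Eucl d)) [IsFiniteMeasureOnCompacts μ] :
    MemLp (φ : Eucl d → ℝ) p μ :=
  φ.contDiff.continuous.memLp_of_hasCompactSupport φ.compact

/-- A test function as an element of `L²(D)`. -/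
def toL2 : Test D →ₗ[ℝ] L2 D where
  toFun φ := (φ.memLp 2 (volume.restrict D)).toLp φ.1
  map_add' _ _ := rfl
  map_smul' _ _ := rfl

theorem coeFn_toL2 (φ : Test D) : (toL2 φ : Eucl d → ℝ) =ᵐ[volume.restrict D] φ.1 :=
  MemLp.coeFn_toLp (φ.memLp 2 (volume.restrict D))

theorem setIntegral_eq {f : Eucl d → ℝ} (φ : Test D) :
    ∫ x in D, f x * φ.1 x = ∫ x, f x * φ.1 x :=
  setIntegral_eq_integral_of_forall_compl_eq_zero fun x hx => by simp [φ.eq_zero hx]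

theorem inner_toL2 (φ ψ : Test D) : inner ℝ (toL2 φ) (toL2 ψ) = ∫ x, φ.1 x * ψ.1 x := by
  rw [← setIntegral_eq, L2.inner_def]
  refine integral_congr_ae ?_
  filter_upwards [coeFn_toL2 φ, coeFn_toL2 ψ] with x h1 h2
  simp [h1, h2, mul_comm]

/-- The compact support of `ψ` alone makes all products integrable. No support condition on `f` is
wanted, since the identity is also applied to smooth velocity fields that do not vanish on the shell
and to constants. -/
theorem integral_mul_partialD (i : Fin d) {f : Eucl d → ℝ} (hf : ContDiff ℝ 1 f) (ψ : Test D) :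
    ∫ x, f x * partialD i ψ.1 x = - ∫ x, partialD i f x * ψ.1 x := by
  have hc : Continuous (partialD i f) :=
    (hf.continuous_fderiv (by simp)).clm_apply continuous_const
  refine integral_mul_fderiv_eq_neg_fderiv_mul_of_integrable (v := EuclideanSpace.single i 1)
    ?_ ?_ ?_ (fun x _ => hf.differentiable (by simp) x) (fun x _ => ψ.differentiableAt x)
  · exact (hc.mul ψ.contDiff.continuous).integrable_of_hasCompactSupport ψ.compact.mul_left
  · exact (hf.continuous.mul (deriv i ψ).contDiff.continuous).integrable_of_hasCompactSupport
      (deriv i ψ).compact.mul_left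
  · exact (hf.continuous.mul ψ.contDiff.continuous).integrable_of_hasCompactSupport
      ψ.compact.mul_left

/-- Integration by parts. -/
theorem inner_deriv (i : Fin d) (φ ψ : Test D) :
    inner ℝ (toL2 (deriv i φ)) (toL2 ψ) = - inner ℝ (toL2 φ) (toL2 (deriv i ψ)) := by
  rw [inner_toL2, inner_toL2, coe_deriv, coe_deriv,
    integral_mul_partialD i (φ.contDiff.of_le (by simp)) ψ, neg_neg]

end Test

/-! ### Classical derivatives -/

theorem classicalDeriv_zero {d k : ℕ} (φ : Eucl d → ℝ) (h : 0 < k + 1) (I : Fin 0 → Fin d) :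
    classicalDeriv (k := k) φ ⟨⟨0, h⟩, I⟩ = φ := by
  ext x
  simp [classicalDeriv]

/-- The index is appended at the end because the recursion of `iteratedFDeriv` used here applies the
last argument to `fderiv` first. Thus `∂_i` acts on jets by a mere relabelling, without any symmetry
of higher derivatives. -/
theorem classicalDeriv_snoc {d k : ℕ} {φ : Eucl d → ℝ} (hφ : ContDiff ℝ ∞ φ)
    (m : Fin (k + 1)) (I : Fin m → Fin d) (i : Fin d) :
    classicalDeriv (k := k + 1) φ ⟨m.succ, (Fin.snoc I i : Fin (m.1 + 1) → Fin d)⟩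
      = classicalDeriv (k := k) (partialD i φ) ⟨m, I⟩ := by
  ext x
  simp only [classicalDeriv]
  have h1 : partialD i φ =
      (ContinuousLinearMap.apply ℝ ℝ (EuclideanSpace.single i (1 : ℝ) : Eucl d)) ∘ fderiv ℝ φ := by
    ext y; simp [partialD]
  have h2 : ContDiff ℝ ∞ (fderiv ℝ φ) := hφ.fderiv_right (by simp)
  rw [h1, ContinuousLinearMap.iteratedFDeriv_comp_left _ (h2.contDiffAt (x := x))
    (by exact_mod_cast le_top)]
  change iteratedFDeriv ℝ (m.1 + 1) φ x _ = _
  rw [iteratedFDeriv_succ_apply_right]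
  simp only [ContinuousLinearMap.compContinuousMultilinearMap_coe, Function.comp_apply,
    ContinuousLinearMap.apply_apply]
  congr 1
  · congr 1
    ext j
    simp [Fin.init]
  · simp

theorem classicalDeriv_one {d k : ℕ} {φ : Eucl d → ℝ} (hφ : ContDiff ℝ ∞ φ) (h : 1 < k + 1 + 1)
    (i : Fin d) : classicalDeriv (k := k + 1) φ ⟨⟨1, h⟩, fun _ => i⟩ = partialD i φ := by
  rw [← classicalDeriv_zero (k := k) (partialD i φ) (by omega) Fin.elim0,
    ← classicalDeriv_snoc hφ]
  congr 1

theorem contDiff_classicalDeriv {d k : ℕ} {φ : Eucl d → ℝ} (hφ : ContDiff ℝ ∞ φ)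
    (I : JetIdx d k) : Continuous (classicalDeriv φ I) := by
  have h := hφ.continuous_iteratedFDeriv (m := I.1) (by exact_mod_cast le_top)
  exact (ContinuousMultilinearMap.apply ℝ (fun _ : Fin I.1 => Eucl d) ℝ
    (fun j => EuclideanSpace.single (I.2 j) 1)).continuous.comp h

theorem support_classicalDeriv_subset {d k : ℕ} (φ : Eucl d → ℝ) (I : JetIdx d k) :
    Function.support (classicalDeriv φ I) ⊆ tsupport φ := by
  intro x hx
  refine support_iteratedFDeriv_subset (𝕜 := ℝ) (n := I.1) (fun h => hx ?_)
  simp [classicalDeriv, h]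

theorem classicalDeriv_add {d k : ℕ} {φ ψ : Eucl d → ℝ} (hφ : ContDiff ℝ ∞ φ)
    (hψ : ContDiff ℝ ∞ ψ) (I : JetIdx d k) :
    classicalDeriv (φ + ψ) I = classicalDeriv φ I + classicalDeriv ψ I := by
  ext x
  simp only [classicalDeriv, Pi.add_apply]
  rw [iteratedFDeriv_add (hφ.of_le (by exact_mod_cast le_top))
    (hψ.of_le (by exact_mod_cast le_top))]
  rfl

theorem classicalDeriv_smul {d k : ℕ} {φ : Eucl d → ℝ} (hφ : ContDiff ℝ ∞ φ) (c : ℝ)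
    (I : JetIdx d k) : classicalDeriv (c • φ) I = c • classicalDeriv φ I := by
  ext x
  simp only [classicalDeriv, Pi.smul_apply]
  rw [iteratedFDeriv_const_smul_apply (hφ.contDiffAt.of_le (by exact_mod_cast le_top))]
  rfl

/-! ### Jets of test functions -/

namespace Test

variable {d : ℕ} {D : Set (Eucl d)}

theorem memLp_classicalDeriv {k : ℕ} (φ : Test D) (I : JetIdx d k) :
    MemLp (classicalDeriv φ.1 I) 2 (volume.restrict D) :=
  (contDiff_classicalDeriv φ.contDiff I).memLp_of_hasCompactSupport
    (HasCompactSupport.of_support_subset_isCompact φ.compact.isCompact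
      (support_classicalDeriv_subset _ I))

/-- A test function as an element of `H^k_0(D)`. -/
def jet (k : ℕ) : Test D →ₗ[ℝ] H0 k D where
  toFun φ := ⟨WithLp.toLp 2 fun I => (φ.memLp_classicalDeriv I).toLp _,
    Submodule.le_topologicalClosure _ (Submodule.subset_span
      ⟨φ.1, φ.contDiff, φ.compact, φ.subset, fun I => MemLp.coeFn_toLp (φ.memLp_classicalDeriv I)⟩)⟩
  map_add' φ ψ := by
    ext1
    refine PiLp.ext fun I => ?_
    refine (MemLp.toLp_congr (Test.memLp_classicalDeriv _ I) ((φ.memLp_classicalDeriv I).add (ψ.memLp_classicalDeriv I)) ?_)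
    exact Filter.Eventually.of_forall fun x =>
      congrFun (classicalDeriv_add φ.contDiff ψ.contDiff I) x
  map_smul' c φ := by
    ext1
    refine PiLp.ext fun I => ?_
    refine (MemLp.toLp_congr (Test.memLp_classicalDeriv _ I) ((φ.memLp_classicalDeriv I).const_smul c) ?_)
    exact Filter.Eventually.of_forall fun x => congrFun (classicalDeriv_smul φ.contDiff c I) x

theorem isJetOf_jet (k : ℕ) (φ : Test D) : IsJetOf φ.1 (jet k φ).1 :=
  fun I => MemLp.coeFn_toLp (φ.memLp_classicalDeriv I)

theorem eq_jet {k : ℕ} (φ : Test D) {U : Jet k D} (h : IsJetOf φ.1 U) : U = (jet k φ).1 :=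
  PiLp.ext fun I => Lp.ext ((h I).trans (isJetOf_jet k φ I).symm)

end Test

/-- Jets of test functions already form a subspace, so the span in the definition of `H0` adds
nothing. -/
theorem H0_eq_closure_range {d : ℕ} (k : ℕ) (D : Set (Eucl d)) :
    (H0 k D : Set (Jet k D)) = closure (range fun φ : Test D => (Test.jet k φ).1) := by
  have h : Submodule.span ℝ (testJets k D)
      = LinearMap.range ((H0 k D).subtype ∘ₗ (Test.jet k : Test D →ₗ[ℝ] H0 k D)) := by
    apply le_antisymm
    · rw [Submodule.span_le]
      rintro U ⟨φ, h1, h2, h3, h4⟩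
      exact ⟨⟨φ, h1, h2, h3⟩, (Test.eq_jet ⟨φ, h1, h2, h3⟩ h4).symm⟩
    · rintro _ ⟨φ, rfl⟩
      exact Submodule.subset_span ⟨φ.1, φ.contDiff, φ.compact, φ.subset, Test.isJetOf_jet k φ⟩
  change ((Submodule.span ℝ (testJets k D)).topologicalClosure : Set (Jet k D)) = _
  rw [h, Submodule.topologicalClosure_coe]
  rfl

/-- This is the tool for nearly every fact about `H0` below: identities and inequalities between
continuous expressions need only be checked on test functions. -/
theorem denseRange_jet {d : ℕ} (k : ℕ) (D : Set (Eucl d)) :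
    DenseRange (Test.jet k : Test D → H0 k D) := by
  intro U
  rw [closure_subtype, ← range_comp]
  have := U.2
  rw [← SetLike.mem_coe, H0_eq_closure_range] at this
  exact this

instance {d : ℕ} (k : ℕ) (D : Set (Eucl d)) : CompleteSpace (H0 k D) :=
  (Submodule.isClosed_topologicalClosure _).completeSpace_coe

/-! ### Continuous operations on `H^k_0` -/

section Operations

variable {d k : ℕ} {D : Set (Eucl d)}

/-- The function underlying an element of `H^k_0(D)`. -/
def fnL : H0 k D →L[ℝ] L2 D :=
  (PiLp.proj 2 (fun _ : JetIdx d k => L2 D) ⟨⟨0, by omega⟩, Fin.elim0⟩ : Jet k D →L[ℝ] L2 D)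
    ∘L (H0 k D).subtypeL

theorem fnL_jet (φ : Test D) : fnL (Test.jet k φ) = Test.toL2 φ := by
  refine MemLp.toLp_congr (φ.memLp_classicalDeriv _) (φ.memLp 2 (volume.restrict D)) (Filter.Eventually.of_forall fun x => ?_)
  rw [classicalDeriv_zero]

/-- The operation on jets that is induced by `∂_i`. -/
def jetShift (i : Fin d) : Jet (k + 1) D →L[ℝ] Jet k D where
  toFun U := WithLp.toLp 2 fun I => U ⟨I.1.succ, (Fin.snoc I.2 i : Fin (I.1.1 + 1) → Fin d)⟩
  map_add' _ _ := rfl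
  map_smul' _ _ := rfl
  cont := by
    refine (PiLp.continuous_toLp 2 _).comp (continuous_pi fun I => ?_)
    fun_prop

theorem jetShift_jet (i : Fin d) (φ : Test D) :
    jetShift i (Test.jet (k + 1) φ).1 = (Test.jet k (Test.deriv i φ)).1 := by
  refine Test.eq_jet _ fun I => ?_
  refine (Test.isJetOf_jet (k + 1) φ _).trans (Filter.Eventually.of_forall fun x => ?_)
  exact congrFun (classicalDeriv_snoc φ.contDiff I.1 I.2 i) x

theorem jetShift_mem (i : Fin d) (U : H0 (k + 1) D) : jetShift i U.1 ∈ H0 k D := by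
  refine (denseRange_jet (k + 1) D).induction_on (p := fun U => jetShift i U.1 ∈ H0 k D) U ?_ ?_
  · exact (Submodule.isClosed_topologicalClosure _).preimage
      ((jetShift i).continuous.comp continuous_subtype_val)
  · intro φ
    rw [jetShift_jet]
    exact Subtype.property _

/-- The derivative `∂_i : H^{k+1}_0(D) → H^k_0(D)`. -/
def shift (i : Fin d) : H0 (k + 1) D →L[ℝ] H0 k D :=
  ((jetShift i).comp (H0 (k + 1) D).subtypeL).codRestrict (H0 k D) (jetShift_mem i)

theorem shift_jet (i : Fin d) (φ : Test D) :
    shift i (Test.jet (k + 1) φ) = Test.jet k (Test.deriv i φ) :=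
  Subtype.ext (jetShift_jet i φ)

theorem pd_eq (U : H0 (k + 1) D) (i : Fin d) : U.1.pd i = fnL (shift i U) := by
  refine congrArg U.1.ofLp (Sigma.ext rfl (heq_of_eq ?_))
  ext j
  fin_cases j; rfl

theorem snd_eq (U : H0 (k + 2) D) (i : Fin d) :
    U.1 ⟨⟨2, by omega⟩, fun _ => i⟩ = fnL (shift i (shift i U)) := by
  refine congrArg U.1.ofLp (Sigma.ext rfl (heq_of_eq ?_))
  ext j
  fin_cases j <;> rfl

/-- The inclusion `H^{k+1}_0(D) → H^k_0(D)` as a continuous linear map. -/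
def lowerL : H0 (k + 1) D →L[ℝ] H0 k D :=
  ((Jet.lower : Jet (k + 1) D →L[ℝ] Jet k D).comp (H0 (k + 1) D).subtypeL).codRestrict (H0 k D)
    fun U => lower_mem_H0 U.2

theorem norm_component_le_zero (U : H0 0 D) (I : JetIdx d 0) : ‖U.1 I‖ ≤ ‖fnL U‖ := by
  obtain ⟨⟨m, hm⟩, I⟩ := I
  obtain rfl : m = 0 := by omega
  obtain rfl : I = Fin.elim0 := Subsingleton.elim _ _
  exact le_rfl

/-- A derivative of positive order whose last index is `i` is a component of `∂_i U`. This permits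
induction on the order of the jet. -/
theorem norm_component_le_succ (U : H0 (k + 1) D) (I : JetIdx d (k + 1)) :
    ‖U.1 I‖ ≤ ‖fnL U‖ + ∑ i, ‖shift i U‖ := by
  have hs : ∀ i, ‖shift i U‖ ≤ ∑ i, ‖shift i U‖ := fun i =>
    Finset.single_le_sum (f := fun i => ‖shift i U‖) (fun _ _ => norm_nonneg _) (Finset.mem_univ i)
  obtain ⟨⟨m, hm⟩, I⟩ := I
  cases m with
  | zero =>
    obtain rfl : I = Fin.elim0 := Subsingleton.elim _ _
    exact le_add_of_nonneg_right (Finset.sum_nonneg fun _ _ => norm_nonneg _)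
  | succ m =>
    have h1 := PiLp.norm_apply_le (shift (I (Fin.last m)) U).1
      (⟨⟨m, by omega⟩, Fin.init I⟩ : JetIdx d k)
    have h2 : (shift (I (Fin.last m)) U).1 (⟨⟨m, by omega⟩, Fin.init I⟩ : JetIdx d k)
        = U.1 ⟨⟨m + 1, hm⟩, I⟩ := by
      exact congrArg U.1.ofLp (Sigma.ext rfl (heq_of_eq (Fin.snoc_init_self I)))
    rw [h2] at h1
    exact h1.trans ((hs _).trans (le_add_of_nonneg_left (norm_nonneg _)))

theorem norm_le_card_mul {U : Jet k D} {M : ℝ} (h : ∀ I, ‖U I‖ ≤ M) :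
    ‖U‖ ≤ Fintype.card (JetIdx d k) * M := by
  have h1 : ‖U‖ ≤ ∑ I, ‖U I‖ := by
    rw [PiLp.norm_eq_of_L2, Real.sqrt_le_left (Finset.sum_nonneg fun _ _ => norm_nonneg _)]
    exact Finset.sum_sq_le_sq_sum_of_nonneg fun _ _ => norm_nonneg _
  refine h1.trans ((Finset.sum_le_sum fun I _ => h I).trans ?_)
  simp

theorem norm_le_zero (U : H0 0 D) : ‖U‖ ≤ Fintype.card (JetIdx d 0) * ‖fnL U‖ :=
  norm_le_card_mul (norm_component_le_zero U)

theorem norm_le_succ (U : H0 (k + 1) D) :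
    ‖U‖ ≤ Fintype.card (JetIdx d (k + 1)) * (‖fnL U‖ + ∑ i, ‖shift i U‖) :=
  norm_le_card_mul (norm_component_le_succ U)

end Operations

end

end FluidShell

namespace FluidShell

noncomputable section

/-! ### Integration by parts and Poincaré inequality on `H^k_0` -/

section Identities

variable {d k l : ℕ} {D : Set (Eucl d)}

/-- Density in each argument separately reduces this to test functions. The orders `k` and `l` are
independent because only the underlying `L²` functions enter, which allows pairing functions of
different regularity. -/
theorem inner_shift_left (i : Fin d) (u : H0 (k + 1) D) (v : H0 (l + 1) D) :
    inner ℝ (fnL (shift i u)) (fnL v) = - inner ℝ (fnL u) (fnL (shift i v)) := by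
  refine (denseRange_jet (k + 1) D).induction_on
    (p := fun u => inner ℝ (fnL (shift i u)) (fnL v) = - inner ℝ (fnL u) (fnL (shift i v))) u
    (isClosed_eq (by fun_prop) (by fun_prop)) fun φ => ?_
  refine (denseRange_jet (l + 1) D).induction_on
    (p := fun v => inner ℝ (fnL (shift i (Test.jet (k + 1) φ))) (fnL v)
      = - inner ℝ (fnL (Test.jet (k + 1) φ)) (fnL (shift i v))) v
    (isClosed_eq (by fun_prop) (by fun_prop)) fun ψ => ?_
  simp only [shift_jet, fnL_jet]
  exact Test.inner_deriv i φ ψ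

theorem shift_comm (i j : Fin d) (u : H0 (k + 2) D) :
    shift i (shift j u) = shift j (shift i u) := by
  refine (denseRange_jet (k + 2) D).induction_on
    (p := fun u => shift i (shift j u) = shift j (shift i u)) u
    (isClosed_eq (by fun_prop) (by fun_prop)) fun φ => ?_
  simp only [shift_jet, Test.deriv_comm i j]

/-- `(∂_i u, ∂_j v) = (∂_j u, ∂_i v)`. -/
theorem inner_shift_symm (i j : Fin d) (u : H0 (k + 1) D) (v : H0 (l + 1) D) :
    inner ℝ (fnL (shift i u)) (fnL (shift j v)) = inner ℝ (fnL (shift j u)) (fnL (shift i v)) := by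
  refine (denseRange_jet (l + 1) D).induction_on
    (p := fun v => inner ℝ (fnL (shift i u)) (fnL (shift j v))
      = inner ℝ (fnL (shift j u)) (fnL (shift i v))) v
    (isClosed_eq (by fun_prop) (by fun_prop)) fun ψ => ?_
  -- Only `v` is taken smooth, since `u` may have a single derivative. Both sides become −(u, second
  -- derivative of ψ), and second derivatives of ψ commute; regarding `∂_m ψ` as an element of `H¹₀`
  -- lets `inner_shift_left` apply once more.
  have h : ∀ m, fnL (shift m (Test.jet (l + 1) ψ)) = fnL (Test.jet 1 (Test.deriv m ψ)) := by
    intro m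
    rw [shift_jet, fnL_jet, fnL_jet]
  rw [h, h, inner_shift_left, inner_shift_left, shift_jet, shift_jet, Test.deriv_comm]

theorem exists_abs_coord_le (hD : Bornology.IsBounded D) :
    ∃ R : ℝ, 0 < R ∧ ∀ x ∈ D, ∀ i, |x i| ≤ R := by
  obtain ⟨R, hR, h⟩ := hD.exists_pos_norm_le
  exact ⟨R, hR, fun x hx i => (PiLp.norm_apply_le x i).trans (h x hx)⟩

/-- The Poincaré inequality. -/
theorem exists_poincare (hD : Bornology.IsBounded D) :
    ∃ C : ℝ, 0 < C ∧ ∀ (i : Fin d) (u : H0 (k + 1) D), ‖fnL u‖ ≤ C * ‖fnL (shift i u)‖ := by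
  obtain ⟨R, hR, hRD⟩ := exists_abs_coord_le hD
  refine ⟨2 * R, by positivity, fun i u => ?_⟩
  refine (denseRange_jet (k + 1) D).induction_on
    (p := fun u => ‖fnL u‖ ≤ 2 * R * ‖fnL (shift i u)‖) u
    (isClosed_le (by fun_prop) (by fun_prop)) fun φ => ?_
  simp only [shift_jet, fnL_jet]
  -- With ψ = x_i φ one has ∂_i ψ = φ + x_i ∂_i φ, so integration by parts gives ‖φ‖² = −2(x_i φ,
  -- ∂_i φ). The bound |x_i| ≤ R on `D` produces the constant 2R.
  set ψ : Test D := Test.mul (fun x => x i) (contDiff_coord i) φ with hψ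
  have h1 := Test.inner_deriv i ψ φ
  have h2 : Test.deriv i ψ = φ + Test.mul (fun x => x i) (contDiff_coord i) (Test.deriv i φ) := by
    ext x
    have := partialD_mul i (φ := fun y : Eucl d => y i) (ψ := φ.1) (x := x)
      ((contDiff_coord (n := 1) i).differentiable (by simp) x) (φ.differentiableAt x)
    rw [partialD_coord] at this
    simpa [Test.mul, hψ] using this
  have h3 : inner ℝ (Test.toL2 (Test.mul (fun x => x i) (contDiff_coord i) (Test.deriv i φ)))
      (Test.toL2 φ) = inner ℝ (Test.toL2 ψ) (Test.toL2 (Test.deriv i φ)) := by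
    rw [Test.inner_toL2, Test.inner_toL2]
    congr 1
    ext x
    simp [hψ, Test.mul]
    ring
  rw [h2, map_add, inner_add_left, h3, real_inner_self_eq_norm_sq] at h1
  have h4 : ‖Test.toL2 ψ‖ ≤ R * ‖Test.toL2 φ‖ := by
    refine Lp.norm_le_mul_norm_of_ae_le_mul ?_
    filter_upwards [Test.coeFn_toL2 φ, Test.coeFn_toL2 ψ] with x e1 e2
    rw [e1, e2]
    by_cases hx : x ∈ D
    · simp only [hψ, Test.mul, norm_mul]
      exact mul_le_mul_of_nonneg_right (hRD x hx i) (norm_nonneg _)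
    · simp [ψ.eq_zero hx, φ.eq_zero hx]
  have h5 := abs_real_inner_le_norm (Test.toL2 ψ) (Test.toL2 (Test.deriv i φ))
  have h6 : ‖Test.toL2 φ‖ * ‖Test.toL2 φ‖
      ≤ 2 * R * ‖Test.toL2 (Test.deriv i φ)‖ * ‖Test.toL2 φ‖ := by
    have := (abs_le.1 h5).1
    have h7 := mul_le_mul_of_nonneg_right h4 (norm_nonneg (Test.toL2 (Test.deriv i φ)))
    nlinarith
  by_contra hlt
  push Not at hlt
  have h8 : 0 < ‖Test.toL2 φ‖ := lt_of_le_of_lt (by positivity) hlt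
  nlinarith

/-- The Laplacian `H^{k+2}_0(D) → L²(D)`. -/
def lapL : H0 (k + 2) D →L[ℝ] L2 D := ∑ i : Fin d, fnL ∘L shift i ∘L shift i

theorem lapL_apply (u : H0 (k + 2) D) : lapL u = ∑ i : Fin d, fnL (shift i (shift i u)) := by
  simp [lapL]

/-- Exchanging one derivative between the factors turns (∂_i²u, ∂_j²u) into ‖∂_i∂_j u‖². Hence the
Laplacian controls all second derivatives on `H²₀` without any elliptic regularity of the boundary.
-/
theorem norm_lapL_sq (u : H0 (k + 2) D) :
    ‖lapL u‖ ^ 2 = ∑ i : Fin d, ∑ j : Fin d, ‖fnL (shift i (shift j u))‖ ^ 2 := by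
  rw [← real_inner_self_eq_norm_sq, lapL_apply, sum_inner]
  refine Finset.sum_congr rfl fun i _ => ?_
  rw [inner_sum]
  refine Finset.sum_congr rfl fun j _ => ?_
  rw [inner_shift_symm, shift_comm j i, real_inner_self_eq_norm_sq]

theorem norm_fnL_shift_shift_le (i j : Fin d) (u : H0 (k + 2) D) :
    ‖fnL (shift i (shift j u))‖ ≤ ‖lapL u‖ := by
  rw [← pow_le_pow_iff_left₀ (norm_nonneg _) (norm_nonneg _) two_ne_zero, norm_lapL_sq]
  refine le_trans ?_ (Finset.single_le_sum (f := fun i => ∑ j, ‖fnL (shift i (shift j u))‖ ^ 2)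
    (fun _ _ => Finset.sum_nonneg fun _ _ => sq_nonneg _) (Finset.mem_univ i))
  exact Finset.single_le_sum (f := fun j => ‖fnL (shift i (shift j u))‖ ^ 2)
    (fun _ _ => sq_nonneg _) (Finset.mem_univ j)

/-- From ‖∂_i u‖² = −(u, ∂_i²u). This interpolation upgrades compactness of `H²₀ → L²` to
compactness of `H²₀ → H¹₀`. -/
theorem norm_shift_sq_le (i : Fin d) (u : H0 (k + 2) D) :
    ‖fnL (shift i u)‖ ^ 2 ≤ ‖fnL u‖ * ‖lapL u‖ := by
  rw [← real_inner_self_eq_norm_sq, inner_shift_left, ← inner_neg_left]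
  refine (real_inner_le_norm _ _).trans ?_
  rw [norm_neg]
  exact mul_le_mul_of_nonneg_left (norm_fnL_shift_shift_le i i u) (norm_nonneg _)

/-- On `H^1_0` of a bounded set the gradient controls the norm. -/
theorem exists_norm_le_grad [NeZero d] (hD : Bornology.IsBounded D) :
    ∃ C : ℝ, 0 < C ∧ ∀ u : H0 1 D, ‖u‖ ≤ C * ∑ i, ‖fnL (shift i u)‖ := by
  obtain ⟨C, hC, h⟩ := exists_poincare (k := 0) hD
  refine ⟨Fintype.card (JetIdx d 1) * (C + Fintype.card (JetIdx d 0)) + 1, by positivity,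
    fun u => ?_⟩
  set S := ∑ i, ‖fnL (shift i u)‖ with hS
  have hS0 : 0 ≤ S := Finset.sum_nonneg fun _ _ => norm_nonneg _
  have h1 : ‖fnL u‖ ≤ C * S := (h 0 u).trans (mul_le_mul_of_nonneg_left
    (Finset.single_le_sum (f := fun i => ‖fnL (shift i u)‖) (fun _ _ => norm_nonneg _)
      (Finset.mem_univ 0)) hC.le)
  have h2 : ∑ i, ‖shift i u‖ ≤ Fintype.card (JetIdx d 0) * S := by
    rw [hS, Finset.mul_sum]
    exact Finset.sum_le_sum fun i _ => norm_le_zero _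
  calc ‖u‖ ≤ Fintype.card (JetIdx d 1) * (‖fnL u‖ + ∑ i, ‖shift i u‖) := norm_le_succ u
    _ ≤ Fintype.card (JetIdx d 1) * (C * S + Fintype.card (JetIdx d 0) * S) := by gcongr
    _ ≤ _ := by nlinarith

/-- On `H^2_0` of a bounded set the Laplacian controls the norm. -/
theorem exists_norm_le_lapL [NeZero d] (hD : Bornology.IsBounded D) :
    ∃ C : ℝ, 0 < C ∧ ∀ u : H0 2 D, ‖u‖ ≤ C * ‖lapL u‖ := by
  obtain ⟨C, hC, h⟩ := exists_norm_le_grad hD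
  obtain ⟨C', hC', h'⟩ := exists_poincare (k := 1) hD
  refine ⟨Fintype.card (JetIdx d 2) * (C' * (C * d) + d * (C * d)) + 1, by positivity,
    fun u => ?_⟩
  have h1 : ∀ i, ‖shift i u‖ ≤ C * d * ‖lapL u‖ := by
    intro i
    refine (h _).trans ?_
    rw [mul_assoc]
    refine mul_le_mul_of_nonneg_left ?_ hC.le
    refine (Finset.sum_le_sum fun j _ => norm_fnL_shift_shift_le j i u).trans ?_
    simp
  have hf : ‖fnL (shift 0 u)‖ ≤ ‖shift 0 u‖ :=
    PiLp.norm_apply_le (shift 0 u).1 (⟨⟨0, by omega⟩, Fin.elim0⟩ : JetIdx d 1)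
  have h2 : ‖fnL u‖ ≤ C' * (C * d * ‖lapL u‖) :=
    (h' 0 u).trans (mul_le_mul_of_nonneg_left (hf.trans (h1 0)) hC'.le)
  have h3 : ∑ i, ‖shift i u‖ ≤ d * (C * d * ‖lapL u‖) :=
    (Finset.sum_le_sum fun i _ => h1 i).trans (by simp)
  calc ‖u‖ ≤ Fintype.card (JetIdx d 2) * (‖fnL u‖ + ∑ i, ‖shift i u‖) := norm_le_succ u
    _ ≤ Fintype.card (JetIdx d 2) * (C' * (C * d * ‖lapL u‖) + d * (C * d * ‖lapL u‖)) := by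
      gcongr
    _ ≤ _ := by nlinarith [norm_nonneg (lapL u)]

end Identities

/-! ### Ladyzhenskaya's inequality -/

section Ladyzhenskaya

open scoped NNReal ENNReal

theorem norm_fderiv_le_sum {d : ℕ} (φ : Eucl d → ℝ) (x : Eucl d) :
    ‖fderiv ℝ φ x‖ ≤ ∑ i, ‖partialD i φ x‖ := by
  refine ContinuousLinearMap.opNorm_le_bound _ (Finset.sum_nonneg fun _ _ => norm_nonneg _) ?_
  intro v
  have hv : v = ∑ i, v i • EuclideanSpace.single i (1 : ℝ) := by
    ext j
    simp [Pi.single_apply]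
  conv_lhs => rw [hv, map_sum]
  rw [Finset.sum_mul]
  refine (norm_sum_le _ _).trans (Finset.sum_le_sum fun i _ => ?_)
  rw [map_smul, norm_smul, mul_comm]
  exact mul_le_mul_of_nonneg_left (PiLp.norm_apply_le v i) (norm_nonneg _)

variable {D : Set (Eucl 2)}

theorem Test.eLpNorm_restrict_eq {d : ℕ} {D : Set (Eucl d)} (φ : Test D) (p : ℝ≥0∞) :
    eLpNorm φ.1 p (volume.restrict D) = eLpNorm φ.1 p volume :=
  eLpNorm_restrict_eq_of_support_subset (subset_closure.trans φ.subset)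

theorem Test.enorm_toL2 {d : ℕ} {D : Set (Eucl d)} (φ : Test D) :
    ‖Test.toL2 φ‖ₑ = eLpNorm φ.1 2 volume := by
  rw [Lp.enorm_def, eLpNorm_congr_ae φ.coeFn_toL2, φ.eLpNorm_restrict_eq]

/-- The Gagliardo–Nirenberg–Sobolev inequality ‖f‖_{L²} ≤ C‖∇f‖_{L¹} of the plane is applied to f =
φ². Since ∇(φ²) = 2φ∇φ, the Cauchy–Schwarz inequality bounds the right side. -/
theorem exists_ladyzhenskaya_test : ∃ C : ℝ≥0, ∀ (D : Set (Eucl 2)) (φ : Test D),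
    eLpNorm φ.1 4 (volume.restrict D) ^ 2
      ≤ C * ‖Test.toL2 φ‖ₑ * ∑ i, ‖Test.toL2 (Test.deriv i φ)‖ₑ := by
  refine ⟨2 * eLpNormLESNormFDerivOneConst (volume : Measure (Eucl 2)) (2 : ℝ≥0), fun D φ => ?_⟩
  have hc : NNReal.HolderConjugate (Module.finrank ℝ (Eucl 2)) (2 : ℝ≥0) := by
    rw [finrank_euclideanSpace_fin]
    exact_mod_cast NNReal.HolderConjugate.two_two
  have h0 := eLpNorm_le_eLpNorm_fderiv_one (volume : Measure (Eucl 2)) (u := fun x => φ.1 x ^ 2)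
    ((φ.contDiff.of_le (by simp)).pow 2) (φ.compact.comp_left (g := fun t => t ^ 2) (by simp)) hc
  have h1 : eLpNorm (fun x => φ.1 x ^ 2) 2 volume = eLpNorm φ.1 4 volume ^ 2 := by
    have := eLpNorm_norm_rpow (μ := (volume : Measure (Eucl 2))) (p := 2) φ.1
      (q := 2) (by norm_num)
    rw [show (2 : ℝ≥0∞) * ENNReal.ofReal 2 = 4 by norm_num] at this
    rw [← ENNReal.rpow_natCast, Nat.cast_two, ← this]
    refine eLpNorm_congr_norm_ae (Filter.Eventually.of_forall fun x => ?_)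
    simp
  have h2 : eLpNorm (fderiv ℝ fun x => φ.1 x ^ 2) 1 volume
      ≤ 2 * ∑ i, eLpNorm φ.1 2 volume * eLpNorm (Test.deriv i φ).1 2 volume := by
    have e1 : ∀ x, ‖fderiv ℝ (fun x => φ.1 x ^ 2) x‖ₑ
        ≤ ∑ i, 2 * (‖φ.1 x‖ₑ * ‖(Test.deriv i φ).1 x‖ₑ) := by
      intro x
      have : fderiv ℝ (fun x => φ.1 x ^ 2) x = (2 * φ.1 x) • fderiv ℝ φ.1 x := by
        rw [fderiv_fun_pow _ (φ.differentiableAt x)]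
        simp
      rw [this, enorm_smul, ← Finset.mul_sum, ← Finset.mul_sum, enorm_mul, mul_assoc,
        show ‖(2 : ℝ)‖ₑ = 2 by simp [enorm_eq_nnnorm]]
      gcongr
      have := norm_fderiv_le_sum φ.1 x
      simp only [enorm_eq_nnnorm, Test.coe_deriv]
      exact_mod_cast this
    rw [eLpNorm_one_eq_lintegral_enorm]
    refine (lintegral_mono e1).trans ?_
    have hm : ∀ ψ : Test D, Measurable fun x => ‖ψ.1 x‖ₑ := fun ψ =>
      ψ.contDiff.continuous.measurable.enorm
    have hm2 : ∀ i, Measurable fun x => ‖φ.1 x‖ₑ * ‖(Test.deriv i φ).1 x‖ₑ := fun i =>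
      (hm φ).mul (hm _)
    rw [lintegral_finsetSum _ fun i _ => (hm2 i).const_mul 2, Finset.mul_sum]
    refine Finset.sum_le_sum fun i _ => ?_
    rw [lintegral_const_mul _ (hm2 i)]
    gcongr
    have := eLpNorm_smul_le_mul_eLpNorm (p := 2) (q := 2) (r := 1)
      (μ := (volume : Measure (Eucl 2)))
      (Test.deriv i φ).contDiff.continuous.aestronglyMeasurable
      φ.contDiff.continuous.aestronglyMeasurable
    rw [eLpNorm_one_eq_lintegral_enorm] at this
    refine le_trans (le_of_eq ?_) this
    congr 1
    ext x
    simp [enorm_mul]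
  rw [φ.eLpNorm_restrict_eq, ← h1]
  simp only [Test.enorm_toL2]
  refine h0.trans ((mul_le_mul_right h2 _).trans (le_of_eq ?_))
  rw [← Finset.mul_sum]
  push_cast
  ring

/-- Fatou's lemma along an almost everywhere convergent subsequence. The `L^p` norm is only lower
semicontinuous for convergence in `L²`, which is enough for passing upper bounds to the limit. -/
theorem eLpNorm_le_of_tendsto {d : ℕ} {D : Set (Eucl d)} {p : ℝ≥0∞} {f : ℕ → L2 D} {g : L2 D}
    (hf : Filter.Tendsto f Filter.atTop (nhds g)) {b : ℕ → ℝ≥0∞} {B : ℝ≥0∞}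
    (hb : Filter.Tendsto b Filter.atTop (nhds B))
    (h : ∀ n, eLpNorm (f n) p (volume.restrict D) ≤ b n) :
    eLpNorm g p (volume.restrict D) ≤ B := by
  obtain ⟨ns, hns, hae⟩ := (tendstoInMeasure_of_tendsto_Lp hf).exists_seq_tendsto_ae
  have h1 := Lp.eLpNorm_lim_le_liminf_eLpNorm (p := p) (f := fun n => ⇑(f (ns n)))
    (fun n => (Lp.aestronglyMeasurable _)) _ hae
  rw [← (hb.comp hns.tendsto_atTop).liminf_eq]
  exact h1.trans (Filter.liminf_le_liminf (Filter.Eventually.of_forall fun n => h (ns n)))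

theorem exists_ladyzhenskaya : ∃ C : ℝ≥0, ∀ (D : Set (Eucl 2)) (k : ℕ) (u : H0 (k + 1) D),
    eLpNorm (fnL u) 4 (volume.restrict D) ^ 2 ≤
      (C * ‖fnL u‖₊ * ∑ i, ‖fnL (shift i u)‖₊ : ℝ≥0) := by
  obtain ⟨C, hC⟩ := exists_ladyzhenskaya_test
  refine ⟨C, fun D k u => ?_⟩
  obtain ⟨x, hx, hxu⟩ := mem_closure_iff_seq_limit.1 ((denseRange_jet (k + 1) D) u)
  choose φ hφ using hx
  -- The square root of the right side is a continuous bound of the `L⁴` norm itself, as the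
  -- semicontinuity lemma requires.
  let B : H0 (k + 1) D → ℝ≥0 := fun u => NNReal.sqrt (C * ‖fnL u‖₊ * ∑ i, ‖fnL (shift i u)‖₊)
  have hB : Continuous B := NNReal.continuous_sqrt.comp (by fun_prop)
  have hBsq : ∀ u, B u ^ 2 = C * ‖fnL u‖₊ * ∑ i, ‖fnL (shift i u)‖₊ := fun u => NNReal.sq_sqrt _
  rw [← hBsq u, ENNReal.coe_pow]
  refine pow_le_pow_left₀ zero_le ?_ 2
  refine eLpNorm_le_of_tendsto (f := fun n => fnL (x n)) (b := fun n => (B (x n) : ℝ≥0∞))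
    ((fnL.continuous.tendsto u).comp hxu)
    (((ENNReal.continuous_coe.comp hB).tendsto u).comp hxu) fun n => ?_
  refine (ENNReal.pow_le_pow_left_iff two_ne_zero).1 ?_
  rw [← ENNReal.coe_pow, hBsq, ← hφ n]
  simp only [shift_jet, fnL_jet]
  rw [eLpNorm_congr_ae (φ n).coeFn_toL2]
  refine (hC D (φ n)).trans (le_of_eq ?_)
  push_cast
  rfl

/-- Elements of `H^1_0(D)` are in `L⁴(D)`. -/
theorem memLp_four {k : ℕ} (u : H0 (k + 1) D) : MemLp (fnL u) 4 (volume.restrict D) := by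
  obtain ⟨C, hC⟩ := exists_ladyzhenskaya
  refine ⟨Lp.aestronglyMeasurable _, ?_⟩
  have h := (hC D k u).trans_lt ENNReal.coe_lt_top
  exact (ENNReal.pow_lt_top_iff.1 h).resolve_right two_ne_zero

end Ladyzhenskaya

end

end FluidShell

namespace FluidShell

noncomputable section

/-! ### Weak convergence of sequences in Hilbert spaces -/

section Weak

variable {H G : Type*} [NormedAddCommGroup H] [InnerProductSpace ℝ H]
  [NormedAddCommGroup G] [InnerProductSpace ℝ G]

open Filter Topology

/-- Weak convergence of a sequence. -/
def WeakTendsto (x : ℕ → H) (a : H) :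
    Prop :=
  ∀ y, Tendsto (fun n => inner ℝ (x n) y) atTop (𝓝 (inner ℝ a y))

/-- The sequential Banach–Alaoglu theorem in the dual of a separable space, transported by the Riesz
isometry. -/
theorem exists_subseq_weakTendsto [CompleteSpace H] [TopologicalSpace.SeparableSpace H] {x : ℕ → H} {R : ℝ}
    (hx : ∀ n, ‖x n‖ ≤ R) : ∃ a, ∃ ns : ℕ → ℕ, StrictMono ns ∧ WeakTendsto (x ∘ ns) a := by
  have h := WeakDual.isSeqCompact_closedBall ℝ H 0 R
  obtain ⟨f, -, ns, hns, hf⟩ := h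
    (x := fun n => StrongDual.toWeakDual (InnerProductSpace.toDual ℝ H (x n))) fun n => by
      simpa using hx n
  refine ⟨(InnerProductSpace.toDual ℝ H).symm (WeakDual.toStrongDual f), ns, hns, fun y => ?_⟩
  have := (WeakBilin.eval_continuous _ y).continuousAt.tendsto.comp hf
  rw [InnerProductSpace.toDual_symm_apply]
  exact this

theorem WeakTendsto.comp_subseq {x : ℕ → H} {a : H} (h : WeakTendsto x a) {ns : ℕ → ℕ}
    (hns : StrictMono ns) : WeakTendsto (x ∘ ns) a :=
  fun y => (h y).comp hns.tendsto_atTop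

theorem WeakTendsto.map [CompleteSpace H] [CompleteSpace G] {x : ℕ → H} {a : H} (h : WeakTendsto x a) (L : H →L[ℝ] G) :
    WeakTendsto (fun n => L (x n)) (L a) := fun y => by
  simpa only [ContinuousLinearMap.adjoint_inner_right] using h (ContinuousLinearMap.adjoint L y)

theorem WeakTendsto.apply_dual [CompleteSpace H] {x : ℕ → H} {a : H} (h : WeakTendsto x a) (L : H →L[ℝ] ℝ) :
    Tendsto (fun n => L (x n)) atTop (𝓝 (L a)) := by
  simpa [WeakTendsto] using h.map L 1

theorem WeakTendsto.add {x y : ℕ → H} {a b : H} (h : WeakTendsto x a) (h' : WeakTendsto y b) :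
    WeakTendsto (fun n => x n + y n) (a + b) := fun z => by
  simpa only [inner_add_left] using (h z).add (h' z)

theorem WeakTendsto.smul {x : ℕ → H} {a : H} (h : WeakTendsto x a) (c : ℝ) :
    WeakTendsto (fun n => c • x n) (c • a) := fun z => by
  simpa only [inner_smul_left] using (h z).const_mul _

theorem weakTendsto_of_tendsto {x : ℕ → H} {a : H} (h : Tendsto x atTop (𝓝 a)) :
    WeakTendsto x a := fun _ => h.inner tendsto_const_nhds

end Weak

/-! ### Separability -/

instance {d : ℕ} (D : Set (Eucl d)) : SecondCountableTopology (L2 D) := by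
  have : Fact ((2 : ENNReal) ≠ ⊤) := ⟨by norm_num⟩
  infer_instance

instance {d k : ℕ} (D : Set (Eucl d)) : SecondCountableTopology (Jet k D) :=
  (PiLp.homeomorph 2 fun _ : JetIdx d k => L2 D).secondCountableTopology

instance {d k : ℕ} (D : Set (Eucl d)) : TopologicalSpace.SeparableSpace (H0 k D) :=
  inferInstance

/-! ### Compactness of the inclusion `H^2_0 → L²` in the plane -/

section Compact

/-- The point `(s, t)` of the plane. -/
def pt (s t : ℝ) : Eucl 2 := !₂[s, t]

theorem contDiff_pt {E : Type*} [NormedAddCommGroup E] [NormedSpace ℝ E] {n : WithTop ℕ∞}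
    {f g : E → ℝ} (hf : ContDiff ℝ n f) (hg : ContDiff ℝ n g) :
    ContDiff ℝ n fun x => pt (f x) (g x) := by
  rw [contDiff_euclidean]
  intro i
  fin_cases i
  · exact hf
  · exact hg

theorem pt_eq (s t : ℝ) :
    pt s t = s • EuclideanSpace.single 0 (1 : ℝ) + t • EuclideanSpace.single 1 (1 : ℝ) := by
  ext i
  fin_cases i <;> simp [pt]

theorem pt_coord (x : Eucl 2) : pt (x 0) (x 1) = x := by
  ext i
  fin_cases i <;> simp [pt]

theorem hasDerivAt_pt_left (s t : ℝ) :
    HasDerivAt (fun s => pt s t) (EuclideanSpace.single 0 1) s := by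
  simp only [pt_eq]
  simpa using ((hasDerivAt_id s).smul_const (EuclideanSpace.single 0 (1 : ℝ))).add_const
    (t • EuclideanSpace.single (1 : Fin 2) (1 : ℝ))

theorem hasDerivAt_pt_right (s t : ℝ) :
    HasDerivAt (fun t => pt s t) (EuclideanSpace.single 1 1) t := by
  simp only [pt_eq]
  simpa using ((hasDerivAt_id t).smul_const (EuclideanSpace.single 1 (1 : ℝ))).const_add
    (s • EuclideanSpace.single (0 : Fin 2) (1 : ℝ))

theorem volume_preserving_pt :
    MeasurePreserving (fun p : ℝ × ℝ => pt p.1 p.2) volume volume := by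
  have h1 := (volume_preserving_finTwoArrow ℝ).symm
  have h2 := PiLp.volume_preserving_toLp (Fin 2)
  exact h2.comp h1

theorem measurableEmbedding_pt : MeasurableEmbedding fun p : ℝ × ℝ => pt p.1 p.2 :=
  (MeasurableEquiv.toLp 2 (Fin 2 → ℝ)).measurableEmbedding.comp
    (MeasurableEquiv.finTwoArrow (α := ℝ)).symm.measurableEmbedding

/-- The quadrant `{y₁ ≤ x₁, y₂ ≤ x₂}`. -/
def quadrant (x : Eucl 2) : Set (Eucl 2) := {y | y 0 ≤ x 0 ∧ y 1 ≤ x 1}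

theorem measurableSet_quadrant (x : Eucl 2) : MeasurableSet (quadrant x) := by
  have h0 : IsClosed {y : Eucl 2 | y 0 ≤ x 0} := isClosed_le (by fun_prop) continuous_const
  have h1 : IsClosed {y : Eucl 2 | y 1 ≤ x 1} := isClosed_le (by fun_prop) continuous_const
  exact (h0.inter h1).measurableSet

variable {D : Set (Eucl 2)}

theorem Test.hasCompactSupport_line {ψ : Eucl 2 → ℝ} (h : HasCompactSupport ψ) (i : Fin 2)
    (γ : ℝ → Eucl 2) (hγ : ∀ t, γ t i = t) : HasCompactSupport fun t => ψ (γ t) := by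
  refine HasCompactSupport.of_support_subset_isCompact
    (K := (fun y : Eucl 2 => y i) '' tsupport ψ) (h.isCompact.image (by fun_prop)) ?_
  intro t ht
  exact ⟨γ t, subset_closure ht, hγ t⟩

/-- The fundamental theorem of calculus along a coordinate line. Since `γ` is parametrized by its
own `i`-th coordinate, the restriction of `ψ` to it keeps compact support. -/
theorem Test.integral_line (ψ : Test D) (i : Fin 2) (γ : ℝ → Eucl 2) (hγ : ∀ t, γ t i = t)
    (hc : ContDiff ℝ 1 γ) (hγ' : ∀ t, HasDerivAt γ (EuclideanSpace.single i 1) t) (b : ℝ) :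
    ∫ t in Iic b, partialD i ψ.1 (γ t) = ψ.1 (γ b) := by
  rw [← HasCompactSupport.integral_Iic_deriv_eq (f := fun t => ψ.1 (γ t))
    ((ψ.contDiff.of_le (by simp)).comp hc) (Test.hasCompactSupport_line ψ.compact i γ hγ)]
  refine setIntegral_congr_fun measurableSet_Iic fun t _ => ?_
  exact ((ψ.differentiableAt (γ t)).hasFDerivAt.comp_hasDerivAt t (hγ' t)).deriv.symm

/-- By Fubini and the fundamental theorem of calculus in each variable. The mixed derivative is
commuted because the inner integration runs over the second coordinate. -/
theorem Test.integral_quadrant (φ : Test D) (x : Eucl 2) :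
    ∫ y in quadrant x, partialD 0 (partialD 1 φ.1) y = φ.1 x := by
  have h0 : (fun p : ℝ × ℝ => pt p.1 p.2) ⁻¹' quadrant x = Iic (x 0) ×ˢ Iic (x 1) := by
    ext p
    simp [quadrant, pt, Prod.le_def]
  rw [← volume_preserving_pt.setIntegral_preimage_emb measurableEmbedding_pt, h0,
    Measure.volume_eq_prod, setIntegral_prod]
  · have h1 : ∀ s, ∫ t in Iic (x 1), partialD 0 (partialD 1 φ.1) (pt s t)
        = partialD 0 φ.1 (pt s (x 1)) := by
      intro s
      rw [partialD_comm 0 1 φ.contDiff]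
      exact Test.integral_line (Test.deriv 0 φ) 1 (fun t => pt s t) (fun t => by simp [pt])
        (contDiff_pt contDiff_const contDiff_id) (hasDerivAt_pt_right s) _
    simp only [h1]
    rw [Test.integral_line φ 0 (fun s => pt s (x 1)) (fun t => by simp [pt])
        (contDiff_pt contDiff_id contDiff_const) (fun t => hasDerivAt_pt_left t _) _, pt_coord]
  · have hi : Integrable (partialD 0 (partialD 1 φ.1)) (volume : Measure (Eucl 2)) :=
      (Test.deriv 0 (Test.deriv 1 φ)).contDiff.continuous.integrable_of_hasCompactSupport
        (Test.deriv 0 (Test.deriv 1 φ)).compact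
    exact ((volume_preserving_pt.integrable_comp_emb measurableEmbedding_pt).2 hi).integrableOn

/-- The indicator function of a quadrant. -/
def quadrantInd (hD : Bornology.IsBounded D) (x : Eucl 2) : L2 D :=
  indicatorConstLp 2 (measurableSet_quadrant x)
    ((measure_mono (subset_univ _)).trans_lt (by simpa using hD.measure_lt_top)).ne (1 : ℝ)

theorem inner_quadrantInd (hD : Bornology.IsBounded D) (x : Eucl 2) (φ : Test D) :
    inner ℝ (quadrantInd hD x) (Test.toL2 (Test.deriv 0 (Test.deriv 1 φ))) = φ.1 x := by
  set ψ := Test.deriv 0 (Test.deriv 1 φ)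
  rw [quadrantInd, L2.inner_indicatorConstLp_one, ← φ.integral_quadrant x,
    setIntegral_congr_ae (g := ψ.1) (measurableSet_quadrant x)
      (ψ.coeFn_toL2.mono fun y hy _ => hy), Measure.restrict_restrict (measurableSet_quadrant x)]
  exact (setIntegral_eq_of_subset_of_forall_sdiff_eq_zero (measurableSet_quadrant x)
    inter_subset_left fun y hy => ψ.eq_zero fun h => hy.2 ⟨hy.1, h⟩).symm

theorem norm_quadrantInd_le (hD : Bornology.IsBounded D) (x : Eucl 2) :
    ‖quadrantInd hD x‖ ≤ (volume D).toReal ^ (1 / 2 : ℝ) := by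
  rw [quadrantInd, norm_indicatorConstLp two_ne_zero (by norm_num), norm_one, one_mul]
  simp only [ENNReal.toReal_ofNat, Measure.real]
  refine Real.rpow_le_rpow ENNReal.toReal_nonneg ?_ (by norm_num)
  refine ENNReal.toReal_mono hD.measure_lt_top.ne ?_
  exact (measure_mono (subset_univ _)).trans (by simp)

/-- The representation of a function by its mixed second derivative. -/
theorem ae_eq_inner_quadrantInd (hD : Bornology.IsBounded D) (w : H0 2 D) :
    ∀ᵐ x ∂volume.restrict D, fnL w x
      = inner ℝ (quadrantInd hD x) (fnL (shift 0 (shift 1 w))) := by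
  obtain ⟨u, hu, huw⟩ := mem_closure_iff_seq_limit.1 ((denseRange_jet 2 D) w)
  choose φ hφ using hu
  have hlim : Filter.Tendsto (fun n => fnL (u n)) Filter.atTop (nhds (fnL w)) :=
    (fnL.continuous.tendsto w).comp huw
  obtain ⟨ns, hns, hae⟩ := (tendstoInMeasure_of_tendsto_Lp hlim).exists_seq_tendsto_ae
  have hφae : ∀ᵐ x ∂volume.restrict D, ∀ n, fnL (u n) x = (φ n).1 x := by
    refine ae_all_iff.2 fun n => ?_
    rw [← hφ n, fnL_jet]
    exact (φ n).coeFn_toL2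
  filter_upwards [hae, hφae] with x h1 h2
  refine tendsto_nhds_unique h1 ?_
  have hc : Continuous fun w : H0 2 D =>
      inner ℝ (quadrantInd hD x) (fnL (shift 0 (shift 1 w))) := by fun_prop
  refine ((hc.tendsto w).comp (huw.comp hns.tendsto_atTop)).congr fun n => ?_
  simp only [Function.comp_apply]
  rw [h2, ← hφ (ns n), shift_jet, shift_jet, fnL_jet, inner_quadrantInd]

-- Compactness of an integral operator with bounded kernel. Pairing with the fixed vector
-- `quadrantInd hD x` converts weak convergence of `f` into pointwise convergence of `g`; the norm
-- of that vector is bounded uniformly in `x` and `D` has finite measure, so dominated convergence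
-- gives convergence in `L²`.
open Filter Topology in
theorem tendsto_zero_of_eq_inner_quadrantInd (hD : Bornology.IsBounded D) {f g : ℕ → L2 D} {B : ℝ}
    (hg : ∀ n, ∀ᵐ x ∂volume.restrict D, g n x = inner ℝ (quadrantInd hD x) (f n))
    (hB : ∀ n, ‖f n‖ ≤ B) (hf : WeakTendsto f 0) : Tendsto g atTop (𝓝 0) := by
  have : IsFiniteMeasure (volume.restrict D) := ⟨by simpa using hD.measure_lt_top⟩
  rw [tendsto_zero_iff_norm_tendsto_zero]
  have hsq : Tendsto (fun n => ‖g n‖ ^ 2) atTop (𝓝 0) := by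
    have e : ∀ n, ‖g n‖ ^ 2 = ∫ x in D, g n x ^ 2 := by
      intro n
      rw [← real_inner_self_eq_norm_sq, L2.inner_def]
      refine integral_congr_ae (Eventually.of_forall fun x => ?_)
      simp [sq]
    simp only [e]
    have hz : (0 : ℝ) = ∫ x in D, (0 : ℝ) := by simp
    rw [hz]
    refine tendsto_integral_of_dominated_convergence
      (fun _ => ((volume D).toReal ^ (1 / 2 : ℝ) * B) ^ 2)
      (fun n => (Lp.aestronglyMeasurable _).pow 2) (integrable_const _) ?_ ?_
    · intro n
      filter_upwards [hg n] with x hx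
      rw [hx, norm_pow]
      refine pow_le_pow_left₀ (norm_nonneg _) ?_ 2
      refine (norm_inner_le_norm _ _).trans ?_
      exact mul_le_mul (norm_quadrantInd_le hD x) (hB n) (norm_nonneg _) (by positivity)
    · filter_upwards [ae_all_iff.2 hg] with x hx
      have h2 := (hf (quadrantInd hD x)).pow 2
      rw [inner_zero_left, zero_pow two_ne_zero] at h2
      exact h2.congr fun n => by rw [hx n, real_inner_comm]
  have := hsq.sqrt
  simpa [Real.sqrt_sq] using this

theorem WeakTendsto.sub_const {H : Type*} [NormedAddCommGroup H] [InnerProductSpace ℝ H]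
    {x : ℕ → H} {a : H} (h : WeakTendsto x a) : WeakTendsto (fun n => x n - a) 0 := fun z => by
  simpa only [inner_sub_left, inner_zero_left, sub_self] using (h z).sub_const (inner ℝ a z)

open Filter Topology in
/-- The inclusion `H^2_0(D) → L²(D)` is compact. -/
theorem tendsto_fnL_of_weakTendsto (hD : Bornology.IsBounded D) {w : ℕ → H0 2 D} {a : H0 2 D}
    {R : ℝ} (hR : ∀ n, ‖w n‖ ≤ R) (hw : WeakTendsto w a) :
    Tendsto (fun n => fnL (w n)) atTop (𝓝 (fnL a)) := by
  let P : H0 2 D →L[ℝ] L2 D := fnL ∘L shift 0 ∘L shift 1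
  have hP : ∀ n, ‖P (w n - a)‖ ≤ ‖P‖ * (R + ‖a‖) := fun n =>
    (P.le_opNorm _).trans (mul_le_mul_of_nonneg_left
      ((norm_sub_le _ _).trans (by gcongr; exact hR n)) P.opNorm_nonneg)
  have h := tendsto_zero_of_eq_inner_quadrantInd hD (f := fun n => P (w n - a))
    (g := fun n => fnL (w n - a)) (fun n => ae_eq_inner_quadrantInd hD (w n - a)) hP
    (by simpa using hw.sub_const.map P)
  simpa using h.add_const (fnL a)

open Filter Topology in
/-- The inclusion `H^2_0(D) → H^1_0(D)` is compact. -/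
theorem tendsto_shift_of_weakTendsto (hD : Bornology.IsBounded D) {w : ℕ → H0 2 D} {a : H0 2 D}
    {R : ℝ} (hR : ∀ n, ‖w n‖ ≤ R) (hw : WeakTendsto w a) (i : Fin 2) :
    Tendsto (fun n => fnL (shift i (w n))) atTop (𝓝 (fnL (shift i a))) := by
  have h0 := tendsto_iff_norm_sub_tendsto_zero.1 (tendsto_fnL_of_weakTendsto hD hR hw)
  rw [tendsto_iff_norm_sub_tendsto_zero]
  let P : H0 2 D →L[ℝ] L2 D := lapL
  have hP : ∀ n, ‖P (w n - a)‖ ≤ ‖P‖ * (R + ‖a‖) := fun n =>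
    (P.le_opNorm _).trans (mul_le_mul_of_nonneg_left
      ((norm_sub_le _ _).trans (by gcongr; exact hR n)) P.opNorm_nonneg)
  -- By interpolation, ‖∂_i(w_n − a)‖² ≤ ‖w_n − a‖ ‖Δ(w_n − a)‖; the first factor tends to zero and
  -- the second is bounded.
  have hb : ∀ n, ‖fnL (shift i (w n)) - fnL (shift i a)‖
      ≤ √(‖fnL (w n) - fnL a‖ * (‖P‖ * (R + ‖a‖))) := by
    intro n
    refine Real.le_sqrt_of_sq_le ?_
    rw [← map_sub, ← map_sub, ← map_sub]
    exact (norm_shift_sq_le i _).trans (mul_le_mul_of_nonneg_left (hP n) (norm_nonneg _))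
  refine squeeze_zero (fun n => norm_nonneg _) hb ?_
  have := (h0.mul_const (‖P‖ * (R + ‖a‖))).sqrt
  simpa using this

end Compact

end

end FluidShell

namespace FluidShell

noncomputable section

/-! ### Products of functions of `H^1_0` -/

section Products

open scoped NNReal ENNReal

variable {D : Set (Eucl 2)}

instance : ENNReal.HolderTriple 4 4 2 := ⟨by
  rw [← ENNReal.toReal_eq_toReal_iff' (by simp) (by simp), ENNReal.toReal_add (by simp) (by simp)]
  norm_num⟩

theorem eLpNorm_mul_le {f g : Eucl 2 → ℝ} {m : Measure (Eucl 2)} (hf : AEStronglyMeasurable f m)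
    (hg : AEStronglyMeasurable g m) :
    eLpNorm (fun x => f x * g x) 2 m ≤ eLpNorm f 4 m * eLpNorm g 4 m := by
  have h := eLpNorm_smul_le_mul_eLpNorm (p := 4) (q := 4) (r := 2) hg hf
  exact h

theorem memLp_mul (u v : H0 1 D) :
    MemLp (fun x => fnL u x * fnL v x) 2 (volume.restrict D) :=
  (memLp_four v).mul (memLp_four u)

/-- The product of two functions of `H^1_0(D)` as an element of `L²(D)`. -/
def prodL2 (u v : H0 1 D) : L2 D := (memLp_mul u v).toLp _

theorem coeFn_prodL2 (u v : H0 1 D) :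
    prodL2 u v =ᵐ[volume.restrict D] fun x => fnL u x * fnL v x :=
  MemLp.coeFn_toLp (memLp_mul u v)

theorem prodL2_comm (u v : H0 1 D) : prodL2 u v = prodL2 v u := by
  refine MemLp.toLp_congr _ _ (Filter.Eventually.of_forall fun x => ?_)
  exact mul_comm _ _

theorem prodL2_add_left (u u' v : H0 1 D) :
    prodL2 (u + u') v = prodL2 u v + prodL2 u' v := by
  refine Lp.ext ?_
  filter_upwards [coeFn_prodL2 (u + u') v, coeFn_prodL2 u v, coeFn_prodL2 u' v,
    Lp.coeFn_add (prodL2 u v) (prodL2 u' v), Lp.coeFn_add (fnL u) (fnL u')] with x h1 h2 h3 h4 h5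
  rw [h1, h4, Pi.add_apply, h2, h3, map_add, h5, Pi.add_apply]
  ring

theorem prodL2_smul_left (c : ℝ) (u v : H0 1 D) :
    prodL2 (c • u) v = c • prodL2 u v := by
  refine Lp.ext ?_
  filter_upwards [coeFn_prodL2 (c • u) v, coeFn_prodL2 u v,
    Lp.coeFn_smul c (prodL2 u v), Lp.coeFn_smul c (fnL u)] with x h1 h2 h4 h5
  rw [h1, h4, Pi.smul_apply, h2, map_smul, h5, Pi.smul_apply]
  simp only [smul_eq_mul]
  ring

/-- Hölder with exponents 4 and 4, followed by Ladyzhenskaya for each factor. An `L²` norm is kept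
beside each `H¹` norm so that a product becomes small as soon as one factor is small in `L²` and
bounded in `H¹`. -/
theorem exists_norm_prodL2_sq_le (D : Set (Eucl 2)) : ∃ C : ℝ, 0 < C ∧ ∀ u v : H0 1 D,
    ‖prodL2 u v‖ ^ 2 ≤ C * (‖fnL u‖ * ‖u‖) * (‖fnL v‖ * ‖v‖) := by
  obtain ⟨C, hC⟩ := exists_ladyzhenskaya
  have h4 : ∀ u : H0 1 D, (eLpNorm (fnL u) 4 (volume.restrict D)).toReal ^ 2
      ≤ 2 * C * (‖fnL u‖ * ‖u‖) := by
    intro u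
    have h := ENNReal.toReal_mono ENNReal.coe_ne_top (hC D 0 u)
    rw [ENNReal.toReal_pow, ENNReal.coe_toReal] at h
    refine h.trans ?_
    have hs : ∀ i, ‖fnL (shift i u)‖ ≤ ‖u‖ := fun i => by
      rw [← pd_eq]
      exact PiLp.norm_apply_le u.1 (⟨⟨1, by omega⟩, fun _ => i⟩ : JetIdx 2 1)
    push_cast
    rw [Fin.sum_univ_two]
    have h0 := mul_nonneg C.2 (norm_nonneg (fnL u))
    have := mul_le_mul_of_nonneg_left (add_le_add (hs 0) (hs 1)) h0
    refine this.trans (le_of_eq ?_)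
    simp only [NNReal.val_eq_coe]
    ring
  -- The summand 1 only makes the constant positive.
  refine ⟨(2 * C) ^ 2 + 1, by positivity, fun u v => ?_⟩
  have h1 : ‖prodL2 u v‖ ≤ (eLpNorm (fnL u) 4 (volume.restrict D)).toReal
      * (eLpNorm (fnL v) 4 (volume.restrict D)).toReal := by
    rw [Lp.norm_def, eLpNorm_congr_ae (coeFn_prodL2 u v), ← ENNReal.toReal_mul]
    refine ENNReal.toReal_mono
      (ENNReal.mul_ne_top (memLp_four u).2.ne (memLp_four v).2.ne) ?_
    exact eLpNorm_mul_le (Lp.aestronglyMeasurable _) (Lp.aestronglyMeasurable _)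
  have h2 := pow_le_pow_left₀ (norm_nonneg _) h1 2
  rw [mul_pow] at h2
  have h3 := mul_le_mul (h4 u) (h4 v) (sq_nonneg _) (by positivity)
  refine h2.trans (h3.trans ?_)
  have : 0 ≤ (‖fnL u‖ * ‖u‖) * (‖fnL v‖ * ‖v‖) := by positivity
  nlinarith

theorem norm_fnL_le {d k : ℕ} {D : Set (Eucl d)} (u : H0 k D) : ‖fnL u‖ ≤ ‖u‖ :=
  PiLp.norm_apply_le u.1 (⟨⟨0, by omega⟩, Fin.elim0⟩ : JetIdx d k)

theorem exists_norm_prodL2_le (D : Set (Eucl 2)) : ∃ C : ℝ, 0 < C ∧ ∀ u v : H0 1 D,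
    ‖prodL2 u v‖ ≤ C * ‖u‖ * ‖v‖ := by
  obtain ⟨C, hC, h⟩ := exists_norm_prodL2_sq_le D
  refine ⟨√C, Real.sqrt_pos.2 hC, fun u v => ?_⟩
  refine (sq_le_sq₀ (norm_nonneg _) (by positivity)).1 ?_
  refine (h u v).trans ?_
  rw [mul_pow, mul_pow, Real.sq_sqrt hC.le, sq, sq]
  gcongr <;> exact norm_fnL_le _

/-- The product of functions of `H^1_0(D)` as a bounded bilinear map. -/
def prodB : H0 1 D →L[ℝ] H0 1 D →L[ℝ] L2 D :=
  LinearMap.mkContinuous₂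
    (LinearMap.mk₂ ℝ prodL2 prodL2_add_left prodL2_smul_left
      (fun u v v' => by rw [prodL2_comm, prodL2_add_left, prodL2_comm v, prodL2_comm v'])
      (fun c u v => by rw [prodL2_comm, prodL2_smul_left, prodL2_comm v]))
    (exists_norm_prodL2_le D).choose (exists_norm_prodL2_le D).choose_spec.2

theorem prodB_apply (u v : H0 1 D) : prodB u v = prodL2 u v := rfl

theorem coeFn_prodB (u v : H0 1 D) :
    prodB u v =ᵐ[volume.restrict D] fun x => fnL u x * fnL v x := coeFn_prodL2 u v

theorem prodB_comm (u v : H0 1 D) : prodB u v = prodB v u := prodL2_comm u v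

set_option maxHeartbeats 1000000 in
theorem exists_norm_prodB_sub_sq_le (D : Set (Eucl 2)) : ∃ C : ℝ, ∀ (x y c : H0 1 D) (M R : ℝ),
    ‖x‖ ≤ M → ‖y‖ ≤ R → ‖prodB x (y - c)‖ ^ 2 ≤ C * (M * M) * ((R + ‖c‖) * ‖fnL y - fnL c‖) := by
  obtain ⟨C, hC, h⟩ := exists_norm_prodL2_sq_le D
  refine ⟨C, fun x y c M R hx hy => ?_⟩
  have h0 := h x (y - c)
  have h1 : ‖fnL x‖ ≤ M := (norm_fnL_le _).trans hx
  have h2 : ‖y - c‖ ≤ R + ‖c‖ := (norm_sub_le _ _).trans (add_le_add hy le_rfl)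
  have h3 : 0 ≤ M := (norm_nonneg _).trans h1
  have h4 : 0 ≤ ‖fnL y - fnL c‖ := norm_nonneg _
  have h5 : 0 ≤ ‖y - c‖ := norm_nonneg _
  have h6 : 0 ≤ ‖fnL x‖ := norm_nonneg _
  have h7 : 0 ≤ ‖x‖ := norm_nonneg _
  rw [map_sub] at h0
  rw [prodB_apply]
  refine h0.trans ?_
  generalize ‖fnL y - fnL c‖ = a at *
  generalize ‖y - c‖ = b at *
  generalize ‖fnL x‖ = e at *
  generalize ‖x‖ = f at *
  generalize R + ‖c‖ = g at *
  rw [mul_comm a b]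
  gcongr

set_option maxHeartbeats 1000000 in
open Filter Topology in
theorem tendsto_prodB_sub {x y : ℕ → H0 1 D} {c : H0 1 D} {M R : ℝ} (hx : ∀ n, ‖x n‖ ≤ M)
    (hy : ∀ n, ‖y n‖ ≤ R) (hyc : Tendsto (fun n => fnL (y n)) atTop (𝓝 (fnL c))) :
    Tendsto (fun n => prodB (x n) (y n - c)) atTop (𝓝 0) := by
  obtain ⟨C, h⟩ := exists_norm_prodB_sub_sq_le D
  have h0 := tendsto_iff_norm_sub_tendsto_zero.1 hyc
  rw [tendsto_zero_iff_norm_tendsto_zero]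
  refine squeeze_zero (fun n => norm_nonneg _)
    (fun n => Real.le_sqrt_of_sq_le (h (x n) (y n) c M R (hx n) (hy n))) ?_
  have := ((h0.const_mul (R + ‖c‖)).const_mul (C * (M * M))).sqrt
  rwa [mul_zero, mul_zero, Real.sqrt_zero] at this

set_option maxHeartbeats 1000000 in
open Filter Topology in
/-- Products converge if the factors are bounded in `H^1_0` and converge in `L²`. -/
theorem tendsto_prodB {u v : ℕ → H0 1 D} {a b : H0 1 D} {R : ℝ} (hu : ∀ n, ‖u n‖ ≤ R)
    (hv : ∀ n, ‖v n‖ ≤ R) (hua : Tendsto (fun n => fnL (u n)) atTop (𝓝 (fnL a)))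
    (hvb : Tendsto (fun n => fnL (v n)) atTop (𝓝 (fnL b))) :
    Tendsto (fun n => prodB (u n) (v n)) atTop (𝓝 (prodB a b)) := by
  -- The decomposition is uv − ab = u(v − b) + b(u − a), each summand having one factor that tends
  -- to zero in `L²`.
  have h1 := tendsto_prodB_sub hu hv hvb
  have h2 := tendsto_prodB_sub (x := fun _ => b) (fun _ => le_refl ‖b‖) hu hua
  have h3 := (h1.add h2).add_const (prodB a b)
  rw [add_zero, zero_add] at h3
  refine h3.congr fun n => ?_
  rw [prodB_comm b, map_sub, map_sub, sub_apply]
  abel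

end Products

/-! ### Multiplication by a bounded function -/

section Multiplication

variable {d : ℕ} {D : Set (Eucl d)}

/-- Multiplication by an essentially bounded function as an operator on `L²(D)`. -/
def mulOp {k : Eucl d → ℝ} (hk : MemLp k ⊤ (volume.restrict D)) : L2 D →L[ℝ] L2 D :=
  (ContinuousLinearMap.mul ℝ ℝ).holderL (volume.restrict D) ⊤ 2 2 (hk.toLp k)

theorem coeFn_mulOp {k : Eucl d → ℝ} (hk : MemLp k ⊤ (volume.restrict D)) (f : L2 D) :
    mulOp hk f =ᵐ[volume.restrict D] fun x => k x * f x := by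
  have h := (ContinuousLinearMap.mul ℝ ℝ).coeFn_holder (r := 2) (hk.toLp k) f
  filter_upwards [h, hk.coeFn_toLp] with x h1 h2
  change ((ContinuousLinearMap.mul ℝ ℝ).holder 2 (hk.toLp k) f) x = _
  rw [h1, h2]
  rfl

theorem memLp_top_of_continuousOn {k : Eucl d → ℝ} (hD : IsOpen D) (hb : Bornology.IsBounded D)
    (hk : ContinuousOn k (closure D)) : MemLp k ⊤ (volume.restrict D) := by
  obtain ⟨C, hC⟩ := hb.isCompact_closure.exists_bound_of_continuousOn hk
  refine memLp_top_of_bound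
    ((hk.mono subset_closure).aestronglyMeasurable hD.measurableSet) C ?_
  filter_upwards [ae_restrict_mem hD.measurableSet] with x hx
  exact hC x (subset_closure hx)

end Multiplication

end

end FluidShell

namespace FluidShell

noncomputable section

/-! ### Energies with quadratic strains -/

section Energy

open Filter Topology

variable {Y : Type*} [NormedAddCommGroup Y] [InnerProductSpace ℝ Y]

/-- The bilinear form of the elastic energy density in terms of the strains. -/
def stressForm (c : ℝ) (E F : Fin 3 → Y) : ℝ :=
  2 * inner ℝ (E 0) (F 0) + 2 * inner ℝ (E 1) (F 1) + c * inner ℝ (E 0 + E 1) (F 0 + F 1)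
    + inner ℝ (E 2) (F 2)

theorem norm_sq_le_stressForm {c : ℝ} (hc : 0 ≤ c) (E : Fin 3 → Y) (i : Fin 3) :
    ‖E i‖ ^ 2 ≤ stressForm c E E := by
  have h := mul_nonneg hc (real_inner_self_nonneg (x := E 0 + E 1))
  simp only [stressForm]
  have h0 := sq_nonneg ‖E 0‖
  have h1 := sq_nonneg ‖E 1‖
  have h2 := sq_nonneg ‖E 2‖
  simp only [real_inner_self_eq_norm_sq] at h ⊢
  fin_cases i <;> simp only [Fin.zero_eta, Fin.mk_one, Fin.reduceFinMk] <;> linarith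

theorem stressForm_self_nonneg {c : ℝ} (hc : 0 ≤ c) (E : Fin 3 → Y) : 0 ≤ stressForm c E E :=
  (sq_nonneg _).trans (norm_sq_le_stressForm hc E 0)

/-- Nonnegativity of the form at E − F. The left side is affine in E, hence weakly continuous; this
is the source of weak lower semicontinuity. -/
theorem two_mul_stressForm_sub_le {c : ℝ} (hc : 0 ≤ c) (E F : Fin 3 → Y) :
    2 * stressForm c E F - stressForm c F F ≤ stressForm c E E := by
  have h := stressForm_self_nonneg hc (fun i => E i - F i)
  have e : stressForm c (fun i => E i - F i) (fun i => E i - F i)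
      = stressForm c E E - 2 * stressForm c E F + stressForm c F F := by
    simp only [stressForm, inner_add_left, inner_add_right, inner_sub_left, inner_sub_right]
    rw [real_inner_comm (E 0) (F 0), real_inner_comm (E 1) (F 1), real_inner_comm (E 2) (F 2),
      real_inner_comm (E 1) (F 0), real_inner_comm (E 0) (F 1)]
    ring
  linarith

theorem hasDerivAt_stressForm {c : ℝ} {E : Fin 3 → ℝ → Y} {F : Fin 3 → Y} {t : ℝ}
    (h : ∀ i, HasDerivAt (E i) (F i) t) :
    HasDerivAt (fun s => stressForm c (fun i => E i s) fun i => E i s)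
      (2 * stressForm c (fun i => E i t) F) t := by
  have h0 := ((h 0).inner ℝ (h 0)).const_mul 2
  have h1 := ((h 1).inner ℝ (h 1)).const_mul 2
  have h01 := (((h 0).add (h 1)).inner ℝ ((h 0).add (h 1))).const_mul c
  have h2 := (h 2).inner ℝ (h 2)
  refine (((h0.add h1).add h01).add h2).congr_deriv ?_
  simp only [stressForm, Pi.add_apply]
  rw [real_inner_comm (E 0 t) (F 0), real_inner_comm (E 1 t) (F 1), real_inner_comm (E 2 t) (F 2),
    real_inner_comm (E 0 t + E 1 t) (F 0 + F 1)]
  ring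

theorem tendsto_stressForm {c : ℝ} {E : Fin 3 → ℕ → Y} {F : Fin 3 → Y}
    (h : ∀ i, WeakTendsto (E i) (F i)) :
    Tendsto (fun n => stressForm c (fun i => E i n) F) atTop (𝓝 (stressForm c F F)) := by
  have h01 := ((h 0).add (h 1)) (F 0 + F 1)
  exact (((((h 0) (F 0)).const_mul 2).add (((h 1) (F 1)).const_mul 2)).add
    (h01.const_mul c)).add ((h 2) (F 2))

variable {X : Type*} [NormedAddCommGroup X] [NormedSpace ℝ X]

/-- The strains with linear part `A` and quadratic part `½ B(u, u)`. -/
def strainOf (A : Fin 3 → X →L[ℝ] Y) (B : Fin 3 → X →L[ℝ] X →L[ℝ] Y) (u : X) (i : Fin 3) : Y :=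
  A i u + (1 / 2 : ℝ) • B i u u

/-- The derivative of the strains. -/
def dstrainOf (A : Fin 3 → X →L[ℝ] Y) (B : Fin 3 → X →L[ℝ] X →L[ℝ] Y) (u b : X) (i : Fin 3) : Y :=
  A i b + B i u b

/-- The energy `½‖Λu‖² + ½ stressForm(strain, strain) - G u`. -/
def energyOf (c : ℝ) (Λ : X →L[ℝ] Y) (A : Fin 3 → X →L[ℝ] Y) (B : Fin 3 → X →L[ℝ] X →L[ℝ] Y)
    (G : X →L[ℝ] ℝ) (u : X) : ℝ :=
  1 / 2 * ‖Λ u‖ ^ 2 + 1 / 2 * stressForm c (strainOf A B u) (strainOf A B u) - G u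

/-- The derivative of the energy. -/
def denergyOf (c : ℝ) (Λ : X →L[ℝ] Y) (A : Fin 3 → X →L[ℝ] Y) (B : Fin 3 → X →L[ℝ] X →L[ℝ] Y)
    (G : X →L[ℝ] ℝ) (u b : X) : ℝ :=
  inner ℝ (Λ u) (Λ b) + stressForm c (strainOf A B u) (dstrainOf A B u b) - G b

variable {c : ℝ} {Λ : X →L[ℝ] Y} {A : Fin 3 → X →L[ℝ] Y} {B : Fin 3 → X →L[ℝ] X →L[ℝ] Y}
  {G : X →L[ℝ] ℝ}

/-- Along the line u + tb the strains are quadratic polynomials in t whose linear coefficient is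
`dstrainOf`, the symmetry of `B` merging the two cross terms. Fermat's criterion at t = 0 then
applies, and the line stays in `S`. -/
theorem denergyOf_eq_zero_of_isMin (hB : ∀ i u v, B i u v = B i v u) {S : Submodule ℝ X} {u : X}
    (hu : u ∈ S) (hmin : ∀ v ∈ S, energyOf c Λ A B G u ≤ energyOf c Λ A B G v) {b : X}
    (hb : b ∈ S) : denergyOf c Λ A B G u b = 0 := by
  have hd : ∀ i, HasDerivAt (fun t : ℝ => strainOf A B (u + t • b) i) (dstrainOf A B u b i) 0 := by
    intro i
    have e : (fun t : ℝ => strainOf A B (u + t • b) i) = fun t =>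
        strainOf A B u i + t • dstrainOf A B u b i + (t ^ 2) • ((1 / 2 : ℝ) • B i b b) := by
      ext t
      simp only [strainOf, dstrainOf, map_add, map_smul, add_apply,
        smul_apply, hB i b u]
      module
    rw [e]
    have h1 := ((hasDerivAt_id (0 : ℝ)).smul_const (dstrainOf A B u b i)).const_add
      (strainOf A B u i)
    have h2 := (hasDerivAt_pow 2 (0 : ℝ)).smul_const ((1 / 2 : ℝ) • B i b b)
    exact (h1.add h2).congr_deriv (by simp)
  have hL : HasDerivAt (fun t : ℝ => Λ (u + t • b)) (Λ b) 0 := by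
    simp only [map_add, map_smul]
    simpa using ((hasDerivAt_id (0 : ℝ)).smul_const (Λ b)).const_add (Λ u)
  have hG : HasDerivAt (fun t : ℝ => G (u + t • b)) (G b) 0 := by
    simp only [map_add, map_smul]
    simpa using ((hasDerivAt_id (0 : ℝ)).smul_const (G b)).const_add (G u)
  have hJ : HasDerivAt (fun t : ℝ => energyOf c Λ A B G (u + t • b))
      (denergyOf c Λ A B G u b) 0 := by
    refine (((hL.norm_sq.const_mul (1 / 2)).add ((hasDerivAt_stressForm (c := c) hd).const_mul
      (1 / 2))).sub hG).congr_deriv ?_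
    simp only [zero_smul, add_zero, denergyOf]
    ring
  refine IsLocalMin.hasDerivAt_eq_zero (Eventually.of_forall fun t => ?_) hJ
  simpa using hmin _ (S.add_mem hu (S.smul_mem t hb))

/-- The energy is convex in the pair (Λu, strains), although not in u. Hence weak convergence of
these quantities is the hypothesis, and the energy is compared with its supporting affine functional
at the limit. -/
theorem energyOf_le_of_weakTendsto (hc : 0 ≤ c) {x : ℕ → X} {u : X}
    (hΛ : WeakTendsto (fun n => Λ (x n)) (Λ u))
    (hE : ∀ i, WeakTendsto (fun n => strainOf A B (x n) i) (strainOf A B u i))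
    (hG : Tendsto (fun n => G (x n)) atTop (𝓝 (G u))) {a : ℕ → ℝ} {m : ℝ}
    (ha : Tendsto a atTop (𝓝 m)) (h : ∀ n, energyOf c Λ A B G (x n) ≤ a n) :
    energyOf c Λ A B G u ≤ m := by
  have h1 := ((hΛ (Λ u)).const_mul 2).sub_const (‖Λ u‖ ^ 2)
  have h2 := ((tendsto_stressForm (c := c) hE).const_mul 2).sub_const
    (stressForm c (strainOf A B u) (strainOf A B u))
  have h3 := ((h1.const_mul (1 / 2)).add (h2.const_mul (1 / 2))).sub hG
  have e : 1 / 2 * (2 * inner ℝ (Λ u) (Λ u) - ‖Λ u‖ ^ 2)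
      + 1 / 2 * (2 * stressForm c (strainOf A B u) (strainOf A B u)
        - stressForm c (strainOf A B u) (strainOf A B u)) - G u = energyOf c Λ A B G u := by
    rw [energyOf, real_inner_self_eq_norm_sq]
    ring
  rw [← e]
  refine le_of_tendsto_of_tendsto' h3 ha fun n => le_trans ?_ (h n)
  have h4 := two_mul_stressForm_sub_le hc (strainOf A B (x n)) (strainOf A B u)
  have h5 : 2 * inner ℝ (Λ (x n)) (Λ u) - ‖Λ u‖ ^ 2 ≤ ‖Λ (x n)‖ ^ 2 := by
    have := norm_sub_sq_real (Λ (x n)) (Λ u)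
    nlinarith [sq_nonneg ‖Λ (x n) - Λ u‖]
  simp only [energyOf]
  linarith

end Energy

/-! ### The strains of the shell -/

section Strain

variable {Ω : Set (Eucl 2)}

/-- The linear part of the strains `ε₁₁`, `ε₂₂`, `ε₁₂`. -/
def linStrain (κ₁ κ₂ : L2 Ω →L[ℝ] L2 Ω) : Fin 3 → W Ω →L[ℝ] L2 Ω :=
  let p1 : W Ω →L[ℝ] H0 1 Ω := ContinuousLinearMap.fst ℝ _ _
  let p2 : W Ω →L[ℝ] H0 1 Ω :=
    ContinuousLinearMap.fst ℝ _ _ ∘L ContinuousLinearMap.snd ℝ (H0 1 Ω) (H0 1 Ω × H0 2 Ω)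
  let p3 : W Ω →L[ℝ] H0 2 Ω :=
    ContinuousLinearMap.snd ℝ _ _ ∘L ContinuousLinearMap.snd ℝ (H0 1 Ω) (H0 1 Ω × H0 2 Ω)
  ![fnL ∘L shift 0 ∘L p1 + κ₁ ∘L fnL ∘L p3, fnL ∘L shift 1 ∘L p2 + κ₂ ∘L fnL ∘L p3,
    fnL ∘L shift 1 ∘L p1 + fnL ∘L shift 0 ∘L p2]

/-- The product `∂_i w ∂_j δ` as a bounded bilinear map on the displacements. -/
def dwProd (i j : Fin 2) : W Ω →L[ℝ] W Ω →L[ℝ] L2 Ω :=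
  let p3 : W Ω →L[ℝ] H0 2 Ω :=
    ContinuousLinearMap.snd ℝ _ _ ∘L ContinuousLinearMap.snd ℝ (H0 1 Ω) (H0 1 Ω × H0 2 Ω)
  prodB.bilinearComp (shift i ∘L p3) (shift j ∘L p3)

/-- The quadratic part of the strains. -/
def quadStrain : Fin 3 → W Ω →L[ℝ] W Ω →L[ℝ] L2 Ω :=
  ![dwProd 0 0, dwProd 1 1, dwProd 0 1 + dwProd 1 0]

variable (κ₁ κ₂ : L2 Ω →L[ℝ] L2 Ω) (u b : W Ω)

theorem linStrain_zero :
    linStrain κ₁ κ₂ 0 u = fnL (shift 0 u.1) + κ₁ (fnL u.2.2) := rfl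

theorem linStrain_one :
    linStrain κ₁ κ₂ 1 u = fnL (shift 1 u.2.1) + κ₂ (fnL u.2.2) := rfl

theorem linStrain_two :
    linStrain κ₁ κ₂ 2 u = fnL (shift 1 u.1) + fnL (shift 0 u.2.1) := rfl

theorem dwProd_symm (i j : Fin 2) : dwProd i j u b = dwProd j i b u := prodB_comm _ _

theorem quadStrain_symm (i : Fin 3) : quadStrain i u b = quadStrain i b u := by
  fin_cases i
  · exact dwProd_symm u b 0 0
  · exact dwProd_symm u b 1 1
  · exact (congrArg₂ (· + ·) (dwProd_symm u b 0 1) (dwProd_symm u b 1 0)).trans (add_comm _ _)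

/-- The Laplacian of the transversal displacement. -/
def lapW : W Ω →L[ℝ] L2 Ω :=
  lapL ∘L ContinuousLinearMap.snd ℝ _ _ ∘L ContinuousLinearMap.snd ℝ (H0 1 Ω) (H0 1 Ω × H0 2 Ω)

theorem lapW_apply : lapW u = lapL u.2.2 := rfl

/-- The load as a functional on the displacements. -/
def loadW (g : Hm1 Ω) : W Ω →L[ℝ] ℝ :=
  g ∘L lowerL ∘L ContinuousLinearMap.snd ℝ _ _
    ∘L ContinuousLinearMap.snd ℝ (H0 1 Ω) (H0 1 Ω × H0 2 Ω)

end Strain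

end

end FluidShell

namespace FluidShell

noncomputable section

/-! ### The shell forms in terms of `L²` inner products -/

section Forms

variable {Ω : Set (Eucl 2)}

/-- The hypothesis concerns only the product of the two functions: a factor such as `N₁₁ w_{x₁}`
need not be square integrable, but after regrouping, `N₁₁` is paired with the `L²` function `w_{x₁}
δ_{x₁}`. -/
theorem ip_eq_inner {d : ℕ} {D : Set (Eucl d)} {f g : Eucl d → ℝ} {F G : L2 D}
    (h : ∀ᵐ x ∂volume.restrict D, f x * g x = F x * G x) : ip D f g = inner ℝ F G := by
  rw [ip, L2.inner_def]
  refine integral_congr_ae (h.mono fun x hx => ?_)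
  simp [hx, mul_comm]

theorem ip_eq_inner_add {f g : Eucl 2 → ℝ} {F G F' G' : L2 Ω}
    (h : ∀ᵐ x ∂volume.restrict Ω, f x * g x = F x * G x + F' x * G' x) :
    ip Ω f g = inner ℝ F G + inner ℝ F' G' := by
  rw [ip, L2.inner_def, L2.inner_def,
    ← integral_add (L2.integrable_inner F G) (L2.integrable_inner F' G')]
  refine integral_congr_ae (h.mono fun x hx => ?_)
  simp [hx, mul_comm]

variable {k1 k2 : Eucl 2 → ℝ} (hk1 : MemLp k1 ⊤ (volume.restrict Ω))
  (hk2 : MemLp k2 ⊤ (volume.restrict Ω)) (u b : W Ω)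

/-- The strains of a displacement as elements of `L²(Ω)`. -/
def strain : Fin 3 → L2 Ω := strainOf (linStrain (mulOp hk1) (mulOp hk2)) quadStrain u

/-- The linearized strains. -/
def dstrain : Fin 3 → L2 Ω := dstrainOf (linStrain (mulOp hk1) (mulOp hk2)) quadStrain u b

theorem du1_eq (i : Fin 2) : u.du1 i = fnL (shift i u.1) := pd_eq u.1 i

theorem du2_eq (i : Fin 2) : u.du2 i = fnL (shift i u.2.1) := pd_eq u.2.1 i

theorem dw_eq (i : Fin 2) : u.dw i = fnL (shift i u.2.2) := pd_eq u.2.2 i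

/-- The product `∂_i w ∂_j δ` as an element of `L²(Ω)`. -/
def dwP (i j : Fin 2) : L2 Ω := dwProd i j u b

/-- The product `k w` as an element of `L²(Ω)`. -/
def kw {k : Eucl 2 → ℝ} (hk : MemLp k ⊤ (volume.restrict Ω)) : L2 Ω := mulOp hk (fnL u.2.2)

theorem coeFn_dwP (i j : Fin 2) :
    dwP u b i j =ᵐ[volume.restrict Ω] fun x => u.dw i x * b.dw j x := by
  have h := coeFn_prodB (shift i u.2.2) (shift j b.2.2)
  rwa [← dw_eq, ← dw_eq] at h

theorem coeFn_kw {k : Eucl 2 → ℝ} (hk : MemLp k ⊤ (volume.restrict Ω)) :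
    kw u hk =ᵐ[volume.restrict Ω] fun x => k x * u.w x := coeFn_mulOp hk _

theorem dwP_symm (i j : Fin 2) : dwP u b i j = dwP b u j i := dwProd_symm u b i j

theorem strain_zero :
    strain hk1 hk2 u 0 = u.du1 0 + kw u hk1 + (1 / 2 : ℝ) • dwP u u 0 0 :=
  congrArg (fun t : L2 Ω => t + kw u hk1 + (1 / 2 : ℝ) • dwP u u 0 0) (du1_eq u 0).symm

theorem strain_one :
    strain hk1 hk2 u 1 = u.du2 1 + kw u hk2 + (1 / 2 : ℝ) • dwP u u 1 1 :=
  congrArg (fun t : L2 Ω => t + kw u hk2 + (1 / 2 : ℝ) • dwP u u 1 1) (du2_eq u 1).symm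

theorem add_half_smul {Y : Type*} [AddCommGroup Y] [Module ℝ Y] {a b c c' : Y} (h : c' = c) :
    a + b + (1 / 2 : ℝ) • (c + c') = a + b + c := by
  rw [h]
  module

theorem strain_two : strain hk1 hk2 u 2 = u.du1 1 + u.du2 0 + dwP u u 0 1 :=
  (congrArg₂ (fun s t : L2 Ω => s + t + (1 / 2 : ℝ) • (dwP u u 0 1 + dwP u u 1 0))
    (du1_eq u 1).symm (du2_eq u 0).symm).trans (add_half_smul (dwP_symm u u 1 0))

theorem dstrain_zero : dstrain hk1 hk2 u b 0 = b.du1 0 + kw b hk1 + dwP u b 0 0 :=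
  congrArg (fun t : L2 Ω => t + kw b hk1 + dwP u b 0 0) (du1_eq b 0).symm

theorem dstrain_one : dstrain hk1 hk2 u b 1 = b.du2 1 + kw b hk2 + dwP u b 1 1 :=
  congrArg (fun t : L2 Ω => t + kw b hk2 + dwP u b 1 1) (du2_eq b 1).symm

theorem dstrain_two :
    dstrain hk1 hk2 u b 2 = b.du1 1 + b.du2 0 + (dwP u b 0 1 + dwP u b 1 0) :=
  congrArg₂ (fun s t : L2 Ω => s + t + (dwP u b 0 1 + dwP u b 1 0))
    (du1_eq b 1).symm (du2_eq b 0).symm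

theorem coeFn_strain_zero :
    strain hk1 hk2 u 0 =ᵐ[volume.restrict Ω] u.eps11 k1 := by
  rw [strain_zero]
  filter_upwards [Lp.coeFn_add (u.du1 0 + kw u hk1) ((1 / 2 : ℝ) • dwP u u 0 0),
    Lp.coeFn_add (u.du1 0) (kw u hk1), Lp.coeFn_smul (1 / 2 : ℝ) (dwP u u 0 0),
    coeFn_dwP u u 0 0, coeFn_kw u hk1] with x h1 h2 h3 h4 h5
  simp only [h1, h2, h3, h4, h5, Pi.add_apply, Pi.smul_apply, W.eps11, smul_eq_mul]
  ring

theorem coeFn_strain_one :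
    strain hk1 hk2 u 1 =ᵐ[volume.restrict Ω] u.eps22 k2 := by
  rw [strain_one]
  filter_upwards [Lp.coeFn_add (u.du2 1 + kw u hk2) ((1 / 2 : ℝ) • dwP u u 1 1),
    Lp.coeFn_add (u.du2 1) (kw u hk2), Lp.coeFn_smul (1 / 2 : ℝ) (dwP u u 1 1),
    coeFn_dwP u u 1 1, coeFn_kw u hk2] with x h1 h2 h3 h4 h5
  simp only [h1, h2, h3, h4, h5, Pi.add_apply, Pi.smul_apply, W.eps22, smul_eq_mul]
  ring

theorem coeFn_strain_two :
    strain hk1 hk2 u 2 =ᵐ[volume.restrict Ω] u.eps12 := by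
  rw [strain_two]
  filter_upwards [Lp.coeFn_add (u.du1 1 + u.du2 0) (dwP u u 0 1),
    Lp.coeFn_add (u.du1 1) (u.du2 0), coeFn_dwP u u 0 1] with x h1 h2 h3
  simp only [h1, h2, h3, Pi.add_apply, W.eps12]

/-- The stress `N₁₁` as an element of `L²(Ω)`. -/
def stress11 (μ : ℝ) : L2 Ω := (2 / (1 - μ)) • (strain hk1 hk2 u 0 + μ • strain hk1 hk2 u 1)

/-- The stress `N₂₂` as an element of `L²(Ω)`. -/
def stress22 (μ : ℝ) : L2 Ω := (2 / (1 - μ)) • (strain hk1 hk2 u 1 + μ • strain hk1 hk2 u 0)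

theorem coeFn_stress (μ : ℝ) {E F : L2 Ω} {e f : Eucl 2 → ℝ} (hE : E =ᵐ[volume.restrict Ω] e)
    (hF : F =ᵐ[volume.restrict Ω] f) : ((2 / (1 - μ)) • (E + μ • F) : L2 Ω)
      =ᵐ[volume.restrict Ω] fun x => 2 / (1 - μ) * (e x + μ * f x) := by
  filter_upwards [Lp.coeFn_smul (2 / (1 - μ)) (E + μ • F), Lp.coeFn_add E (μ • F),
    Lp.coeFn_smul μ F, hE, hF] with x h1 h2 h3 h4 h5
  simp only [h1, h2, h3, h4, h5, Pi.add_apply, Pi.smul_apply, smul_eq_mul]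

theorem coeFn_stress11 (μ : ℝ) :
    stress11 hk1 hk2 u μ =ᵐ[volume.restrict Ω] u.N11 μ k1 k2 :=
  coeFn_stress μ (coeFn_strain_zero hk1 hk2 u) (coeFn_strain_one hk1 hk2 u)

theorem coeFn_stress22 (μ : ℝ) :
    stress22 hk1 hk2 u μ =ᵐ[volume.restrict Ω] u.N22 μ k1 k2 :=
  coeFn_stress μ (coeFn_strain_one hk1 hk2 u) (coeFn_strain_zero hk1 hk2 u)

-- Sorting the terms by stresses exhibits the part of the linearized strains that contains δ.
set_option maxHeartbeats 2000000 in
theorem formTrans_eq (μ : ℝ) : formTrans μ k1 k2 u b =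
    inner ℝ (stress11 hk1 hk2 u μ) (kw b hk1 + dwP u b 0 0)
    + inner ℝ (strain hk1 hk2 u 2) (dwP u b 0 1 + dwP u b 1 0)
    + inner ℝ (stress22 hk1 hk2 u μ) (kw b hk2 + dwP u b 1 1) := by
  have n11 := coeFn_stress11 hk1 hk2 u μ
  have n22 := coeFn_stress22 hk1 hk2 u μ
  have n12 := coeFn_strain_two hk1 hk2 u
  have e1 : ip Ω (fun x => k1 x * u.N11 μ k1 k2 x + k2 x * u.N22 μ k1 k2 x) b.w
      = inner ℝ (stress11 hk1 hk2 u μ) (kw b hk1)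
        + inner ℝ (stress22 hk1 hk2 u μ) (kw b hk2) := by
    refine ip_eq_inner_add ?_
    filter_upwards [n11, n22, coeFn_kw b hk1, coeFn_kw b hk2] with x h1 h2 h3 h4
    rw [h1, h2, h3, h4]
    ring
  have e2 : ip Ω (fun x => u.N11 μ k1 k2 x * u.dw 0 x + u.N12 x * u.dw 1 x) (b.dw 0)
      = inner ℝ (stress11 hk1 hk2 u μ) (dwP u b 0 0)
        + inner ℝ (strain hk1 hk2 u 2) (dwP u b 1 0) := by
    refine ip_eq_inner_add ?_
    filter_upwards [n11, n12, coeFn_dwP u b 0 0, coeFn_dwP u b 1 0] with x h1 h2 h3 h4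
    rw [h1, h2, h3, h4, W.N12]
    ring
  have e3 : ip Ω (fun x => u.N12 x * u.dw 0 x + u.N22 μ k1 k2 x * u.dw 1 x) (b.dw 1)
      = inner ℝ (strain hk1 hk2 u 2) (dwP u b 0 1)
        + inner ℝ (stress22 hk1 hk2 u μ) (dwP u b 1 1) := by
    refine ip_eq_inner_add ?_
    filter_upwards [n12, n22, coeFn_dwP u b 0 1, coeFn_dwP u b 1 1] with x h1 h2 h3 h4
    rw [h1, h2, h3, h4, W.N12]
    ring
  rw [formTrans, e1, e2, e3]
  simp only [inner_add_right]
  ring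

set_option maxHeartbeats 2000000 in
theorem formQbar_rest_eq (μ : ℝ) : formQbar μ k1 k2 u b = formTrans μ k1 k2 u b
    + inner ℝ (stress11 hk1 hk2 u μ) (b.du1 0)
    + inner ℝ (strain hk1 hk2 u 2) (b.du1 1 + b.du2 0)
    + inner ℝ (stress22 hk1 hk2 u μ) (b.du2 1) := by
  have n11 := coeFn_stress11 hk1 hk2 u μ
  have n22 := coeFn_stress22 hk1 hk2 u μ
  have n12 := coeFn_strain_two hk1 hk2 u
  rw [formQbar, ip_eq_inner (F := stress11 hk1 hk2 u μ) (G := b.du1 0)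
      (n11.mono fun x h => by rw [h]),
    ip_eq_inner (F := strain hk1 hk2 u 2) (G := b.du1 1 + b.du2 0)
      (by filter_upwards [n12, Lp.coeFn_add (b.du1 1) (b.du2 0)] with x h h'
          rw [h, h']; rfl),
    ip_eq_inner (F := stress22 hk1 hk2 u μ) (G := b.du2 1) (n22.mono fun x h => by rw [h])]

/-- Since 2/(1 − μ) = 2 + c and 2μ/(1 − μ) = c for c = 2μ/(1 − μ), Hooke's law is a diagonal part
plus c times the product of the traces. For 0 ≤ μ < 1 this displays positivity. -/
theorem inner_stress {Y : Type*} [NormedAddCommGroup Y] [InnerProductSpace ℝ Y] {μ : ℝ}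
    (hμ : μ < 1) (E F : Fin 3 → Y) :
    inner ℝ ((2 / (1 - μ)) • (E 0 + μ • E 1)) (F 0) + inner ℝ (E 2) (F 2)
      + inner ℝ ((2 / (1 - μ)) • (E 1 + μ • E 0)) (F 1) = stressForm (2 * μ / (1 - μ)) E F := by
  have h : (1 - μ) ≠ 0 := by linarith
  simp only [stressForm, inner_smul_left, inner_add_left, inner_add_right, RCLike.conj_to_real]
  field_simp
  ring

-- Stresses are paired with linearized strains, so `q̄(u, ·)` is the derivative of the membrane
-- energy. This gives (∗) its variational structure.
set_option maxHeartbeats 2000000 in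
theorem formQbar_eq {μ : ℝ} (hμ : μ < 1) : formQbar μ k1 k2 u b
    = stressForm (2 * μ / (1 - μ)) (strain hk1 hk2 u) (dstrain hk1 hk2 u b) := by
  rw [← inner_stress hμ, formQbar_rest_eq hk1 hk2, formTrans_eq hk1 hk2, dstrain_zero,
    dstrain_one, dstrain_two]
  simp only [stress11, stress22, inner_add_right]
  ring

/-- The terms with `p` and `q` agree outright. In the purely linear part, the plane elasticity form
has coefficient (1 + μ)/(1 − μ) at (u²_{x₂}, β¹_{x₁}), whereas the stresses give 2μ/(1 − μ) there
and 1 at (u²_{x₁}, β¹_{x₂}); these coefficients add up correctly and `h` exchanges the two products.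
The other mixed term is treated by `h'`. -/
theorem inner_elastic {Y : Type*} [NormedAddCommGroup Y] [InnerProductSpace ℝ Y] {μ : ℝ}
    (hμ : μ < 1) {u₁ u₂ b₁ b₂ : Fin 2 → Y} (p0 p1 p2 q1 q2 : Y)
    (h : inner ℝ (u₂ 1) (b₁ 0) = inner ℝ (u₂ 0) (b₁ 1))
    (h' : inner ℝ (u₁ 0) (b₂ 1) = inner ℝ (u₁ 1) (b₂ 0)) :
    inner ℝ (u₁ 0) (b₁ 0) + inner ℝ (u₁ 1) (b₁ 1) + (inner ℝ (u₂ 0) (b₂ 0) + inner ℝ (u₂ 1) (b₂ 1))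
      + (1 + μ) / (1 - μ) * inner ℝ (u₁ 0 + u₂ 1) (b₁ 0 + b₂ 1)
      + (1 / (1 - μ) * (inner ℝ (p0 + μ • p1) (b₁ 0) + inner ℝ (p1 + μ • p0) (b₂ 1))
        + inner ℝ p2 (b₁ 1 + b₂ 0)
        + 2 / (1 - μ) * (inner ℝ (q1 + μ • q2) (b₁ 0) + inner ℝ (q2 + μ • q1) (b₂ 1)))
    = inner ℝ ((2 / (1 - μ)) • (u₁ 0 + q1 + (1 / 2 : ℝ) • p0
          + μ • (u₂ 1 + q2 + (1 / 2 : ℝ) • p1))) (b₁ 0)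
      + inner ℝ (u₁ 1 + u₂ 0 + p2) (b₁ 1 + b₂ 0)
      + inner ℝ ((2 / (1 - μ)) • (u₂ 1 + q2 + (1 / 2 : ℝ) • p1
          + μ • (u₁ 0 + q1 + (1 / 2 : ℝ) • p0))) (b₂ 1) := by
  have hn : (1 - μ) ≠ 0 := by linarith
  simp only [inner_smul_left, inner_add_left, inner_add_right, RCLike.conj_to_real, h, h']
  field_simp
  ring

set_option maxHeartbeats 2000000 in
theorem formQ_rest_eq (μ : ℝ) : formQ μ k1 k2 u b = formTrans μ k1 k2 u b
    + (1 / (1 - μ) * (inner ℝ (dwP u u 0 0 + μ • dwP u u 1 1) (b.du1 0)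
        + inner ℝ (dwP u u 1 1 + μ • dwP u u 0 0) (b.du2 1))
      + inner ℝ (dwP u u 0 1) (b.du1 1 + b.du2 0)
      + 2 / (1 - μ) * (inner ℝ (kw u hk1 + μ • kw u hk2) (b.du1 0)
        + inner ℝ (kw u hk2 + μ • kw u hk1) (b.du2 1))) := by
  have comb : ∀ {E F : L2 Ω} {e f : Eucl 2 → ℝ} (_ : E =ᵐ[volume.restrict Ω] e)
      (_ : F =ᵐ[volume.restrict Ω] f),
      (E + μ • F : L2 Ω) =ᵐ[volume.restrict Ω] fun x => e x + μ * f x := by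
    intro E F e f hE hF
    filter_upwards [Lp.coeFn_add E (μ • F), Lp.coeFn_smul μ F, hE, hF] with x h2 h3 h4 h5
    simp only [h2, h3, h4, h5, Pi.add_apply, Pi.smul_apply, smul_eq_mul]
  have p00 := coeFn_dwP u u 0 0
  have p11 := coeFn_dwP u u 1 1
  have w1 := coeFn_kw u hk1
  have w2 := coeFn_kw u hk2
  rw [formQ, ip_eq_inner (F := dwP u u 0 0 + μ • dwP u u 1 1) (G := b.du1 0)
      ((comb p00 p11).mono fun x h => by rw [h]; ring),
    ip_eq_inner (F := dwP u u 1 1 + μ • dwP u u 0 0) (G := b.du2 1)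
      ((comb p11 p00).mono fun x h => by rw [h]; ring),
    ip_eq_inner (F := dwP u u 0 1) (G := b.du1 1 + b.du2 0)
      (by filter_upwards [coeFn_dwP u u 0 1, Lp.coeFn_add (b.du1 1) (b.du2 0)] with x h h'
          rw [h, h']; rfl),
    ip_eq_inner_add (F := kw u hk1 + μ • kw u hk2) (G := b.du1 0)
      (F' := kw u hk2 + μ • kw u hk1) (G' := b.du2 1)
      (by filter_upwards [comb w1 w2, comb w2 w1] with x h h'
          rw [h, h']; ring)]
  ring

set_option maxHeartbeats 2000000 in
theorem formA_eq (μ : ℝ) : formA μ u b =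
    inner ℝ (u.du1 0) (b.du1 0) + inner ℝ (u.du1 1) (b.du1 1)
      + (inner ℝ (u.du2 0) (b.du2 0) + inner ℝ (u.du2 1) (b.du2 1))
      + (1 + μ) / (1 - μ) * inner ℝ (u.du1 0 + u.du2 1) (b.du1 0 + b.du2 1) := by
  have h : ∀ F G : L2 Ω, ip Ω F G = inner ℝ F G := fun F G =>
    ip_eq_inner (Filter.Eventually.of_forall fun _ => rfl)
  rw [formA, Fin.sum_univ_two, Fin.sum_univ_two, h, h, h, h,
    ip_eq_inner (F := u.du1 0 + u.du2 1) (G := b.du1 0 + b.du2 1)]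
  filter_upwards [Lp.coeFn_add (u.du1 0) (u.du2 1), Lp.coeFn_add (b.du1 0) (b.du2 1)] with x h h'
  rw [h, h']
  rfl

set_option maxHeartbeats 2000000 in
/-- The forms `a + q` and `q̄` coincide. -/
theorem formA_add_formQ {μ : ℝ} (hμ : μ < 1) (hk1 : MemLp k1 ⊤ (volume.restrict Ω))
    (hk2 : MemLp k2 ⊤ (volume.restrict Ω)) :
    formA μ u b + formQ μ k1 k2 u b = formQbar μ k1 k2 u b := by
  have h : inner ℝ (u.du2 1) (b.du1 0) = inner ℝ (u.du2 0) (b.du1 1) := by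
    rw [du2_eq, du2_eq, du1_eq, du1_eq, inner_shift_symm]
  have h' : inner ℝ (u.du1 0) (b.du2 1) = inner ℝ (u.du1 1) (b.du2 0) := by
    rw [du2_eq, du2_eq, du1_eq, du1_eq, inner_shift_symm]
  have key := inner_elastic hμ (u₁ := u.du1) (u₂ := u.du2) (b₁ := b.du1) (b₂ := b.du2)
    (dwP u u 0 0) (dwP u u 1 1) (dwP u u 0 1) (kw u hk1)
    (kw u hk2) h h'
  rw [formA_eq, formQ_rest_eq hk1 hk2, formQbar_rest_eq hk1 hk2, stress11, stress22, strain_zero,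
    strain_one, strain_two]
  linarith

theorem coeFn_lapW : lapW u =ᵐ[volume.restrict Ω] u.lapw := by
  rw [lapW_apply, lapL_apply, Fin.sum_univ_two, ← snd_eq, ← snd_eq]
  filter_upwards [Lp.coeFn_add (u.2.2.1 ⟨⟨2, by omega⟩, fun _ => 0⟩)
    (u.2.2.1 ⟨⟨2, by omega⟩, fun _ => 1⟩)] with x h
  rw [h, W.lapw, Jet.lap, Fin.sum_univ_two]
  rfl

theorem ip_lapw : ip Ω u.lapw b.lapw = inner ℝ (lapW u) (lapW b) := by
  refine ip_eq_inner ?_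
  filter_upwards [coeFn_lapW u, coeFn_lapW b] with x h h'
  rw [h, h']

/-- The residual of the von Kármán equation. -/
def vonKarman (μ : ℝ) (g : Hm1 Ω) : ℝ :=
  denergyOf (2 * μ / (1 - μ)) lapW (linStrain (mulOp hk1) (mulOp hk2)) quadStrain (loadW g) u b

theorem vonKarman_eq {μ : ℝ} (hμ : μ < 1) (g : Hm1 Ω) :
    ip Ω u.lapw b.lapw + formQbar μ k1 k2 u b - g (toLower b.2.2) = vonKarman hk1 hk2 u b μ g := by
  rw [ip_lapw, formQbar_eq hk1 hk2 u b hμ]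
  rfl

end Forms

end

end FluidShell

namespace FluidShell

noncomputable section

/-! ### Solvability of the von Kármán equation -/

section Solvability

open Filter Topology

variable {Ω : Set (Eucl 2)}

/-- The mean value functional. -/
def meanL (hb : Bornology.IsBounded Ω) : H0 2 Ω →L[ℝ] ℝ :=
  innerSL ℝ (indicatorConstLp 2 MeasurableSet.univ
    (by simpa using hb.measure_lt_top.ne : (volume.restrict Ω) univ ≠ ⊤) (1 : ℝ)) ∘L fnL

theorem meanL_apply (hb : Bornology.IsBounded Ω) (w : H0 2 Ω) :
    meanL hb w = ∫ x in Ω, fnL w x := by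
  have h := L2.inner_indicatorConstLp_one (𝕜 := ℝ) MeasurableSet.univ
    (by simpa using hb.measure_lt_top.ne : (volume.restrict Ω) univ ≠ ⊤) (fnL w)
  rw [Measure.restrict_univ] at h
  exact h

/-- The space `Ŵ` as a subspace of `W`. -/
def whatSpace (hb : Bornology.IsBounded Ω) : Submodule ℝ (W Ω) :=
  LinearMap.ker (meanL hb ∘L ContinuousLinearMap.snd ℝ _ _
    ∘L ContinuousLinearMap.snd ℝ (H0 1 Ω) (H0 1 Ω × H0 2 Ω)).toLinearMap

theorem mem_whatSpace {hb : Bornology.IsBounded Ω} {u : W Ω} :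
    u ∈ whatSpace hb ↔ meanL hb u.2.2 = 0 := Iff.rfl

theorem mem_whatSpace_iff {hb : Bornology.IsBounded Ω} {u : W Ω} :
    u ∈ whatSpace hb ↔ u ∈ What Ω := by
  rw [mem_whatSpace, meanL_apply]
  rfl

/-- Korn's inequality in terms of vectors of a Hilbert space. -/
theorem norm_sq_le_of_inner_eq {Y : Type*} [NormedAddCommGroup Y] [InnerProductSpace ℝ Y]
    {a b p q : Y} {M : ℝ} (h : inner ℝ p q = inner ℝ a b) (ha : ‖a‖ ≤ M) (hb : ‖b‖ ≤ M)
    (hpq : ‖p + q‖ ≤ M) : ‖p‖ ≤ 2 * M ∧ ‖q‖ ≤ 2 * M := by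
  have h1 := norm_add_sq_real p q
  have h2 := (abs_le.1 (abs_real_inner_le_norm a b)).1
  have hM : 0 ≤ M := (norm_nonneg _).trans ha
  have h3 : ‖a‖ * ‖b‖ ≤ M * M := mul_le_mul ha hb (norm_nonneg _) hM
  have h4 : ‖p + q‖ ^ 2 ≤ M ^ 2 := pow_le_pow_left₀ (norm_nonneg _) hpq 2
  -- Here ‖p‖² + ‖q‖² = ‖p + q‖² − 2(a, b) ≤ 3M² ≤ (2M)².
  constructor <;> refine abs_le_of_sq_le_sq' ?_ (by positivity) |>.2 <;>
    nlinarith [sq_nonneg ‖p‖, sq_nonneg ‖q‖]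

variable {k1 k2 : Eucl 2 → ℝ} (hk1 : MemLp k1 ⊤ (volume.restrict Ω))
  (hk2 : MemLp k2 ⊤ (volume.restrict Ω))

theorem norm_le_of_add {Y : Type*} [NormedAddCommGroup Y] [NormedSpace ℝ Y] {a b c : Y}
    {L M N : ℝ} (h : ‖a + b + (1 / 2 : ℝ) • c‖ ≤ L) (hb : ‖b‖ ≤ M) (hc : ‖c‖ ≤ N) :
    ‖a‖ ≤ L + M + N := by
  have e : a = (a + b + (1 / 2 : ℝ) • c) - b - (1 / 2 : ℝ) • c := by abel
  have h1 : ‖(1 / 2 : ℝ) • c‖ ≤ N := by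
    rw [norm_smul]
    norm_num
    linarith [norm_nonneg c]
  rw [e]
  refine (norm_sub_le _ _).trans (add_le_add ((norm_sub_le _ _).trans (add_le_add h hb)) h1)

/-- A bound for Δw bounds w in `H²₀` by `exists_norm_le_lapL`, and the other quantities are bounded
linear or bilinear images of w. -/
theorem exists_norm_dw_le (hb : Bornology.IsBounded Ω) (L : ℝ) : ∃ M, ∀ u : W Ω, ‖lapW u‖ ≤ L →
    ‖u.2.2‖ ≤ M ∧ ‖kw u hk1‖ ≤ M ∧ ‖kw u hk2‖ ≤ M ∧ ∀ i j, ‖dwP u u i j‖ ≤ M := by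
  obtain ⟨C, hC, h⟩ := exists_norm_le_lapL hb
  obtain ⟨P, hP, hP'⟩ := exists_norm_prodL2_le Ω
  let r := C * L
  let s : Fin 2 → ℝ := fun i => ‖(shift i : H0 2 Ω →L[ℝ] H0 1 Ω)‖
  let c1 := ‖mulOp hk1 ∘L (fnL : H0 2 Ω →L[ℝ] L2 Ω)‖
  let c2 := ‖mulOp hk2 ∘L (fnL : H0 2 Ω →L[ℝ] L2 Ω)‖
  let m : Fin 2 → Fin 2 → ℝ := fun i j => P * (s i * r) * (s j * r)
  have hs : ∀ i, 0 ≤ s i := fun i => ContinuousLinearMap.opNorm_nonneg _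
  refine ⟨|r| + |c1 * r| + |c2 * r| + ∑ i, ∑ j, |m i j|, fun u hu => ?_⟩
  have hr : ‖u.2.2‖ ≤ r := (h u.2.2).trans (mul_le_mul_of_nonneg_left hu hC.le)
  have hr0 : 0 ≤ r := (norm_nonneg _).trans hr
  have h1 : ‖kw u hk1‖ ≤ c1 * r :=
    ((mulOp hk1 ∘L (fnL : H0 2 Ω →L[ℝ] L2 Ω)).le_opNorm u.2.2).trans
      (mul_le_mul_of_nonneg_left hr (ContinuousLinearMap.opNorm_nonneg _))
  have h2 : ‖kw u hk2‖ ≤ c2 * r :=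
    ((mulOp hk2 ∘L (fnL : H0 2 Ω →L[ℝ] L2 Ω)).le_opNorm u.2.2).trans
      (mul_le_mul_of_nonneg_left hr (ContinuousLinearMap.opNorm_nonneg _))
  have h3 : ∀ i, ‖shift i u.2.2‖ ≤ s i * r := fun i =>
    ((shift i : H0 2 Ω →L[ℝ] H0 1 Ω).le_opNorm u.2.2).trans
      (mul_le_mul_of_nonneg_left hr (hs i))
  have h4 : ∀ i j, ‖dwP u u i j‖ ≤ m i j := fun i j =>
    (hP' (shift i u.2.2) (shift j u.2.2)).trans
      (mul_le_mul (mul_le_mul_of_nonneg_left (h3 i) hP.le) (h3 j) (norm_nonneg _)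
        (mul_nonneg hP.le (mul_nonneg (hs i) hr0)))
  have h5 : 0 ≤ ∑ i, ∑ j, |m i j| :=
    Finset.sum_nonneg fun _ _ => Finset.sum_nonneg fun _ _ => abs_nonneg _
  have h6 : ∀ i j, |m i j| ≤ ∑ i, ∑ j, |m i j| := fun i j =>
    (Finset.single_le_sum (f := fun j => |m i j|) (fun _ _ => abs_nonneg _)
      (Finset.mem_univ j)).trans (Finset.single_le_sum (f := fun i => ∑ j, |m i j|)
        (fun _ _ => Finset.sum_nonneg fun _ _ => abs_nonneg _) (Finset.mem_univ i))
  have e0 := abs_nonneg r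
  have e1 := abs_nonneg (c1 * r)
  have e2 := abs_nonneg (c2 * r)
  refine ⟨?_, ?_, ?_, fun i j => ?_⟩
  · linarith [le_abs_self r]
  · linarith [le_abs_self (c1 * r)]
  · linarith [le_abs_self (c2 * r)]
  · linarith [h4 i j, h6 i j, le_abs_self (m i j)]

/-- Bounds on the Laplacian and on the strains bound the displacement. -/
theorem exists_norm_le_of_strain_le (hb : Bornology.IsBounded Ω) (L : ℝ) : ∃ R, ∀ u : W Ω,
    ‖lapW u‖ ≤ L → (∀ i, ‖strain hk1 hk2 u i‖ ≤ L) → ‖u‖ ≤ R := by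
  obtain ⟨M, hM⟩ := exists_norm_dw_le hk1 hk2 hb L
  obtain ⟨C, hC, h⟩ := exists_norm_le_grad hb
  let N := L + M + M
  refine ⟨|M| + C * (4 * |N|), fun u hu hE => ?_⟩
  obtain ⟨hw, h1, h2, hd⟩ := hM u hu
  have hM0 : 0 ≤ M := (norm_nonneg _).trans hw
  have a0 : ‖fnL (shift 0 u.1)‖ ≤ N := by
    have h0 := hE 0
    rw [strain_zero, du1_eq] at h0
    exact norm_le_of_add h0 h1 (hd 0 0)
  have b0 : ‖fnL (shift 1 u.2.1)‖ ≤ N := by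
    have h0 := hE 1
    rw [strain_one, du2_eq] at h0
    exact norm_le_of_add h0 h2 (hd 1 1)
  have c0 : ‖fnL (shift 1 u.1) + fnL (shift 0 u.2.1)‖ ≤ N := by
    have h0 := hE 2
    rw [strain_two, du1_eq, du2_eq] at h0
    have h3 := norm_le_of_add (a := fnL (shift 1 u.1) + fnL (shift 0 u.2.1))
      (b := dwP u u 0 1) (c := 0) (N := M) (by simpa using h0) (hd 0 1) (by simpa using hM0)
    exact h3
  -- Plane Korn inequality: only the sum u¹_{x₂} + u²_{x₁} is controlled, but its cross term
  -- (u¹_{x₂}, u²_{x₁}) equals (u¹_{x₁}, u²_{x₂}), where both factors are already bounded.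
  have hK := norm_sq_le_of_inner_eq
    (inner_shift_symm (k := 0) (l := 0) 1 0 u.1 u.2.1) a0 b0 c0
  have hN : N ≤ |N| := le_abs_self N
  have hN0 : 0 ≤ |N| := abs_nonneg N
  have g1 : ‖u.1‖ ≤ C * (4 * |N|) := by
    refine (h u.1).trans (mul_le_mul_of_nonneg_left ?_ hC.le)
    rw [Fin.sum_univ_two]
    linarith [hK.1]
  have g2 : ‖u.2.1‖ ≤ C * (4 * |N|) := by
    refine (h u.2.1).trans (mul_le_mul_of_nonneg_left ?_ hC.le)
    rw [Fin.sum_univ_two]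
    linarith [hK.2]
  have hMa := le_abs_self M
  have hCN : 0 ≤ C * (4 * |N|) := by positivity
  rw [Prod.norm_def, Prod.norm_def]
  refine max_le ?_ (max_le ?_ ?_) <;> linarith [abs_nonneg M]

theorem exists_load_le (hb : Bornology.IsBounded Ω) (g : Hm1 Ω) :
    ∃ γ : ℝ, 0 ≤ γ ∧ ∀ u : W Ω, |loadW g u| ≤ γ * ‖lapW u‖ := by
  obtain ⟨C, hC, h⟩ := exists_norm_le_lapL hb
  let T : H0 2 Ω →L[ℝ] ℝ := g ∘L lowerL
  refine ⟨‖T‖ * C, mul_nonneg T.opNorm_nonneg hC.le, fun u => ?_⟩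
  refine (T.le_opNorm u.2.2).trans ?_
  rw [mul_assoc]
  exact mul_le_mul_of_nonneg_left (h u.2.2) T.opNorm_nonneg

/-- The energy of the shell. -/
def shellEnergy (μ : ℝ) (g : Hm1 Ω) (u : W Ω) : ℝ :=
  energyOf (2 * μ / (1 - μ)) lapW (linStrain (mulOp hk1) (mulOp hk2)) quadStrain (loadW g) u

theorem shellEnergy_eq (μ : ℝ) (g : Hm1 Ω) (u : W Ω) : shellEnergy hk1 hk2 μ g u
    = 1 / 2 * ‖lapW u‖ ^ 2 + 1 / 2 * stressForm (2 * μ / (1 - μ)) (strain hk1 hk2 u)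
      (strain hk1 hk2 u) - loadW g u := rfl

/-- The load grows at most linearly in ‖Δw‖ while the bending energy is quadratic; the nonnegative
membrane energy then bounds the strains. -/
theorem exists_norm_le_of_energy_le (hb : Bornology.IsBounded Ω) {μ : ℝ} (hμ0 : 0 < μ)
    (hμ : μ < 1) (g : Hm1 Ω) : ∃ m : ℝ, (∀ u, m ≤ shellEnergy hk1 hk2 μ g u) ∧
      ∀ M, ∃ R, ∀ u, shellEnergy hk1 hk2 μ g u ≤ M → ‖u‖ ≤ R := by
  obtain ⟨γ, hγ, h⟩ := exists_load_le hb g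
  have hc : 0 ≤ 2 * μ / (1 - μ) := div_nonneg (by linarith) (by linarith)
  -- The minimum of s²/2 − γs over real s.
  refine ⟨-(γ ^ 2 / 2), fun u => ?_, fun M => ?_⟩
  · have h1 := stressForm_self_nonneg hc (strain hk1 hk2 u)
    have h2 := (abs_le.1 (h u)).2
    rw [shellEnergy_eq]
    nlinarith [sq_nonneg (‖lapW u‖ - γ)]
  -- If s = ‖Δw‖ exceeded t, then s ≥ 2 and s/2 − γ ≥ 1 + |M|/2, so s²/2 − γs > M. Given s ≤ t, each
  -- strain has square norm at most 2(|M| + γt).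
  · let t := 2 * γ + 2 + |M|
    have ht : 0 ≤ t := by positivity
    obtain ⟨R, hR⟩ := exists_norm_le_of_strain_le hk1 hk2 hb (t + √(2 * (|M| + γ * t)))
    refine ⟨R, fun u hu => ?_⟩
    rw [shellEnergy_eq] at hu
    have h1 := stressForm_self_nonneg hc (strain hk1 hk2 u)
    have h2 := (abs_le.1 (h u)).2
    have hM := le_abs_self M
    have hM0 := abs_nonneg M
    have hl : ‖lapW u‖ ≤ t := by
      by_contra hlt
      push Not at hlt
      have h3 : 1 + |M| / 2 ≤ ‖lapW u‖ / 2 - γ := by linarith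
      nlinarith
    have hl2 : γ * ‖lapW u‖ ≤ γ * t := mul_le_mul_of_nonneg_left hl hγ
    refine hR u (hl.trans (le_add_of_nonneg_right (Real.sqrt_nonneg _))) fun i => ?_
    refine (Real.le_sqrt_of_sq_le ?_).trans (le_add_of_nonneg_left ht)
    have h4 := norm_sq_le_stressForm hc (strain hk1 hk2 u) i
    nlinarith [sq_nonneg ‖lapW u‖]

-- The linear part of a strain is weakly continuous. The quadratic part even converges strongly: the
-- first derivatives of w converge in `L²` by compactness and are bounded in `H¹₀`, so
-- `tendsto_prodB` applies.
set_option maxHeartbeats 1000000 in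
theorem weakTendsto_strain (hb : Bornology.IsBounded Ω) {u : ℕ → W Ω} {a : W Ω} {R : ℝ}
    (hR : ∀ n, ‖u n‖ ≤ R) (h1 : WeakTendsto (fun n => (u n).1) a.1)
    (h2 : WeakTendsto (fun n => (u n).2.1) a.2.1) (h3 : WeakTendsto (fun n => (u n).2.2) a.2.2)
    (i : Fin 3) : WeakTendsto (fun n => strain hk1 hk2 (u n) i) (strain hk1 hk2 a i) := by
  have hw : ∀ n, ‖(u n).2.2‖ ≤ R := fun n =>
    ((norm_snd_le _).trans (norm_snd_le _)).trans (hR n)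
  have hq : ∀ i j, Tendsto (fun n => dwP (u n) (u n) i j) atTop (𝓝 (dwP a a i j)) := by
    intro i j
    let s : ℝ := max ‖(shift i : H0 2 Ω →L[ℝ] H0 1 Ω)‖ ‖(shift j : H0 2 Ω →L[ℝ] H0 1 Ω)‖
    have hs0 : 0 ≤ s := (ContinuousLinearMap.opNorm_nonneg _).trans (le_max_left _ _)
    have hb' : ∀ l, ‖(shift l : H0 2 Ω →L[ℝ] H0 1 Ω)‖ ≤ s → ∀ n,
        ‖shift l (u n).2.2‖ ≤ s * R := fun l hl n =>
      ((shift l : H0 2 Ω →L[ℝ] H0 1 Ω).le_opNorm _).trans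
        (mul_le_mul hl (hw n) (norm_nonneg _) hs0)
    exact tendsto_prodB (hb' i (le_max_left _ _)) (hb' j (le_max_right _ _))
      (tendsto_shift_of_weakTendsto hb hw h3 i) (tendsto_shift_of_weakTendsto hb hw h3 j)
  fin_cases i
  · exact ((h1.map (fnL ∘L shift 0)).add (h3.map (mulOp hk1 ∘L fnL))).add
      ((weakTendsto_of_tendsto (hq 0 0)).smul (1 / 2))
  · exact ((h2.map (fnL ∘L shift 1)).add (h3.map (mulOp hk2 ∘L fnL))).add
      ((weakTendsto_of_tendsto (hq 1 1)).smul (1 / 2))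
  · exact ((h1.map (fnL ∘L shift 1)).add (h2.map (fnL ∘L shift 0))).add
      ((weakTendsto_of_tendsto ((hq 0 1).add (hq 1 0))).smul (1 / 2))

/-- The product `W` carries the maximum norm and is not a Hilbert space, so subsequences are
extracted successively for the three components. -/
theorem exists_subseq_weakTendsto_W {u : ℕ → W Ω} {R : ℝ} (hR : ∀ n, ‖u n‖ ≤ R) :
    ∃ a : W Ω, ∃ ns : ℕ → ℕ, StrictMono ns ∧ WeakTendsto (fun n => (u (ns n)).1) a.1 ∧
      WeakTendsto (fun n => (u (ns n)).2.1) a.2.1 ∧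
      WeakTendsto (fun n => (u (ns n)).2.2) a.2.2 := by
  obtain ⟨a1, n1, hn1, h1⟩ := exists_subseq_weakTendsto
    (x := fun n => (u n).1) (R := R) fun n => (norm_fst_le _).trans (hR n)
  obtain ⟨a2, n2, hn2, h2⟩ := exists_subseq_weakTendsto
    (x := fun n => (u (n1 n)).2.1) (R := R)
    fun n => ((norm_fst_le _).trans (norm_snd_le _)).trans (hR _)
  obtain ⟨a3, n3, hn3, h3⟩ := exists_subseq_weakTendsto
    (x := fun n => (u (n1 (n2 n))).2.2) (R := R)
    fun n => ((norm_snd_le _).trans (norm_snd_le _)).trans (hR _)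
  exact ⟨(a1, a2, a3), n1 ∘ n2 ∘ n3, hn1.comp (hn2.comp hn3),
    h1.comp_subseq (hn2.comp hn3), h2.comp_subseq hn3, h3⟩

end Solvability

end

end FluidShell

namespace FluidShell

noncomputable section

/-! ### Existence of a minimizer, and the a priori bound without curvature -/

section Solvability

open Filter Topology

variable {Ω : Set (Eucl 2)}

variable {k1 k2 : Eucl 2 → ℝ} (hk1 : MemLp k1 ⊤ (volume.restrict Ω))
  (hk2 : MemLp k2 ⊤ (volume.restrict Ω))

theorem shellEnergy_le_of_weakTendsto (hb : Bornology.IsBounded Ω) {μ : ℝ}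
    (hc : 0 ≤ 2 * μ / (1 - μ)) (g : Hm1 Ω) {u : ℕ → W Ω} {a : W Ω} {R : ℝ}
    (hR : ∀ n, ‖u n‖ ≤ R) (h1 : WeakTendsto (fun n => (u n).1) a.1)
    (h2 : WeakTendsto (fun n => (u n).2.1) a.2.1) (h3 : WeakTendsto (fun n => (u n).2.2) a.2.2)
    {e : ℕ → ℝ} {m : ℝ} (he : Tendsto e atTop (𝓝 m))
    (h : ∀ n, shellEnergy hk1 hk2 μ g (u n) ≤ e n) : shellEnergy hk1 hk2 μ g a ≤ m := by
  have hΛ : WeakTendsto (fun n => lapW (u n)) (lapW a) := fun y => by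
    simp only [lapW_apply]
    exact h3.map lapL y
  have hG : Tendsto (fun n => loadW g (u n)) atTop (𝓝 (loadW g a)) := by
    have := h3.apply_dual (g ∘L lowerL)
    exact this
  have hE : ∀ i, WeakTendsto
      (fun n => strainOf (linStrain (mulOp hk1) (mulOp hk2)) quadStrain (u n) i)
      (strainOf (linStrain (mulOp hk1) (mulOp hk2)) quadStrain a i) := 
    weakTendsto_strain hk1 hk2 hb hR h1 h2 h3
  exact energyOf_le_of_weakTendsto hc hΛ hE hG he h

set_option maxHeartbeats 1000000 in
/-- The energy has a minimizer in `Ŵ`. -/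
theorem exists_isMin (hb : Bornology.IsBounded Ω) {μ : ℝ} (hμ0 : 0 < μ)
    (hμ : μ < 1) (g : Hm1 Ω) : ∃ u ∈ whatSpace hb, ∀ v ∈ whatSpace hb,
      shellEnergy hk1 hk2 μ g u ≤ shellEnergy hk1 hk2 μ g v := by
  obtain ⟨m0, hm0, hbd⟩ := exists_norm_le_of_energy_le hk1 hk2 hb hμ0 hμ g
  have hc : 0 ≤ 2 * μ / (1 - μ) := div_nonneg (by linarith) (by linarith)
  set S := shellEnergy hk1 hk2 μ g '' whatSpace hb
  have hSne : S.Nonempty := ⟨_, mem_image_of_mem _ (whatSpace hb).zero_mem⟩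
  have hSb : BddBelow S := ⟨m0, by rintro _ ⟨u, -, rfl⟩; exact hm0 u⟩
  obtain ⟨e, -, he, heS⟩ := exists_seq_tendsto_sInf hSne hSb
  choose u hu heu using heS
  obtain ⟨M, hM⟩ := he.bddAbove_range
  obtain ⟨R, hR⟩ := hbd M
  have huR : ∀ n, ‖u n‖ ≤ R := fun n => hR _ (by rw [heu]; exact hM ⟨n, rfl⟩)
  obtain ⟨a, ns, hns, h1, h2, h3⟩ := exists_subseq_weakTendsto_W huR
  refine ⟨a, ?_, fun v hv => le_trans ?_ (csInf_le hSb (mem_image_of_mem _ hv))⟩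
  -- The mean value is a continuous linear functional, so the constraint survives the weak limit.
  · have h4 := h3.apply_dual (meanL hb)
    rw [mem_whatSpace]
    refine tendsto_nhds_unique h4 (tendsto_const_nhds.congr fun n => ?_)
    exact (mem_whatSpace.1 (hu (ns n))).symm
  · exact shellEnergy_le_of_weakTendsto hk1 hk2 hb hc g (fun n => huR (ns n)) h1 h2 h3
      (he.comp hns.tendsto_atTop) fun n => (heu (ns n)).le

theorem exists_solvesVonKarman (ho : IsOpen Ω) (hb : Bornology.IsBounded Ω) {μ : ℝ} (hμ0 : 0 < μ)
    (hμ : μ < 1) (hk1 : ContinuousOn k1 (closure Ω)) (hk2 : ContinuousOn k2 (closure Ω))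
    (g : Hm1 Ω) : ∃ u ∈ What Ω, SolvesVonKarman μ k1 k2 g u := by
  have h1 := memLp_top_of_continuousOn ho hb hk1
  have h2 := memLp_top_of_continuousOn ho hb hk2
  obtain ⟨u, hu, hmin⟩ := exists_isMin h1 h2 hb hμ0 hμ g
  refine ⟨u, mem_whatSpace_iff.1 hu, fun β hβ => ?_⟩
  rw [vonKarman_eq h1 h2 u β hμ]
  exact denergyOf_eq_zero_of_isMin (fun i u v => quadStrain_symm u v i) hu hmin
    (mem_whatSpace_iff.2 hβ)

theorem two_smul_add_zero {X Y : Type*} [NormedAddCommGroup X] [NormedSpace ℝ X]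
    [NormedAddCommGroup Y] [NormedSpace ℝ Y] (A : X →L[ℝ] Y) (x : X) {k : Y} (hk : k = 0) :
    A ((2 : ℝ) • x) + k = (2 : ℝ) • (A x + k) := by
  rw [hk, map_smul, add_zero, add_zero]

-- Without curvature terms the strains are homogeneous of degree two when ū has weight 2 and w has
-- weight 1; (2ū; w) is the corresponding Euler direction.
set_option maxHeartbeats 2000000 in
theorem dstrain_double (h1 : ∀ f, mulOp hk1 f = 0) (h2 : ∀ f, mulOp hk2 f = 0) (u : W Ω)
    (i : Fin 3) :
    dstrain hk1 hk2 u ((2 : ℝ) • u.1, (2 : ℝ) • u.2.1, u.2.2) i = (2 : ℝ) • strain hk1 hk2 u i := by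
  have key : ∀ a q : L2 Ω, (2 : ℝ) • a + q = (2 : ℝ) • (a + (1 / 2 : ℝ) • q) := fun a q => by module
  have e : linStrain (mulOp hk1) (mulOp hk2) i ((2 : ℝ) • u.1, (2 : ℝ) • u.2.1, u.2.2)
      = (2 : ℝ) • linStrain (mulOp hk1) (mulOp hk2) i u := by
    fin_cases i
    · refine (linStrain_zero _ _ _).trans (Eq.trans ?_ (congrArg _ (linStrain_zero _ _ u).symm))
      exact two_smul_add_zero (fnL ∘L shift 0) u.1 (h1 _)
    · refine (linStrain_one _ _ _).trans (Eq.trans ?_ (congrArg _ (linStrain_one _ _ u).symm))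
      exact two_smul_add_zero (fnL ∘L shift 1) u.2.1 (h2 _)
    · refine (linStrain_two _ _ _).trans (Eq.trans ?_ (congrArg _ (linStrain_two _ _ u).symm))
      exact (congrArg₂ (· + ·) (map_smul (fnL ∘L shift 1) (2 : ℝ) u.1)
        (map_smul (fnL ∘L shift 0) (2 : ℝ) u.2.1)).trans (smul_add _ _ _).symm
  have q : quadStrain i u ((2 : ℝ) • u.1, (2 : ℝ) • u.2.1, u.2.2) = quadStrain i u u := by
    fin_cases i <;> rfl
  exact (congrArg₂ (· + ·) e q).trans (key _ _)

theorem stressForm_smul_right {Y : Type*} [NormedAddCommGroup Y] [InnerProductSpace ℝ Y] (c t : ℝ)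
    (E : Fin 3 → Y) {F : Fin 3 → Y} (h : ∀ i, F i = t • E i) :
    stressForm c E F = t * stressForm c E E := by
  simp only [stressForm, h, inner_add_right, inner_smul_right]
  ring

/-- Testing with (2ū; w) gives ‖Δw‖² + 2S(ε, ε) = (g, w) ≤ γ‖Δw‖. Therefore ‖Δw‖ ≤ γ, and each
strain satisfies ‖ε_i‖² ≤ S(ε, ε) ≤ γ², which bounds u. -/
theorem isBounded_solutions (ho : IsOpen Ω) (hb : Bornology.IsBounded Ω) {μ : ℝ} (hμ0 : 0 < μ)
    (hμ : μ < 1) (hk1 : ContinuousOn k1 (closure Ω)) (hk2 : ContinuousOn k2 (closure Ω))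
    (g : Hm1 Ω) (h0 : ∀ x ∈ Ω, k1 x = 0 ∧ k2 x = 0) :
    Bornology.IsBounded {u : W Ω | u ∈ What Ω ∧ SolvesVonKarman μ k1 k2 g u} := by
  have h1 := memLp_top_of_continuousOn ho hb hk1
  have h2 := memLp_top_of_continuousOn ho hb hk2
  have z : ∀ {k : Eucl 2 → ℝ} (hk : MemLp k ⊤ (volume.restrict Ω)), (∀ x ∈ Ω, k x = 0) →
      ∀ f, mulOp hk f = 0 := by
    intro k hk hk0 f
    refine Lp.ext ?_
    filter_upwards [coeFn_mulOp hk f, ae_restrict_mem ho.measurableSet,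
      Lp.coeFn_zero ℝ 2 (volume.restrict Ω)] with x e1 e2 e3
    rw [e1, e3, hk0 x e2, zero_mul, Pi.zero_apply]
  have z1 := z h1 fun x hx => (h0 x hx).1
  have z2 := z h2 fun x hx => (h0 x hx).2
  obtain ⟨γ, hγ, hload⟩ := exists_load_le hb g
  have hc : 0 ≤ 2 * μ / (1 - μ) := div_nonneg (by linarith) (by linarith)
  obtain ⟨R, hR⟩ := exists_norm_le_of_strain_le h1 h2 hb γ
  refine isBounded_iff_forall_norm_le.2 ⟨R, fun u ⟨hu, hsol⟩ => ?_⟩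
  -- The direction leaves w unchanged, so its membership in `Ŵ` is that of `u`.
  have hβ := hsol ((2 : ℝ) • u.1, (2 : ℝ) • u.2.1, u.2.2) hu
  rw [vonKarman_eq h1 h2 u _ hμ] at hβ
  have e1 : inner ℝ (lapW u) (lapW u) + stressForm (2 * μ / (1 - μ)) (strain h1 h2 u)
      (dstrain h1 h2 u ((2 : ℝ) • u.1, (2 : ℝ) • u.2.1, u.2.2)) - loadW g u = 0 := hβ
  rw [stressForm_smul_right _ 2 _ (dstrain_double h1 h2 z1 z2 u), real_inner_self_eq_norm_sq] at e1
  have h3 := (abs_le.1 (hload u)).2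
  have h4 := stressForm_self_nonneg hc (strain h1 h2 u)
  have h5 := norm_nonneg (lapW u)
  have hl : ‖lapW u‖ ≤ γ := by
    by_contra hlt
    push Not at hlt
    nlinarith
  refine hR u hl fun i => abs_le_of_sq_le_sq' ?_ hγ |>.2
  have h6 := norm_sq_le_stressForm hc (strain h1 h2 u) i
  nlinarith

end Solvability

end

end FluidShell

namespace FluidShell

noncomputable section

/-! ### The geometry of the fluid domain -/

section Geometry

variable {O : Set (Eucl 3)} {Ω : Set (Eucl 2)}

theorem frontier_height_nonpos (hdom : IsFluidShellDomain O Ω) {x : Eucl 3}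
    (hx : x ∈ frontier O) : x 2 ≤ 0 := by
  by_cases h : x ∈ embed '' Ω
  · obtain ⟨y, -, rfl⟩ := h
    simp [embed]
  · exact hdom.wall_below x ⟨hx, h⟩

/-- The fluid lies below the plane of the shell. -/
theorem height_neg (hdom : IsFluidShellDomain O Ω) {x : Eucl 3} (hx : x ∈ O) : x 2 < 0 := by
  by_contra! h
  have hO := hdom.isOpen_fluid
  have hc : Continuous fun y : Eucl 3 => y 2 := (contDiff_coord (n := 0) 2).continuous
  obtain ⟨y, hy, hmax⟩ := hdom.isBounded_fluid.isCompact_closure.exists_isMaxOn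
    ⟨x, subset_closure hx⟩ hc.continuousOn
  -- From each point of the open set `O` one can move upwards inside `O`, so the maximum of x₃ over
  -- the closure is not attained in `O`. If `O` reached the level x₃ ≥ 0, that maximum would be
  -- positive, which is impossible on the boundary as well.
  have up : ∀ z ∈ O, ∃ z' ∈ O, z 2 < z' 2 := by
    intro z hz
    have hl : Filter.Tendsto (fun t : ℝ => z + t • EuclideanSpace.single (2 : Fin 3) (1 : ℝ))
        (nhdsWithin 0 (Ioi 0)) (nhds z) := by
      have : Continuous fun t : ℝ => z + t • EuclideanSpace.single (2 : Fin 3) (1 : ℝ) := by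
        fun_prop
      simpa using (this.tendsto 0).mono_left nhdsWithin_le_nhds
    obtain ⟨t, ht, ht0⟩ := ((hl.eventually (hO.mem_nhds hz)).and self_mem_nhdsWithin).exists
    exact ⟨_, ht, by simpa using ht0⟩
  obtain ⟨x', hx', hlt⟩ := up x hx
  have hy0 : 0 < y 2 := (h.trans_lt hlt).trans_le (hmax (subset_closure hx'))
  have hyO : y ∈ O := by
    by_contra hn
    exact absurd (frontier_height_nonpos hdom (hO.frontier_eq ▸ ⟨hy, hn⟩)) (not_le.2 hy0)
  obtain ⟨z, hz, hlt⟩ := up y hyO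
  exact absurd (hmax (subset_closure hz)) (not_le.2 hlt)

theorem isBounded_shell (hdom : IsFluidShellDomain O Ω) : Bornology.IsBounded Ω := by
  have hc : Continuous fun x : Eucl 3 => (!₂[x 0, x 1] : Eucl 2) := by fun_prop
  refine (hdom.isBounded_fluid.isCompact_closure.image hc).isBounded.subset fun y hy => ?_
  refine ⟨embed y, frontier_subset_closure (hdom.shell_subset ⟨y, hy, rfl⟩), ?_⟩
  ext i
  fin_cases i <;> simp [embed]

end Geometry

/-! ### Smooth solenoidal fields -/

section Fields

variable {O : Set (Eucl 3)} {Ω : Set (Eucl 2)}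

theorem contDiff_component {d n : ℕ} {φ : Eucl d → Eucl n} (hφ : ContDiff ℝ ∞ φ) (j : Fin n) :
    ContDiff ℝ ∞ fun x => φ x j := (contDiff_coord j).comp hφ

theorem zero_mem_smoothFields : (0 : Eucl 3 → Eucl 3) ∈ smoothFields O Ω :=
  ⟨contDiff_const, ⟨univ, isOpen_univ, subset_univ _, fun _ _ => rfl⟩, fun x _ => by simp⟩

theorem add_mem_smoothFields {φ ψ : Eucl 3 → Eucl 3} (hφ : φ ∈ smoothFields O Ω)
    (hψ : ψ ∈ smoothFields O Ω) : φ + ψ ∈ smoothFields O Ω := by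
  obtain ⟨h1, ⟨N, hN, hw, h2⟩, h3⟩ := hφ
  obtain ⟨h1', ⟨N', hN', hw', h2'⟩, h3'⟩ := hψ
  refine ⟨h1.add h1', ⟨N ∩ N', hN.inter hN', subset_inter hw hw', fun x hx => ?_⟩, fun x hx => ?_⟩
  · rw [Pi.add_apply, h2 x ⟨hx.1.1, hx.2⟩, h2' x ⟨hx.1.2, hx.2⟩, add_zero]
  · rw [fderiv_add (h1.differentiable (by simp) x) (h1'.differentiable (by simp) x)]
    simp only [add_apply, PiLp.add_apply, Finset.sum_add_distrib, h3 x hx, h3' x hx, add_zero]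

theorem smul_mem_smoothFields (c : ℝ) {φ : Eucl 3 → Eucl 3} (hφ : φ ∈ smoothFields O Ω) :
    c • φ ∈ smoothFields O Ω := by
  obtain ⟨h1, ⟨N, hN, hw, h2⟩, h3⟩ := hφ
  refine ⟨contDiff_const.smul h1, ⟨N, hN, hw, fun x hx => ?_⟩, fun x hx => ?_⟩
  · rw [Pi.smul_apply, h2 x hx, smul_zero]
  · rw [fderiv_const_smul (h1.differentiable (by simp) x)]
    simp only [smul_apply, PiLp.smul_apply, smul_eq_mul, ← Finset.mul_sum, h3 x hx, mul_zero]

theorem IsJetOf.add {d k : ℕ} {D : Set (Eucl d)} {φ ψ : Eucl d → ℝ} {U U' : Jet k D}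
    (hφ : ContDiff ℝ ∞ φ) (hψ : ContDiff ℝ ∞ ψ) (h : IsJetOf φ U) (h' : IsJetOf ψ U') :
    IsJetOf (φ + ψ) (U + U') := fun I => by
  rw [classicalDeriv_add hφ hψ]
  exact (Lp.coeFn_add _ _).trans ((h I).add (h' I))

theorem IsJetOf.smul {d k : ℕ} {D : Set (Eucl d)} {φ : Eucl d → ℝ} {U : Jet k D}
    (hφ : ContDiff ℝ ∞ φ) (c : ℝ) (h : IsJetOf φ U) : IsJetOf (c • φ) (c • U) := fun I => by
  rw [classicalDeriv_smul hφ]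
  exact (Lp.coeFn_smul _ _).trans ((h I).const_smul c)

theorem IsJetOf.fn_eq {d k : ℕ} {D : Set (Eucl d)} {φ : Eucl d → ℝ} {U : Jet k D}
    (h : IsJetOf φ U) : U.fn =ᵐ[volume.restrict D] φ := by
  have := h ⟨⟨0, by omega⟩, Fin.elim0⟩
  rwa [classicalDeriv_zero] at this

theorem IsJetOf.pd_eq {d k : ℕ} {D : Set (Eucl d)} {φ : Eucl d → ℝ} {U : Jet (k + 1) D}
    (hφ : ContDiff ℝ ∞ φ) (h : IsJetOf φ U) (i : Fin d) :
    U.pd i =ᵐ[volume.restrict D] partialD i φ := by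
  have := h ⟨⟨1, by omega⟩, fun _ => i⟩
  rwa [classicalDeriv_one hφ] at this

/-- The elements of `V` are limits of smooth fields. -/
theorem mem_closure_of_mem_V {v : VelJet O} (hv : v ∈ V O Ω) :
    v ∈ closure {U : VelJet O | ∃ φ ∈ smoothFields O Ω, ∀ j, IsJetOf (fun x => φ x j) (U j)} := by
  -- Jets of smooth fields already form a subspace, so the span may be dropped from the closure.
  let S : Submodule ℝ (VelJet O) :=
    { carrier := {U | ∃ φ ∈ smoothFields O Ω, ∀ j, IsJetOf (fun x => φ x j) (U j)}
      zero_mem' := by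
        refine ⟨0, zero_mem_smoothFields, fun j I => ?_⟩
        refine (Lp.coeFn_zero ℝ 2 _).trans (Filter.Eventually.of_forall fun x => ?_)
        have h := congrFun (classicalDeriv_smul (contDiff_const (c := (0 : ℝ))) 0 I) x
        rw [zero_smul, zero_smul] at h
        exact h.symm
      add_mem' := by
        rintro U U' ⟨φ, h1, h2⟩ ⟨ψ, h1', h2'⟩
        exact ⟨φ + ψ, add_mem_smoothFields h1 h1', fun j =>
          (h2 j).add (contDiff_component h1.1 j) (contDiff_component h1'.1 j) (h2' j)⟩
      smul_mem' := by
        rintro c U ⟨φ, h1, h2⟩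
        exact ⟨c • φ, smul_mem_smoothFields c h1, fun j =>
          (h2 j).smul (contDiff_component h1.1 j) c⟩ }
  have hS : Submodule.span ℝ {U : VelJet O | ∃ φ ∈ smoothFields O Ω,
      ∀ j, IsJetOf (fun x => φ x j) (U j)} = S := Submodule.span_eq S
  rw [V, hS] at hv
  exact hv

/-- A weight that vanishes for `x₃ ≥ -ε` and is positive for `x₃ < -ε`. -/
def depthWeight (ε : ℝ) (x : Eucl 3) : ℝ := expNegInvGlue (-x 2 - ε)

theorem contDiff_depthWeight (ε : ℝ) : ContDiff ℝ ∞ (depthWeight ε) :=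
  expNegInvGlue.contDiff.comp ((contDiff_coord 2).neg.sub contDiff_const)

theorem memLp_depthWeight (hdom : IsFluidShellDomain O Ω) (ε : ℝ) :
    MemLp (depthWeight ε) ⊤ (volume.restrict O) :=
  memLp_top_of_continuousOn hdom.isOpen_fluid hdom.isBounded_fluid
    (contDiff_depthWeight ε).continuous.continuousOn

/-- The weight depends on x₃ alone and hence commutes with horizontal differentiation. This is why
only horizontal Poincaré inequalities are available for weighted fields. -/
theorem partialD_depthWeight (ε : ℝ) {i : Fin 3} (hi : i ≠ 2) (x : Eucl 3) :
    partialD i (depthWeight ε) x = 0 := by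
  have h : (depthWeight ε) = (fun t => expNegInvGlue (-t - ε)) ∘
    (EuclideanSpace.proj 2 : Eucl 3 →L[ℝ] ℝ) := rfl
  have hg : ContDiff ℝ ∞ fun t : ℝ => expNegInvGlue (-t - ε) :=
    expNegInvGlue.contDiff.comp (contDiff_id.neg.sub contDiff_const)
  rw [partialD, h, fderiv_comp x (hg.differentiable (by simp) _)
    (ContinuousLinearMap.differentiableAt _), ContinuousLinearMap.fderiv]
  simp [hi.symm]

/-- Away from the shell, the components of a smooth field can be extended by zero. -/
theorem exists_test_depthWeight_mul (hdom : IsFluidShellDomain O Ω) {φ : Eucl 3 → Eucl 3}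
    (hφ : φ ∈ smoothFields O Ω) {ε : ℝ} (hε : 0 < ε) (j : Fin 3) :
    ∃ θ : Test O, ∀ x ∈ O, θ.1 x = depthWeight ε x * φ x j := by
  classical
  have hO := hdom.isOpen_fluid
  obtain ⟨h1, ⟨N, hN, hw, h2⟩, -⟩ := hφ
  let f : Eucl 3 → ℝ := O.indicator fun x => depthWeight ε x * φ x j
  -- A boundary point lies on the shell, where x₃ > −ε nearby and the weight vanishes, or on the
  -- wall, where the field itself vanishes nearby.
  have hf : ∀ x ∉ O, f =ᶠ[nhds x] 0 := by
    intro x hx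
    by_cases hc : x ∈ closure O
    · have hfr : x ∈ frontier O := hO.frontier_eq ▸ ⟨hc, hx⟩
      by_cases he : x ∈ embed '' Ω
      · have hx2 : -ε < x 2 := by
          obtain ⟨y, -, rfl⟩ := he
          simpa [embed] using hε
        have hcont : Continuous fun y : Eucl 3 => y 2 := (contDiff_coord (n := 0) 2).continuous
        filter_upwards [hcont.continuousAt.eventually (lt_mem_nhds hx2)] with y hy
        have : depthWeight ε y = 0 := expNegInvGlue.zero_of_nonpos (by linarith)
        simp [f, indicator, this]
      · filter_upwards [hN.mem_nhds (hw ⟨hfr, he⟩)] with y hy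
        by_cases hyO : y ∈ O
        · simp [f, indicator, h2 y ⟨hy, subset_closure hyO⟩]
        · simp [f, hyO]
    · filter_upwards [isClosed_closure.isOpen_compl.mem_nhds hc] with y hy
      exact indicator_of_notMem (fun h => hy (subset_closure h)) _
  have hsub : tsupport f ⊆ O := fun x hx => by
    by_contra hn
    exact (notMem_tsupport_iff_eventuallyEq.2 (hf x hn)) hx
  refine ⟨⟨f, contDiff_iff_contDiffAt.2 fun x => ?_, ?_, hsub⟩,
    fun x hx => (indicator_of_mem hx _ : f x = _)⟩
  · by_cases hx : x ∈ O
    · refine ContDiffAt.congr_of_eventuallyEq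
        ((contDiff_depthWeight ε).mul (contDiff_component h1 j)).contDiffAt ?_
      filter_upwards [hO.mem_nhds hx] with y hy
      exact indicator_of_mem hy _
    · exact contDiffAt_const.congr_of_eventuallyEq (hf x hx)
  · exact HasCompactSupport.of_support_subset_isCompact hdom.isBounded_fluid.isCompact_closure
      (support_indicator_subset.trans subset_closure)

/-- Poincaré's inequality in the horizontal directions. -/
theorem exists_norm_depthWeight_le (hdom : IsFluidShellDomain O Ω) {ε : ℝ} (hε : 0 < ε) :
    ∃ C : ℝ, ∀ v ∈ V O Ω, ∀ j, ∀ i ≠ (2 : Fin 3),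
      ‖mulOp (memLp_depthWeight hdom ε) (v j).fn‖
        ≤ C * ‖mulOp (memLp_depthWeight hdom ε) ((v j).pd i)‖ := by
  obtain ⟨C, -, hC⟩ := exists_poincare (k := 0) hdom.isBounded_fluid
  refine ⟨C, fun v hv j i hi => ?_⟩
  have hcl : IsClosed {v : VelJet O | ‖mulOp (memLp_depthWeight hdom ε) (v j).fn‖
        ≤ C * ‖mulOp (memLp_depthWeight hdom ε) ((v j).pd i)‖} := by
    refine isClosed_le ?_ ?_ <;> simp only [Jet.fn, Jet.pd] <;> fun_prop
  refine closure_minimal ?_ hcl (mem_closure_of_mem_V hv)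
  rintro U ⟨φ, hφ, hU⟩
  obtain ⟨θ, hθ⟩ := exists_test_depthWeight_mul hdom hφ hε j
  have hmem := ae_restrict_mem (μ := volume) hdom.isOpen_fluid.measurableSet
  have e1 : mulOp (memLp_depthWeight hdom ε) (U j).fn = Test.toL2 θ := by
    refine Lp.ext ?_
    filter_upwards [coeFn_mulOp (memLp_depthWeight hdom ε) (U j).fn, (hU j).fn_eq,
      Test.coeFn_toL2 θ, hmem] with x a b c d
    rw [a, b, c, hθ x d]
  have e2 : mulOp (memLp_depthWeight hdom ε) ((U j).pd i) = Test.toL2 (Test.deriv i θ) := by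
    refine Lp.ext ?_
    filter_upwards [coeFn_mulOp (memLp_depthWeight hdom ε) ((U j).pd i),
      (hU j).pd_eq (contDiff_component hφ.1 j) i,
      Test.coeFn_toL2 (Test.deriv i θ), hmem] with x a b c d
    have h : partialD i θ.1 x = partialD i (fun y => depthWeight ε y * φ y j) x := by
      rw [partialD, partialD, Filter.EventuallyEq.fderiv_eq]
      filter_upwards [hdom.isOpen_fluid.mem_nhds d] with y hy
      exact hθ y hy
    rw [a, b, c, Test.coe_deriv, h, partialD_mul i
      ((contDiff_depthWeight ε).differentiable (by simp) x)
      ((contDiff_component hφ.1 j).differentiable (by simp) x), partialD_depthWeight ε hi]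
    ring
  have h := hC i (Test.jet 1 θ)
  rw [shift_jet, fnL_jet, fnL_jet] at h
  rw [mem_ofPred_eq, e1, e2]
  exact h

/-- The weighted Poincaré inequality kills the function where x₃ < −1/(n + 1), for every n. These
sets exhaust `O`, because `O` lies strictly below the plane. -/
theorem fn_eq_zero_of_pd_eq_zero (hdom : IsFluidShellDomain O Ω) {v : VelJet O} (hv : v ∈ V O Ω)
    {i j : Fin 3} (hi : i ≠ 2) (h : (v j).pd i = 0) : (v j).fn = 0 := by
  have h0 : ∀ n : ℕ, ∀ᵐ x ∂volume.restrict O,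
      depthWeight (1 / (n + 1 : ℝ)) x * (v j).fn x = 0 := by
    intro n
    have hn : (0 : ℝ) < 1 / (n + 1 : ℝ) := by positivity
    obtain ⟨C, hC⟩ := exists_norm_depthWeight_le hdom hn
    have h1 := hC v hv j i hi
    rw [h, map_zero, norm_zero, mul_zero, norm_le_zero_iff] at h1
    filter_upwards [coeFn_mulOp (memLp_depthWeight hdom (1 / (n + 1 : ℝ))) (v j).fn,
      Lp.coeFn_zero ℝ 2 (volume.restrict O)] with x a b
    rw [← a, h1, b, Pi.zero_apply]
  refine Lp.ext ?_
  filter_upwards [ae_all_iff.2 h0, ae_restrict_mem hdom.isOpen_fluid.measurableSet,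
    Lp.coeFn_zero ℝ 2 (volume.restrict O)] with x a b c
  have hx := height_neg hdom b
  obtain ⟨n, hn⟩ := exists_nat_one_div_lt (neg_pos.2 hx)
  rw [c, Pi.zero_apply]
  exact (mul_eq_zero.1 (a n)).resolve_left (expNegInvGlue.pos_of_pos (by linarith)).ne'

theorem inner_pd_toL2 {v : VelJet O} (hv : v ∈ V O Ω) (i j : Fin 3) (τ : Test O) :
    inner ℝ ((v j).pd i) (Test.toL2 τ) = - inner ℝ (v j).fn (Test.toL2 (Test.deriv i τ)) := by
  have hcl : IsClosed {v : VelJet O | inner ℝ ((v j).pd i) (Test.toL2 τ)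
      = - inner ℝ (v j).fn (Test.toL2 (Test.deriv i τ))} := by
    refine isClosed_eq ?_ ?_ <;> simp only [Jet.fn, Jet.pd] <;> fun_prop
  refine closure_minimal ?_ hcl (mem_closure_of_mem_V hv)
  rintro U ⟨φ, hφ, hU⟩
  have hφj := contDiff_component hφ.1 j
  have key : ∀ (F : L2 O) (f : Eucl 3 → ℝ) (σ : Test O), F =ᵐ[volume.restrict O] f →
      inner ℝ F (Test.toL2 σ) = ∫ x, f x * σ.1 x := by
    intro F f σ hF
    rw [← Test.setIntegral_eq, L2.inner_def]
    refine integral_congr_ae ?_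
    filter_upwards [hF, Test.coeFn_toL2 σ] with x a b
    simp [a, b, mul_comm]
  rw [mem_ofPred_eq, key _ _ τ ((hU j).pd_eq hφj i), key _ _ _ (hU j).fn_eq, Test.coe_deriv,
    Test.integral_mul_partialD i (hφj.of_le (by simp)) τ, neg_neg]

/-- The components of an element of `V` are weak derivatives of its zeroth component, since
integration by parts against test functions passes to limits; the fundamental lemma of the calculus
of variations concludes. It is needed because a jet stores its derivatives as separate entries. -/
theorem pd_eq_zero_of_fn_eq_zero (hdom : IsFluidShellDomain O Ω) {v : VelJet O} (hv : v ∈ V O Ω)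
    {j : Fin 3} (h : (v j).fn = 0) (i : Fin 3) : (v j).pd i = 0 := by
  have h0 : ∀ᵐ x, x ∈ O → (v j).pd i x = 0 := by
    refine hdom.isOpen_fluid.ae_eq_zero_of_integral_contDiff_smul_eq_zero ?_ ?_
    · have : Fact ((1 : ENNReal) ≤ 2) := ⟨by norm_num⟩
      exact locallyIntegrableOn_of_locallyIntegrable_restrict
        ((Lp.memLp ((v j).pd i)).locallyIntegrable (by norm_num))
    · intro τ h1 h2 h3
      have h4 := inner_pd_toL2 hv i j ⟨τ, h1, h2, h3⟩
      rw [h, inner_zero_left, neg_zero, L2.inner_def] at h4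
      rw [← h4, ← setIntegral_eq_integral_of_forall_compl_eq_zero (s := O)]
      · refine integral_congr_ae ?_
        filter_upwards [Test.coeFn_toL2 (⟨τ, h1, h2, h3⟩ : Test O)] with x a
        simp [a]
      · intro x hx
        have h5 : τ x = 0 := Test.eq_zero ⟨τ, h1, h2, h3⟩ hx
        rw [h5, zero_smul]
  refine Lp.ext ?_
  filter_upwards [(ae_restrict_iff' hdom.isOpen_fluid.measurableSet).2 h0,
    Lp.coeFn_zero ℝ 2 (volume.restrict O)] with x a b
  rw [a, b, Pi.zero_apply]

theorem jet_one_eq_zero {d : ℕ} {D : Set (Eucl d)} {U : Jet 1 D} (h0 : U.fn = 0)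
    (h1 : ∀ i, U.pd i = 0) : U = 0 := by
  refine PiLp.ext fun I => ?_
  obtain ⟨⟨m, hm⟩, I⟩ := I
  obtain rfl | rfl : m = 0 ∨ m = 1 := by omega
  · obtain rfl : I = Fin.elim0 := Subsingleton.elim _ _
    exact h0
  · have hI : I = fun _ => I 0 := by
      ext j
      fin_cases j; rfl
    rw [hI]
    exact h1 (I 0)

theorem pd_add_pd_eq_zero {v : V O Ω} (h : formE v v = 0) (i j : Fin 3) :
    (v.1 j).pd i + (v.1 i).pd j = 0 := by
  have e : ∀ i j, ip O (fun x => (v.1 j).pd i x + (v.1 i).pd j x)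
      (fun x => (v.1 j).pd i x + (v.1 i).pd j x) = ‖(v.1 j).pd i + (v.1 i).pd j‖ ^ 2 := by
    intro i j
    rw [← real_inner_self_eq_norm_sq, ip, L2.inner_def]
    refine integral_congr_ae ?_
    filter_upwards [Lp.coeFn_add ((v.1 j).pd i) ((v.1 i).pd j)] with x a
    rw [a]
    simp [sq]
  simp only [formE, e] at h
  have h1 : ∑ i : Fin 3, ∑ j : Fin 3, ‖(v.1 j).pd i + (v.1 i).pd j‖ ^ 2 = 0 := by linarith
  have h2 := (Finset.sum_eq_zero_iff_of_nonneg fun i _ =>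
    Finset.sum_nonneg fun j _ => sq_nonneg _).1 h1 i (Finset.mem_univ i)
  have h3 := (Finset.sum_eq_zero_iff_of_nonneg fun j _ => sq_nonneg _).1 h2 j (Finset.mem_univ j)
  exact norm_eq_zero.1 (pow_eq_zero_iff two_ne_zero |>.1 h3)

/-- Korn's inequality: a field of `V` without deformations vanishes. -/
theorem eq_zero_of_formE_eq_zero (hdom : IsFluidShellDomain O Ω) {v : V O Ω}
    (h : formE v v = 0) : v = 0 := by
  have hs := pd_add_pd_eq_zero h
  have hd : ∀ i, (v.1 i).pd i = 0 := fun i => by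
    have h1 := hs i i
    rw [← two_smul ℝ, smul_eq_zero] at h1
    exact h1.resolve_left two_ne_zero
  have f0 := fn_eq_zero_of_pd_eq_zero hdom v.2 (by decide : (0 : Fin 3) ≠ 2) (hd 0)
  have f1 := fn_eq_zero_of_pd_eq_zero hdom v.2 (by decide : (1 : Fin 3) ≠ 2) (hd 1)
  -- The diagonal entries give only ∂₃v³ = 0, a vertical derivative to which the weighted inequality
  -- does not apply. The off-diagonal entry ∂₁v³ + ∂₃v¹ = 0 together with v¹ = 0 supplies a
  -- horizontal derivative.
  have d2 : (v.1 2).pd 0 = 0 := by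
    have h1 := hs 0 2
    rwa [pd_eq_zero_of_fn_eq_zero hdom v.2 f0, add_zero] at h1
  have f2 := fn_eq_zero_of_pd_eq_zero hdom v.2 (by decide : (0 : Fin 3) ≠ 2) d2
  refine Subtype.ext (PiLp.ext fun j => ?_)
  have hf : (v.1 j).fn = 0 := by fin_cases j <;> assumption
  exact jet_one_eq_zero hf (pd_eq_zero_of_fn_eq_zero hdom v.2 hf)

end Fields

end

end FluidShell

namespace FluidShell

noncomputable section

/-! ### The fluid below the shell -/

section BelowShell

open Filter Topology

/-- The projection `(x₁, x₂, x₃) ↦ (x₁, x₂)`. -/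
def planeProj : Eucl 3 →L[ℝ] Eucl 2 :=
  (EuclideanSpace.proj 0 : Eucl 3 →L[ℝ] ℝ).smulRight (EuclideanSpace.single 0 1)
    + (EuclideanSpace.proj 1 : Eucl 3 →L[ℝ] ℝ).smulRight (EuclideanSpace.single 1 1)

/-- The point `(y₁, y₂, t)`. -/
def lift (y : Eucl 2) (t : ℝ) : Eucl 3 := !₂[y 0, y 1, t]

theorem lift_two (y : Eucl 2) (t : ℝ) : lift y t 2 = t := by simp [lift]

theorem planeProj_lift (y : Eucl 2) (t : ℝ) : planeProj (lift y t) = y := by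
  ext i
  fin_cases i <;> simp [planeProj, lift]

theorem lift_planeProj (x : Eucl 3) : lift (planeProj x) (x 2) = x := by
  ext i
  fin_cases i <;> simp [planeProj, lift]

theorem lift_zero (y : Eucl 2) : lift y 0 = embed y := rfl

theorem continuous_lift : Continuous fun p : Eucl 2 × ℝ => lift p.1 p.2 := by
  unfold lift
  fun_prop

theorem lift_eq (y : Eucl 2) (t : ℝ) :
    lift y t = embed y + t • EuclideanSpace.single (2 : Fin 3) (1 : ℝ) := by
  ext i
  fin_cases i <;> simp [lift, embed]

theorem embed_eq (y : Eucl 2) : embed y = y 0 • EuclideanSpace.single (0 : Fin 3) (1 : ℝ)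
    + y 1 • EuclideanSpace.single (1 : Fin 3) (1 : ℝ) := by
  ext i
  fin_cases i <;> simp [embed]

theorem hasDerivAt_lift (y : Eucl 2) (t : ℝ) :
    HasDerivAt (fun t => lift y t) (EuclideanSpace.single (2 : Fin 3) (1 : ℝ)) t := by
  simp only [lift_eq]
  simpa using ((hasDerivAt_id t).smul_const (EuclideanSpace.single (2 : Fin 3) (1 : ℝ))).const_add
    (embed y)

variable {O : Set (Eucl 3)} {Ω : Set (Eucl 2)}

theorem eq_zero_of_mem_frontier {d : ℕ} {D U : Set (Eucl d)} (hD : IsOpen D) {ρ : Eucl d → ℝ}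
    (hU : IsOpen U) (hρ : ContinuousOn ρ U) (h : D ∩ U = {y ∈ U | ρ y < 0}) {x : Eucl d}
    (hx : x ∈ frontier D) (hxU : x ∈ U) : ρ x = 0 := by
  rw [hD.frontier_eq] at hx
  have hc := hρ.continuousAt (hU.mem_nhds hxU)
  refine le_antisymm (le_of_not_gt fun hlt => ?_) (le_of_not_gt fun hlt => hx.2 ?_)
  · obtain ⟨y, hy, hyD⟩ := mem_closure_iff_nhds.1 hx.1 _
      (inter_mem (hU.mem_nhds hxU) (hc.eventually (lt_mem_nhds hlt)))
    have h1 : y ∈ D ∩ U := ⟨hyD, hy.1⟩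
    rw [h] at h1
    exact absurd hy.2 (not_lt.2 h1.2.le)
  · have h1 : x ∈ {y ∈ U | ρ y < 0} := ⟨hxU, hlt⟩
    rw [← h] at h1
    exact h1.1

/-- A defining function that vanishes on the plane near the point has no horizontal derivatives
there, so its nonzero gradient must be vertical. -/
theorem partialD_two_ne_zero {ρ : Eucl 3 → ℝ} {y : Eucl 2} (hρ : DifferentiableAt ℝ ρ (embed y))
    (h0 : ∀ᶠ z in 𝓝 y, ρ (embed z) = 0) (h : fderiv ℝ ρ (embed y) ≠ 0) :
    partialD 2 ρ (embed y) ≠ 0 := by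
  intro h2
  let E : Eucl 2 →L[ℝ] Eucl 3 :=
    (EuclideanSpace.proj 0 : Eucl 2 →L[ℝ] ℝ).smulRight (EuclideanSpace.single 0 1)
    + (EuclideanSpace.proj 1 : Eucl 2 →L[ℝ] ℝ).smulRight (EuclideanSpace.single 1 1)
  have hE : ∀ z, E z = embed z := fun z => by rw [embed_eq]; simp [E]
  have h1 : HasFDerivAt (fun z => ρ (E z)) ((fderiv ℝ ρ (embed y)).comp E) y := by
    refine HasFDerivAt.comp y ?_ E.hasFDerivAt
    rw [hE]
    exact hρ.hasFDerivAt
  have h3 : HasFDerivAt (fun z => ρ (E z)) (0 : Eucl 2 →L[ℝ] ℝ) y := by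
    refine (hasFDerivAt_const (0 : ℝ) y).congr_of_eventuallyEq ?_
    filter_upwards [h0] with z hz
    rw [hE, hz]
  have h4 := h1.unique h3
  apply h
  ext x
  have hx : x = E (planeProj x) + x 2 • EuclideanSpace.single (2 : Fin 3) (1 : ℝ) := by
    rw [hE, ← lift_eq, lift_planeProj]
  have h5 := DFunLike.congr_fun h4 (planeProj x)
  simp only [ContinuousLinearMap.comp_apply, zero_apply] at h5
  rw [partialD] at h2
  rw [hx, map_add, map_smul, h5, h2]
  simp

/-- Near a shell point the C¹ defining function is strictly monotone in x₃ and vanishes on the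
shell. It must be increasing, so it is negative just below the shell, uniformly for nearby points.
-/
theorem exists_nhds_below (hdom : IsFluidShellDomain O Ω) {y : Eucl 2} (hy : y ∈ Ω) :
    ∃ N ∈ 𝓝 y, ∃ h > 0, ∀ z ∈ N, ∀ t, -h ≤ t → t < 0 → lift z t ∈ O := by
  obtain ⟨U, ρ, hU, hyU, hρ, hd, hOU⟩ :=
    hdom.boundary_fluid (embed y) (hdom.shell_subset ⟨y, hy, rfl⟩)
  have hdiff : ∀ x ∈ U, DifferentiableAt ℝ ρ x := fun x hx =>
    (hρ.differentiableOn (by simp)).differentiableAt (hU.mem_nhds hx)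
  have hcont : ContinuousOn (partialD 2 ρ) U :=
    (hρ.continuousOn_fderiv_of_isOpen hU (by simp)).clm_apply continuousOn_const
  have hz : ∀ z ∈ Ω, embed z ∈ U → ρ (embed z) = 0 := fun z hz hzU =>
    eq_zero_of_mem_frontier hdom.isOpen_fluid hU hρ.continuousOn hOU
      (hdom.shell_subset ⟨z, hz, rfl⟩) hzU
  have hembed : Continuous embed :=
    continuous_lift.comp (continuous_id.prodMk (continuous_const (y := (0 : ℝ))))
  have hev : ∀ᶠ z in 𝓝 y, z ∈ Ω ∧ embed z ∈ U :=
    (hdom.isOpen_shell.eventually_mem hy).and (hembed.continuousAt.eventually (hU.mem_nhds hyU))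
  have hne := partialD_two_ne_zero (hdiff _ hyU) (hev.mono fun z h => hz z h.1 h.2) (hd _ hyU)
  have hder : ∀ z t, lift z t ∈ U → HasDerivAt (fun t => ρ (lift z t)) (partialD 2 ρ (lift z t)) t :=
    fun z t h => (hdiff _ h).hasFDerivAt.comp_hasDerivAt t (hasDerivAt_lift z t)
  have hc0 : ContinuousAt (partialD 2 ρ) (embed y) := hcont.continuousAt (hU.mem_nhds hyU)
  have slab : ∀ {S : Set (Eucl 3)}, S ∈ 𝓝 (embed y) → ∃ N ∈ 𝓝 y, ∃ h > 0, ∀ z ∈ N, ∀ t,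
      -h ≤ t → t ≤ h → lift z t ∈ S := by
    intro S hS
    have h1 : (fun p : Eucl 2 × ℝ => lift p.1 p.2) ⁻¹' S ∈ 𝓝 (y, (0 : ℝ)) :=
      continuous_lift.continuousAt hS
    obtain ⟨N, hN, T, hT, hNT⟩ := mem_nhds_prod_iff.1 h1
    obtain ⟨h, hh, hhT⟩ := Metric.nhds_basis_closedBall.mem_iff.1 hT
    refine ⟨N, hN, h, hh, fun z hzN t ht1 ht2 => hNT (mk_mem_prod hzN (hhT ?_))⟩
    rw [Metric.mem_closedBall, dist_zero_right, Real.norm_eq_abs, abs_le]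
    exact ⟨ht1, ht2⟩
  have mem : ∀ {x}, x ∈ U → ρ x < 0 → x ∈ O := fun {x} hx hlt => by
    have h1 : x ∈ {y ∈ U | ρ y < 0} := ⟨hx, hlt⟩
    rw [← hOU] at h1
    exact h1.1
  rcases lt_or_gt_of_ne hne with hneg | hpos
  -- A decreasing defining function would be negative just above the shell, placing points of `O` at
  -- positive height.
  · exfalso
    obtain ⟨N, hN, h, hh, hS⟩ := slab (inter_mem (hU.mem_nhds hyU)
      (hc0.eventually (gt_mem_nhds hneg)))
    have hyN := mem_of_mem_nhds hN
    have hanti : StrictAntiOn (fun t => ρ (lift y t)) (Icc 0 h) := by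
      refine strictAntiOn_of_deriv_neg (convex_Icc 0 h) (fun t ht =>
        (hder y t (hS y hyN t (by linarith [ht.1]) ht.2).1).continuousAt.continuousWithinAt) ?_
      intro t ht
      rw [interior_Icc] at ht
      have h1 := hS y hyN t (by linarith [ht.1]) ht.2.le
      rw [(hder y t h1.1).deriv]
      exact h1.2
    have h1 := hanti ⟨le_rfl, hh.le⟩ ⟨hh.le, le_rfl⟩ hh
    simp only [lift_zero] at h1
    rw [hz y hy hyU] at h1
    have h2 := height_neg hdom (mem (hS y hyN h (by linarith) le_rfl).1 h1)
    rw [lift_two] at h2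
    linarith
  · obtain ⟨N, hN, h, hh, hS⟩ := slab (inter_mem (hU.mem_nhds hyU)
      (hc0.eventually (lt_mem_nhds hpos)))
    refine ⟨N ∩ Ω, inter_mem hN (hdom.isOpen_shell.mem_nhds hy), h, hh, fun z hzN t ht1 ht2 => ?_⟩
    have hmono : StrictMonoOn (fun t => ρ (lift z t)) (Icc (-h) 0) := by
      refine strictMonoOn_of_deriv_pos (convex_Icc (-h) 0) (fun t ht =>
        (hder z t (hS z hzN.1 t ht.1 (by linarith [ht.2])).1).continuousAt.continuousWithinAt) ?_
      intro t ht
      rw [interior_Icc] at ht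
      have h1 := hS z hzN.1 t ht.1.le (by linarith [ht.2])
      rw [(hder z t h1.1).deriv]
      exact h1.2
    have h1 := hmono ⟨ht1, ht2.le⟩ ⟨by linarith, le_rfl⟩ ht2
    have h3 := (hS z hzN.1 0 (by linarith) hh.le).1
    simp only [lift_zero] at h1 h3
    rw [hz z hzN.2 h3] at h1
    exact mem (hS z hzN.1 t ht1 (by linarith)).1 h1

/-- The fluid fills a layer below every compact part of the shell. -/
theorem exists_layer (hdom : IsFluidShellDomain O Ω) {K : Set (Eucl 2)} (hK : IsCompact K)
    (hKΩ : K ⊆ Ω) : ∃ h > 0, ∀ z ∈ K, ∀ t, -h ≤ t → t < 0 → lift z t ∈ O := by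
  refine hK.induction_on (p := fun K => ∃ h > 0, ∀ z ∈ K, ∀ t, -h ≤ t → t < 0 → lift z t ∈ O)
    ⟨1, one_pos, fun _ h => h.elim⟩ ?_ ?_ ?_
  · rintro s t hst ⟨h, hh, H⟩
    exact ⟨h, hh, fun z hz => H z (hst hz)⟩
  · rintro s t ⟨h, hh, H⟩ ⟨h', hh', H'⟩
    refine ⟨min h h', lt_min hh hh', fun z hz τ h1 h2 => ?_⟩
    rcases hz with hz | hz
    · exact H z hz τ (by linarith [min_le_left h h']) h2
    · exact H' z hz τ (by linarith [min_le_right h h']) h2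
  · intro y hy
    obtain ⟨N, hN, h, hh, H⟩ := exists_nhds_below hdom (hKΩ hy)
    exact ⟨N, mem_nhdsWithin_of_mem_nhds hN, h, hh, H⟩

/-- A wall point over `K` has x₃ ≤ 0. If x₃ < 0 it would lie in the open set `O`; if x₃ = 0 it would
lie on the shell. Thus no upper bound on x₃ is needed in the slab. -/
theorem disjoint_layer_wall (hdom : IsFluidShellDomain O Ω) {K : Set (Eucl 2)} (hKΩ : K ⊆ Ω)
    {h : ℝ} (H : ∀ z ∈ K, ∀ t, -h ≤ t → t < 0 → lift z t ∈ O) :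
    Disjoint {x : Eucl 3 | planeProj x ∈ K ∧ -h ≤ x 2} (wall O Ω) := by
  rw [Set.disjoint_left]
  rintro x ⟨hxK, hxh⟩ hxw
  rcases (hdom.wall_below x hxw).lt_or_eq with hlt | h0
  · have h1 := H _ hxK _ hxh hlt
    rw [lift_planeProj] at h1
    have h2 := hxw.1
    rw [hdom.isOpen_fluid.frontier_eq] at h2
    exact h2.2 h1
  · refine hxw.2 ⟨planeProj x, hKΩ hxK, ?_⟩
    rw [← lift_zero, ← h0, lift_planeProj]

theorem fderiv_component {d n : ℕ} {φ : Eucl d → Eucl n} {x : Eucl d}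
    (hφ : DifferentiableAt ℝ φ x) (v : Eucl d) (i : Fin n) :
    fderiv ℝ φ x v i = fderiv ℝ (fun y => φ y i) x v := by
  have h := ((EuclideanSpace.proj i : Eucl n →L[ℝ] ℝ).hasFDerivAt.comp x hφ.hasFDerivAt).fderiv
  exact (DFunLike.congr_fun h v).symm

/-- The solenoidal fields that vanish outside a closed set that does not meet the wall. -/
theorem mem_smoothFields {φ : Eucl 3 → Eucl 3} (hφ : ContDiff ℝ ∞ φ) {C : Set (Eucl 3)}
    (hC : IsClosed C) (hd : Disjoint C (wall O Ω)) (h0 : ∀ x ∉ C, φ x = 0)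
    (hdiv : ∀ x ∈ O, ∑ i : Fin 3, partialD i (fun y => φ y i) x = 0) :
    φ ∈ smoothFields O Ω := by
  refine ⟨hφ, ⟨Cᶜ, hC.isOpen_compl, fun x hx hxC => Set.disjoint_left.1 hd hxC hx,
    fun x hx => h0 x hx.1⟩, fun x hx => ?_⟩
  rw [← hdiv x hx]
  exact Finset.sum_congr rfl fun i _ => fderiv_component (hφ.differentiable (by simp) x) _ i

/-- A smooth field on the space with given components. -/
def field (f : Fin 3 → Eucl 3 → ℝ) (x : Eucl 3) : Eucl 3 := WithLp.toLp 2 fun i => f i x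

theorem contDiff_field {f : Fin 3 → Eucl 3 → ℝ} (hf : ∀ i, ContDiff ℝ ∞ (f i)) :
    ContDiff ℝ ∞ (field f) := by
  rw [contDiff_euclidean]
  exact hf

theorem contDiff_comp_planeProj {f : Eucl 2 → ℝ} (hf : ContDiff ℝ ∞ f) :
    ContDiff ℝ ∞ fun x => f (planeProj x) := hf.comp planeProj.contDiff

theorem contDiff_comp_two {γ : ℝ → ℝ} (hγ : ContDiff ℝ ∞ γ) :
    ContDiff ℝ ∞ fun x : Eucl 3 => γ (x 2) := hγ.comp (contDiff_coord 2)

theorem partialD_comp_planeProj {f : Eucl 2 → ℝ} (hf : ContDiff ℝ ∞ f) (i : Fin 3) (x : Eucl 3) :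
    partialD i (fun x => f (planeProj x)) x
      = (![partialD 0 f (planeProj x), partialD 1 f (planeProj x), 0] : Fin 3 → ℝ) i := by
  have h : HasFDerivAt (fun x => f (planeProj x)) ((fderiv ℝ f (planeProj x)).comp planeProj) x :=
    (hf.differentiable (by simp) _).hasFDerivAt.comp x planeProj.hasFDerivAt
  rw [partialD, h.fderiv]
  fin_cases i <;> simp [planeProj, partialD]

theorem partialD_comp_two {γ : ℝ → ℝ} (hγ : ContDiff ℝ ∞ γ) (i : Fin 3) (x : Eucl 3) :
    partialD i (fun x => γ (x 2)) x = (![0, 0, deriv γ (x 2)] : Fin 3 → ℝ) i := by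
  have h : HasFDerivAt (fun x : Eucl 3 => γ (x 2))
      (deriv γ (x 2) • (EuclideanSpace.proj 2 : Eucl 3 →L[ℝ] ℝ)) x :=
    (hγ.differentiable (by simp) (x 2)).hasDerivAt.comp_hasFDerivAt x
      (EuclideanSpace.proj 2 : Eucl 3 →L[ℝ] ℝ).hasFDerivAt
  rw [partialD, h.fderiv]
  fin_cases i <;> simp

theorem contDiff_deriv {γ : ℝ → ℝ} (hγ : ContDiff ℝ ∞ γ) : ContDiff ℝ ∞ (deriv γ) :=
  (contDiff_infty_iff_deriv.1 hγ).2

/-- The solenoidal field `(-γ' c₁, -γ' c₂, γ (∂₁c₁ + ∂₂c₂))` in the layer below the shell. -/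
theorem layerField_mem_smoothFields (hdom : IsFluidShellDomain O Ω) (c : Fin 2 → Test Ω) {h : ℝ}
    (H : ∀ i, ∀ z ∈ tsupport (c i).1, ∀ t, -h ≤ t → t < 0 → lift z t ∈ O) {γ : ℝ → ℝ}
    (hγ : ContDiff ℝ ∞ γ) (hγ0 : ∀ t ≤ -h, γ t = 0) :
    field ![fun x => -deriv γ (x 2) * (c 0).1 (planeProj x),
      fun x => -deriv γ (x 2) * (c 1).1 (planeProj x),
      fun x => γ (x 2) * (partialD 0 (c 0).1 (planeProj x) + partialD 1 (c 1).1 (planeProj x))]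
      ∈ smoothFields O Ω := by
  have hγ' := contDiff_deriv hγ
  have hc := fun i => (c i).contDiff
  have hγd : ∀ t < -h, deriv γ t = 0 := fun t ht => by
    have : γ =ᶠ[𝓝 t] fun _ => 0 := by
      filter_upwards [gt_mem_nhds ht] with s hs using hγ0 s hs.le
    rw [this.deriv_eq, deriv_const]
  have s0 := contDiff_comp_two hγ
  have s1 := (contDiff_comp_two hγ').neg
  have s2 := fun i => contDiff_comp_planeProj (hc i)
  have s3 : ContDiff ℝ ∞ fun x => partialD 0 (c 0).1 (planeProj x)
      + partialD 1 (c 1).1 (planeProj x) :=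
    (contDiff_comp_planeProj (contDiff_partialD 0 (hc 0))).add
      (contDiff_comp_planeProj (contDiff_partialD 1 (hc 1)))
  have hK : tsupport (c 0).1 ∪ tsupport (c 1).1 ⊆ Ω := union_subset (c 0).subset (c 1).subset
  refine mem_smoothFields (contDiff_field fun i => ?_)
    (C := {x : Eucl 3 | planeProj x ∈ tsupport (c 0).1 ∪ tsupport (c 1).1 ∧ -h ≤ x 2}) ?_
    (disjoint_layer_wall hdom hK fun z hz => hz.elim (H 0 z) (H 1 z)) ?_ fun x hx => ?_
  · fin_cases i
    · exact s1.mul (s2 0)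
    · exact s1.mul (s2 1)
    · exact s0.mul s3
  · exact (((isClosed_tsupport _).union (isClosed_tsupport _)).preimage planeProj.continuous).inter
      (isClosed_le continuous_const (contDiff_coord (n := 0) 2).continuous)
  · intro x hx
    rw [mem_ofPred_eq, not_and_or, not_le, mem_union, not_or] at hx
    have hz : ∀ i : Fin 2, planeProj x ∉ tsupport (c i).1 →
        (c i).1 (planeProj x) = 0 ∧ partialD i (c i).1 (planeProj x) = 0 := fun i hi =>
      ⟨image_eq_zero_of_notMem_tsupport hi,
        image_eq_zero_of_notMem_tsupport fun h' => hi (tsupport_partialD_subset i _ h')⟩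
    ext i
    rcases hx with hx | hx
    · fin_cases i <;> simp [field, hz 0 hx.1, hz 1 hx.2]
    · fin_cases i <;> simp [field, hγ0 _ hx.le, hγd _ hx]
  · have d1 : ∀ i : Fin 3, ∀ j : Fin 2,
        partialD i (fun x => -deriv γ (x 2) * (c j).1 (planeProj x)) x
          = partialD i (fun x => -deriv γ (x 2)) x * (c j).1 (planeProj x)
            + -deriv γ (x 2) * partialD i (fun x => (c j).1 (planeProj x)) x := fun i j =>
      partialD_mul i (s1.differentiable (by simp) x) ((s2 j).differentiable (by simp) x)
    have d2 := partialD_mul 2 (s0.differentiable (by simp) x) (s3.differentiable (by simp) x)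
    have d3 : ∀ i : Fin 3, partialD i (fun x => -deriv γ (x 2)) x
        = (![0, 0, deriv (fun t => -deriv γ t) (x 2)] : Fin 3 → ℝ) i :=
      fun i => partialD_comp_two hγ'.neg i x
    have d4 := partialD_comp_planeProj (((contDiff_partialD 0 (hc 0))).add
      ((contDiff_partialD 1 (hc 1)))) 2 x
    rw [Fin.sum_univ_three]
    simp only [field, Matrix.cons_val_zero, Matrix.cons_val_one, Matrix.cons_val]
    rw [d1, d1, d2, d3, d3, partialD_comp_planeProj (hc 0), partialD_comp_planeProj (hc 1),
      partialD_comp_two hγ, d4]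
    simp only [Matrix.cons_val_zero, Matrix.cons_val_one, Matrix.cons_val]
    ring

end BelowShell

end

end FluidShell

namespace FluidShell

noncomputable section

/-! ### Functionals that vanish on derivatives -/

/-! ### Smoothness of parameter integrals and compactly supported primitives -/

section Primitives

open Filter Topology

theorem contDiff_congr {E : Type*} [NormedAddCommGroup E] [NormedSpace ℝ E] {f g : E → ℝ}
    (hf : ContDiff ℝ ∞ f) (h : ∀ x, g x = f x) : ContDiff ℝ ∞ g := by
  rwa [funext h]

/-- The integral is the value at 0 of the convolution of the indicator of (0, 1] with t ↦ χ(t)F(x,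
−t). The bump χ equals 1 on [−1, 1], so the values are unchanged, and it provides the compact
support that the theorem on convolutions with a parameter requires. -/
theorem contDiff_parametric {E : Type*} [NormedAddCommGroup E] [NormedSpace ℝ E] {F : E → ℝ → ℝ}
    (hF : ContDiff ℝ ∞ fun p : E × ℝ => F p.1 p.2) :
    ContDiff ℝ ∞ fun x => ∫ t in (0 : ℝ)..1, F x t := by
  let χ : ContDiffBump (0 : ℝ) := ⟨1, 2, one_pos, one_lt_two⟩
  let g : E → ℝ → ℝ := fun x t => χ t * F x (-t)
  have hg : ContDiff ℝ ∞ ↿g := by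
    have h1 : ContDiff ℝ ∞ fun p : E × ℝ => χ p.2 := χ.contDiff.comp contDiff_snd
    have h2 : ContDiff ℝ ∞ fun p : E × ℝ => F p.1 (-p.2) :=
      hF.comp (contDiff_fst.prodMk contDiff_snd.neg)
    exact h1.mul h2
  have h1 := contDiffOn_convolution_right_with_param (𝕜 := ℝ) (n := ⊤) (μ := volume)
    (f := (Ioc (0 : ℝ) 1).indicator fun _ => (1 : ℝ)) (ContinuousLinearMap.mul ℝ ℝ) (g := g)
    (k := Metric.closedBall (0 : ℝ) 2) isOpen_univ (isCompact_closedBall _ _)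
    (fun p x _ hx => by
      have : χ x = 0 := χ.zero_of_le_dist (not_le.1 hx).le
      simp [g, this])
    ((integrable_indicator_iff measurableSet_Ioc).2
      (integrableOn_const (by simp))).locallyIntegrable hg.contDiffOn
  rw [univ_prod_univ, contDiffOn_univ] at h1
  have h2 : ContDiff ℝ ∞ fun x : E => (x, (0 : ℝ)) := contDiff_id.prodMk contDiff_const
  refine contDiff_congr (h1.comp h2) fun x => ?_
  simp only [Function.comp_apply, convolution, ContinuousLinearMap.mul_apply', zero_sub]
  rw [intervalIntegral.integral_of_le zero_le_one, ← integral_indicator measurableSet_Ioc]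
  refine integral_congr_ae (Eventually.of_forall fun t => ?_)
  by_cases ht : t ∈ Ioc (0 : ℝ) 1
  · have h3 : χ (-t) = 1 := χ.one_of_mem_closedBall (by
      rw [Metric.mem_closedBall, dist_zero_right, norm_neg, Real.norm_eq_abs, abs_of_pos ht.1]
      exact ht.2)
    simp [g, ht, h3]
  · simp [ht]

/-- The substitution t = a + (u(x) − a)s moves the variable endpoint into the integrand. -/
theorem contDiff_integral_upper {E : Type*} [NormedAddCommGroup E] [NormedSpace ℝ E] {F : E → ℝ → ℝ}
    (hF : ContDiff ℝ ∞ fun p : E × ℝ => F p.1 p.2) {u : E → ℝ} (hu : ContDiff ℝ ∞ u) (a : ℝ) :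
    ContDiff ℝ ∞ fun x => ∫ t in a..u x, F x t := by
  have h2 : ContDiff ℝ ∞ fun p : E × ℝ => u p.1 := hu.comp contDiff_fst
  have h3 : ContDiff ℝ ∞ fun p : E × ℝ => (p.1, a + (u p.1 - a) * p.2) :=
    contDiff_fst.prodMk (contDiff_const.add ((h2.sub contDiff_const).mul contDiff_snd))
  have h1 : ContDiff ℝ ∞ fun p : E × ℝ => F p.1 (a + (u p.1 - a) * p.2) := hF.comp h3
  refine contDiff_congr ((hu.sub (contDiff_const (c := a))).mul
    (contDiff_parametric (F := fun x t => F x (a + (u x - a) * t)) h1)) fun x => ?_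
  have h2 := intervalIntegral.smul_integral_comp_add_mul (a := 0) (b := 1) (F x) (u x - a) a
  rw [mul_zero, mul_one, add_zero, add_sub_cancel] at h2
  exact h2.symm

variable {d : ℕ}

/-- Replaces the coordinate `x_i` by `s`. -/
def setCoord (i : Fin d) (x : Eucl d) (s : ℝ) : Eucl d :=
  x + (s - x i) • EuclideanSpace.single i (1 : ℝ)

theorem setCoord_same (i : Fin d) (x : Eucl d) (s : ℝ) : setCoord i x s i = s := by
  simp [setCoord]

theorem setCoord_ne {i j : Fin d} (h : j ≠ i) (x : Eucl d) (s : ℝ) : setCoord i x s j = x j := by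
  simp [setCoord, h]

theorem setCoord_self (i : Fin d) (x : Eucl d) : setCoord i x (x i) = x := by
  simp [setCoord]

theorem setCoord_setCoord (i : Fin d) (x : Eucl d) (s t : ℝ) :
    setCoord i (setCoord i x s) t = setCoord i x t := by
  ext j
  by_cases h : j = i
  · subst h
    simp only [setCoord_same]
  · simp only [setCoord_ne h]

theorem setCoord_add (i : Fin d) (x : Eucl d) (s t : ℝ) :
    setCoord i (x + t • EuclideanSpace.single i (1 : ℝ)) s = setCoord i x s := by
  have h : x + t • EuclideanSpace.single i (1 : ℝ) = setCoord i x (x i + t) := by simp [setCoord]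
  rw [h, setCoord_setCoord]

theorem contDiff_setCoord {n : WithTop ℕ∞} (i : Fin d) :
    ContDiff ℝ n fun p : Eucl d × ℝ => setCoord i p.1 p.2 :=
  contDiff_fst.add ((contDiff_snd.sub ((contDiff_coord i).comp contDiff_fst)).smul contDiff_const)

theorem continuous_setCoord (i : Fin d) (x : Eucl d) : Continuous (setCoord i x) :=
  (contDiff_setCoord (n := 0) i).continuous.comp (continuous_const.prodMk continuous_id)

/-- A closed cube. -/
def box (a : Eucl d) (r : ℝ) : Set (Eucl d) := {x | ∀ j, |x j - a j| ≤ r}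

theorem isCompact_box (a : Eucl d) (r : ℝ) : IsCompact (box a r) := by
  have h : box a r = WithLp.toLp 2 '' (Set.pi univ fun j => Icc (a j - r) (a j + r)) := by
    ext x
    constructor
    · intro hx
      refine ⟨x.ofLp, fun j _ => ?_, rfl⟩
      have := abs_le.1 (hx j)
      exact ⟨by linarith, by linarith⟩
    · rintro ⟨y, hy, rfl⟩ j
      have := hy j (mem_univ j)
      exact abs_le.2 ⟨by simp; linarith [this.1], by simp; linarith [this.2]⟩
  rw [h]
  exact (isCompact_univ_pi fun j => isCompact_Icc).image (PiLp.continuous_toLp 2 _)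

theorem box_mem_nhds (a : Eucl d) {r : ℝ} (hr : 0 < r) : box a r ∈ 𝓝 a := by
  refine mem_of_superset (Metric.ball_mem_nhds a hr) fun x hx j => ?_
  have h := (PiLp.norm_apply_le (x - a) j).trans (mem_ball_iff_norm.1 hx).le
  simpa using h

theorem exists_box_subset {D : Set (Eucl d)} {a : Eucl d} (hD : D ∈ 𝓝 a) :
    ∃ r > 0, box a r ⊆ D := by
  have hc : Continuous fun x : Fin d → ℝ => (WithLp.toLp 2 x : Eucl d) :=
    PiLp.continuous_toLp 2 _
  have h : (fun x : Fin d → ℝ => (WithLp.toLp 2 x : Eucl d)) ⁻¹' D ∈ 𝓝 a.ofLp :=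
    hc.continuousAt hD
  obtain ⟨r, hr, hrD⟩ := Metric.nhds_basis_closedBall.mem_iff.1 h
  refine ⟨r, hr, fun x hx => ?_⟩
  have : x.ofLp ∈ Metric.closedBall a.ofLp r := by
    rw [Metric.mem_closedBall, dist_pi_le_iff hr.le]
    exact fun j => hx j
  exact hrD this

theorem notMem_box {a x : Eucl d} {r : ℝ} {j : Fin d} (h : r < |x j - a j|) : x ∉ box a r :=
  fun hx => absurd (hx j) (not_le.2 h)

theorem lt_or_lt_of_notMem_box {a x : Eucl 2} {r : ℝ} (hx : x ∉ box a r) :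
    r < |x 0 - a 0| ∨ r < |x 1 - a 1| := by
  by_contra! h
  exact hx (Fin.forall_fin_two.2 h)

/-- A smooth function that vanishes outside a compact subset of `D`. -/
def Test.ofCompact {D K : Set (Eucl d)} (hK : IsCompact K) (hKD : K ⊆ D) (f : Eucl d → ℝ)
    (hf : ContDiff ℝ ∞ f) (h0 : ∀ x ∉ K, f x = 0) : Test D :=
  ⟨f, hf, HasCompactSupport.intro hK h0, (closure_minimal (fun x hx => by
    by_contra hn
    exact hx (h0 x hn)) hK.isClosed).trans hKD⟩

theorem continuous_line {f : Eucl d → ℝ} (hf : Continuous f) (i : Fin d) (x : Eucl d) :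
    Continuous fun s => f (setCoord i x s) := hf.comp (continuous_setCoord i x)

theorem line_eq_zero {f : Eucl d → ℝ} {a : Eucl d} {r : ℝ} (h0 : ∀ x ∉ box a r, f x = 0)
    (i : Fin d) (x : Eucl d) {s : ℝ} (hs : r < |s - a i|) : f (setCoord i x s) = 0 :=
  h0 _ (notMem_box (j := i) (by rwa [setCoord_same]))

theorem line_integrable {f : Eucl d → ℝ} (hf : Continuous f) {a : Eucl d} {r : ℝ}
    (h0 : ∀ x ∉ box a r, f x = 0) (i : Fin d) (x : Eucl d) :
    Integrable fun s => f (setCoord i x s) := by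
  refine (continuous_line hf i x).integrable_of_hasCompactSupport
    (HasCompactSupport.intro (isCompact_closedBall (a i) r) fun s hs => ?_)
  exact line_eq_zero h0 i x (by simpa [Real.dist_eq] using hs)

theorem intervalIntegral_line {f : Eucl d → ℝ} {a : Eucl d} {r : ℝ}
    (h0 : ∀ x ∉ box a r, f x = 0) (i : Fin d) (x : Eucl d) {α β : ℝ} (hα : α < a i - r)
    (hβ : a i + r ≤ β) : ∫ s in α..β, f (setCoord i x s) = ∫ s, f (setCoord i x s) := by
  refine intervalIntegral.integral_eq_integral_of_support_subset fun s hs => ?_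
  have h1 : |s - a i| ≤ r := by
    by_contra! h
    exact hs (line_eq_zero h0 i x h)
  have h2 := abs_le.1 h1
  exact ⟨by linarith, by linarith⟩

/-- A function whose integrals along the lines in the direction `i` vanish is a derivative. -/
theorem exists_primitive {D : Set (Eucl d)} {a : Eucl d} {r : ℝ} (hB : box a r ⊆ D) (i : Fin d)
    {f : Eucl d → ℝ} (hf : ContDiff ℝ ∞ f) (h0 : ∀ x ∉ box a r, f x = 0)
    (hint : ∀ x, ∫ s, f (setCoord i x s) = 0) : ∃ c : Test D, (Test.deriv i c).1 = f := by
  -- Any lower endpoint strictly below the box serves; it is independent of x, which keeps g smooth.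
  let α : ℝ := a i - r - 1
  let g : Eucl d → ℝ := fun x => ∫ s in α..x i, f (setCoord i x s)
  have hg : ContDiff ℝ ∞ g :=
    contDiff_integral_upper (F := fun x s => f (setCoord i x s)) (hf.comp (contDiff_setCoord i))
      (contDiff_coord i) α
  have hg0 : ∀ x ∉ box a r, g x = 0 := by
    intro x hx
    -- Outside the box, either another coordinate is outside and the whole line misses the support,
    -- or x_i is: above the box the integral is the full line integral, zero by hypothesis, and
    -- below it the integrand vanishes.
    by_cases hj : ∃ j, j ≠ i ∧ r < |x j - a j|
    · obtain ⟨j, hji, hj⟩ := hj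
      have : ∀ s, f (setCoord i x s) = 0 := fun s =>
        h0 _ (notMem_box (j := j) (by rwa [setCoord_ne hji]))
      simp [g, this]
    · push Not at hj
      have hi : r < |x i - a i| := by
        by_contra! h
        exact hx fun j => if hji : j = i then hji ▸ h else hj j hji
      rcases lt_abs.1 hi with h | h
      · simp only [g]
        rw [intervalIntegral_line h0 i x (by simp [α]) (by linarith), hint]
      · refine intervalIntegral.integral_zero_ae (Eventually.of_forall fun s hs => ?_)
        refine line_eq_zero h0 i x (lt_abs.2 (Or.inr ?_))
        have := hs.2
        have h3 : α < a i - r := by simp [α]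
        have : s ≤ max α (x i) := hs.2
        have h4 : max α (x i) < a i - r := max_lt h3 (by linarith)
        linarith
  refine ⟨Test.ofCompact (isCompact_box a r) hB g hg hg0, ?_⟩
  ext x
  have h1 : HasDerivAt (fun t : ℝ => g (x + t • EuclideanSpace.single i (1 : ℝ)))
      (partialD i g x) 0 := by
    have h2 : HasDerivAt (fun t : ℝ => x + t • EuclideanSpace.single i (1 : ℝ))
        (EuclideanSpace.single i (1 : ℝ)) 0 := by
      simpa using ((hasDerivAt_id (0 : ℝ)).smul_const (EuclideanSpace.single i (1 : ℝ))).const_add x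
    have h3 : HasFDerivAt g (fderiv ℝ g x)
        (x + (0 : ℝ) • EuclideanSpace.single i (1 : ℝ)) := by
      rw [zero_smul, add_zero]
      exact (hg.differentiable (by simp) x).hasFDerivAt
    exact h3.comp_hasDerivAt 0 h2
  have h2 : HasDerivAt (fun t : ℝ => g (x + t • EuclideanSpace.single i (1 : ℝ)))
      (f x) 0 := by
    have h3 : (fun t : ℝ => g (x + t • EuclideanSpace.single i (1 : ℝ)))
        = fun t => ∫ s in α..x i + t, f (setCoord i x s) := by
      ext t
      simp [g, setCoord_add]
    rw [h3]
    have h4 := ((continuous_line hf.continuous i x).integral_hasStrictDerivAt α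
      (x i + 0)).hasDerivAt
    have h5 := h4.comp_const_add (x i) 0
    rwa [add_zero, setCoord_self] at h5
  exact h1.unique h2

end Primitives

/-! ### Distributions with vanishing gradient -/

section Functionals

open Filter Topology

variable {Ω : Set (Eucl 2)} {T : Test Ω →ₗ[ℝ] ℝ}

theorem setCoord_setCoord_eq_pt (x : Eucl 2) (s t : ℝ) :
    setCoord 0 (setCoord 1 x s) t = pt t s := by
  ext j
  fin_cases j <;> simp [setCoord, pt]

theorem integral_lines {f : Eucl 2 → ℝ} (hf : Integrable f) (x : Eucl 2) :
    ∫ s, ∫ t, f (setCoord 0 (setCoord 1 x s) t) = ∫ y, f y := by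
  simp only [setCoord_setCoord_eq_pt]
  rw [← volume_preserving_pt.integral_comp measurableEmbedding_pt, Measure.volume_eq_prod,
    integral_prod_symm]
  exact (volume_preserving_pt.integrable_comp_emb measurableEmbedding_pt).2 hf

/-- A functional that vanishes on derivatives is locally a multiple of the integral. -/
theorem exists_eq_mul_integral_of_box (hT : ∀ i c, T (Test.deriv i c) = 0) {a : Eucl 2} {r : ℝ}
    (hr : 0 < r) (hB : box a r ⊆ Ω) :
    ∃ κ : ℝ, ∀ δ : Test Ω, (∀ x ∉ box a r, δ.1 x = 0) → T δ = κ * ∫ x, δ.1 x := by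
  let η : Fin 2 → ℝ → ℝ := fun i =>
    (⟨r / 2, r, by positivity, by linarith⟩ : ContDiffBump (a i)).normed volume
  have hη : ∀ i, ContDiff ℝ ∞ (η i) := fun i => ContDiffBump.contDiff_normed _
  have hη0 : ∀ i s, r < |s - a i| → η i s = 0 := by
    intro i s hs
    by_contra hn
    have h1 : s ∈ Function.support (η i) := hn
    rw [ContDiffBump.support_normed_eq, Metric.mem_ball, Real.dist_eq] at h1
    exact absurd hs (not_lt.2 h1.le)
  have hη1 : ∀ i, ∫ s, η i s = 1 := fun i => ContDiffBump.integral_normed _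
  have hηi : ∀ i, Integrable (η i) := fun i => ContDiffBump.integrable_normed _
  have hηx : ∀ i, ContDiff ℝ ∞ fun x : Eucl 2 => η i (x i) := fun i => (hη i).comp (contDiff_coord i)
  let H : Test Ω := Test.ofCompact (isCompact_box a r) hB (fun x => η 0 (x 0) * η 1 (x 1))
    ((hηx 0).mul (hηx 1)) fun x hx => by
      rcases lt_or_lt_of_notMem_box hx with hj | hj
      · rw [hη0 0 _ hj, zero_mul]
      · rw [hη0 1 _ hj, mul_zero]
  refine ⟨T H, fun δ hδ => ?_⟩
  have hδc := δ.contDiff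
  let m : ℝ := ∫ x, δ.1 x
  -- The marginal of δ, which depends on the second coordinate only and whose integral over that
  -- coordinate is m.
  let k : Eucl 2 → ℝ := fun x => ∫ s, δ.1 (setCoord 0 x s)
  have hk : ContDiff ℝ ∞ k := by
    refine contDiff_congr (contDiff_integral_upper (F := fun x s => δ.1 (setCoord 0 x s))
      (hδc.comp (contDiff_setCoord 0)) (contDiff_const (c := a 0 + r)) (a 0 - r - 1)) fun x => ?_
    exact (intervalIntegral_line hδ 0 x (by linarith) le_rfl).symm
  have hk0 : ∀ x : Eucl 2, r < |x 1 - a 1| → k x = 0 := by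
    intro x hx
    have : ∀ s, δ.1 (setCoord 0 x s) = 0 := fun s =>
      hδ _ (notMem_box (j := 1) (by rwa [setCoord_ne (by decide)]))
    simp [k, this]
  have hkc : ∀ x s, k (setCoord 0 x s) = k x := fun x s => by simp [k, setCoord_setCoord]
  have hk1 : ∀ x, ∫ s, k (setCoord 1 x s) = m := fun x =>
    integral_lines ((δ.contDiff.continuous).integrable_of_hasCompactSupport δ.compact) x
  have hki : ∀ x, Integrable fun s => k (setCoord 1 x s) := by
    intro x
    refine (continuous_line hk.continuous 1 x).integrable_of_hasCompactSupport
      (HasCompactSupport.intro (isCompact_closedBall (a 1) r) fun s hs => hk0 _ ?_)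
    rw [setCoord_same]
    simpa [Real.dist_eq] using hs
  -- δ is the telescoping sum of δ − η₀k, of η₀(k − mη₁) and of mη₀η₁. The first two have vanishing
  -- integrals along the lines of one coordinate direction and are therefore derivatives of test
  -- functions.
  obtain ⟨c1, hc1⟩ := exists_primitive hB 0 (f := fun x => δ.1 x - η 0 (x 0) * k x)
    (hδc.sub ((hηx 0).mul hk)) (fun x hx => by
      rw [hδ x hx]
      rcases lt_or_lt_of_notMem_box hx with hj | hj
      · rw [hη0 0 _ hj, zero_mul, sub_zero]
      · rw [hk0 _ hj, mul_zero, sub_zero]) (fun x => by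
      simp only [hkc, setCoord_same]
      rw [integral_sub (line_integrable hδc.continuous hδ 0 x) ((hηi 0).mul_const _),
        integral_mul_const, hη1, one_mul]
      exact sub_self _)
  obtain ⟨c2, hc2⟩ := exists_primitive hB 1 (f := fun x => η 0 (x 0) * (k x - m * η 1 (x 1)))
    ((hηx 0).mul (hk.sub (contDiff_const.mul (hηx 1)))) (fun x hx => by
      rcases lt_or_lt_of_notMem_box hx with hj | hj
      · rw [hη0 0 _ hj, zero_mul]
      · rw [hk0 _ hj, hη0 1 _ hj, mul_zero, sub_zero, mul_zero]) (fun x => by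
      simp only [setCoord_same, setCoord_ne (show (0 : Fin 2) ≠ 1 by decide)]
      rw [integral_const_mul, integral_sub (hki x) ((hηi 1).const_mul _), hk1, integral_const_mul,
        hη1, mul_one, sub_self, mul_zero])
  have e : δ = Test.deriv 0 c1 + Test.deriv 1 c2 + m • H := by
    refine Subtype.ext (funext fun x => ?_)
    have e1 := congrFun hc1 x
    have e2 := congrFun hc2 x
    change δ.1 x = (Test.deriv 0 c1).1 x + (Test.deriv 1 c2).1 x + m * (η 0 (x 0) * η 1 (x 1))
    rw [e1, e2]
    ring
  conv_lhs => rw [e]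
  rw [map_add, map_add, hT, hT, map_smul, smul_eq_mul]
  ring

/-- A functional that is locally a fixed multiple of the integral is so globally. -/
theorem eq_mul_integral_of_local {κ : ℝ} (h : ∀ a ∈ Ω, ∃ U : Set (Eucl 2), IsOpen U ∧ a ∈ U ∧
    ∀ δ : Test Ω, tsupport δ.1 ⊆ U → T δ = κ * ∫ x, δ.1 x) (δ : Test Ω) :
    T δ = κ * ∫ x, δ.1 x := by
  have key : ∃ U : Set (Eucl 2), IsOpen U ∧ tsupport δ.1 ⊆ U ∧
      ∀ δ : Test Ω, tsupport δ.1 ⊆ U → T δ = κ * ∫ x, δ.1 x := by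
    refine δ.compact.isCompact.induction_on (p := fun s => ∃ U : Set (Eucl 2), IsOpen U ∧ s ⊆ U ∧
      ∀ δ : Test Ω, tsupport δ.1 ⊆ U → T δ = κ * ∫ x, δ.1 x) ?_ ?_ ?_ ?_
    · refine ⟨∅, isOpen_empty, subset_rfl, fun δ hδ => ?_⟩
      have h0 : δ = 0 := Subtype.ext (tsupport_eq_empty_iff.1 (subset_empty_iff.1 hδ))
      rw [h0, map_zero]
      simp
    · rintro s t hst ⟨U, hU, htU, H⟩
      exact ⟨U, hU, hst.trans htU, H⟩
    · rintro s t ⟨U, hU, hsU, H⟩ ⟨U', hU', htU', H'⟩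
      refine ⟨U ∪ U', hU.union hU', union_subset_union hsU htU', fun δ hδ => ?_⟩
      have hcl : IsClosed (tsupport δ.1 \ U') := (isClosed_tsupport _).sdiff hU'
      have hsub : tsupport δ.1 \ U' ⊆ U := fun x hx => (hδ hx.1).resolve_right hx.2
      -- The function f is 0 near the part of the support outside U' and 1 near the complement of U.
      -- Hence fδ is supported in U' and δ − fδ in U.
      obtain ⟨f, hf1, hf0, -⟩ := exists_contMDiffMap_zero_one_nhds_of_isClosed (n := ⊤)
        (modelWithCornersSelf ℝ (Eucl 2)) hcl hU.isClosed_compl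
        (disjoint_compl_right_iff_subset.2 hsub)
      have hfc : ContDiff ℝ ∞ f := f.contMDiff.contDiff
      let δ' : Test Ω := Test.mul f hfc δ
      have e1 : T (δ - δ') = κ * ∫ x, (δ - δ').1 x := by
        refine H _ fun x hx => ?_
        by_contra hxU
        have h1 : ∀ᶠ y in 𝓝 x, f y = 1 := hf0.filter_mono (nhds_le_nhdsSet hxU)
        refine (notMem_tsupport_iff_eventuallyEq.2 ?_) hx
        filter_upwards [h1] with y hy
        change δ.1 y - f y * δ.1 y = 0
        rw [hy, one_mul, sub_self]
      have e2 : T δ' = κ * ∫ x, δ'.1 x := by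
        refine H' _ fun x hx => ?_
        by_contra hxU
        have h2 : x ∈ tsupport δ.1 := (tsupport_mul_subset_right (f := f)) hx
        have h1 : ∀ᶠ y in 𝓝 x, f y = 0 := hf1.filter_mono (nhds_le_nhdsSet (show x ∈ tsupport δ.1 \ U' from ⟨h2, hxU⟩))
        refine (notMem_tsupport_iff_eventuallyEq.2 ?_) hx
        filter_upwards [h1] with y hy
        change f y * δ.1 y = 0
        rw [hy, zero_mul]
      have i1 : ∀ δ : Test Ω, Integrable δ.1 := fun δ =>
        δ.contDiff.continuous.integrable_of_hasCompactSupport δ.compact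
      have e3 : ∫ x, δ.1 x = (∫ x, (δ - δ').1 x) + ∫ x, δ'.1 x := by
        rw [← integral_add (i1 _) (i1 _)]
        refine integral_congr_ae (Eventually.of_forall fun x => ?_)
        change δ.1 x = (δ.1 x - δ'.1 x) + δ'.1 x
        ring
      have e4 : T δ = T (δ - δ') + T δ' := by rw [← map_add, sub_add_cancel]
      rw [e4, e1, e2, e3]
      ring
    · intro a ha
      obtain ⟨U, hU, haU, H⟩ := h a (δ.subset ha)
      exact ⟨U, mem_nhdsWithin_of_mem_nhds (hU.mem_nhds haU), U, hU, subset_rfl, H⟩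
  obtain ⟨U, -, h1, h2⟩ := key
  exact h2 δ h1

end Functionals

end

end FluidShell

namespace FluidShell

noncomputable section

/-! ### Transport of mass in the fluid -/

section Transport

open Filter Topology

theorem sum_partialD_mul (f : Eucl 3 → ℝ) (x v : Eucl 3) :
    ∑ i, partialD i f x * v i = fderiv ℝ f x v := by
  have hv : v = ∑ i, v i • EuclideanSpace.single i (1 : ℝ) := by
    ext j
    fin_cases j <;> simp [Fin.sum_univ_three]
  conv_rhs => rw [hv]
  rw [map_sum]
  exact Finset.sum_congr rfl fun i _ => by rw [map_smul, smul_eq_mul, mul_comm, partialD]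

/-- Small amounts of mass can be moved from `p` to `q` by a smooth flux with compact support
in `O`. -/
def Transportable (O : Set (Eucl 3)) (p q : Eucl 3) : Prop :=
  ∃ ε > 0, ∀ P : Eucl 3 → ℝ, ContDiff ℝ ∞ P → (∀ x, ε ≤ ‖x‖ → P x = 0) →
    ∃ F : Eucl 3 → Eucl 3, ContDiff ℝ ∞ F ∧ (∃ K ⊆ O, IsCompact K ∧ ∀ x ∉ K, F x = 0) ∧
      ∀ x, ∑ i, partialD i (fun y => F y i) x = P (x - p) - P (x - q)

variable {O : Set (Eucl 3)} {p q r : Eucl 3}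

theorem Transportable.symm (h : Transportable O p q) : Transportable O q p := by
  obtain ⟨ε, hε, H⟩ := h
  refine ⟨ε, hε, fun P hP hP0 => ?_⟩
  obtain ⟨F, hF, ⟨K, hKO, hK, hFK⟩, hdiv⟩ := H P hP hP0
  refine ⟨fun x => -F x, hF.neg, ⟨K, hKO, hK, fun x hx => neg_eq_zero.2 (hFK x hx)⟩, fun x => ?_⟩
  have h1 : ∀ i : Fin 3, partialD i (fun y => (-F y) i) x = - partialD i (fun y => F y i) x := by
    intro i
    simp only [PiLp.neg_apply, partialD]
    rw [fderiv_fun_neg]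
    rfl
  simp only [h1, Finset.sum_neg_distrib, hdiv, neg_sub]

theorem Transportable.trans (h : Transportable O p q) (h' : Transportable O q r) :
    Transportable O p r := by
  obtain ⟨ε, hε, H⟩ := h
  obtain ⟨ε', hε', H'⟩ := h'
  refine ⟨min ε ε', lt_min hε hε', fun P hP hP0 => ?_⟩
  have c1 : ∀ x, ε ≤ ‖x‖ → P x = 0 := fun x hx => hP0 x ((min_le_left _ _).trans hx)
  have c2 : ∀ x, ε' ≤ ‖x‖ → P x = 0 := fun x hx => hP0 x ((min_le_right _ _).trans hx)
  obtain ⟨F, hF, ⟨K, hKO, hK, hFK⟩, hdiv⟩ := H P hP c1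
  obtain ⟨F', hF', ⟨K', hKO', hK', hFK'⟩, hdiv'⟩ := H' P hP c2
  refine ⟨fun x => F x + F' x, hF.add hF', ⟨K ∪ K', union_subset hKO hKO', hK.union hK',
    fun x hx => ?_⟩, fun x => ?_⟩
  · rw [mem_union, not_or] at hx
    change F x + F' x = 0
    rw [hFK x hx.1, hFK' x hx.2, add_zero]
  · have h1 : ∀ i : Fin 3, partialD i (fun y => (F y + F' y) i) x
        = partialD i (fun y => F y i) x + partialD i (fun y => F' y i) x := by
      intro i
      simp only [PiLp.add_apply, partialD]
      rw [fderiv_fun_add ((contDiff_component hF i).differentiable (by simp) x)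
        ((contDiff_component hF' i).differentiable (by simp) x)]
      rfl
    simp only [h1, Finset.sum_add_distrib, hdiv, hdiv']
    ring

/-- Transport along a segment. -/
theorem transportable_of_norm_lt {ρ : ℝ} (hρ : 0 < ρ) (hO : Metric.closedBall p ρ ⊆ O)
    (hq : ‖q - p‖ < ρ / 2) : Transportable O p q := by
  refine ⟨ρ / 2, by positivity, fun P hP hP0 => ?_⟩
  let v := q - p
  -- The mass P is smeared along the segment from p to q; the flux Gv then has divergence ∂_v G =
  -- P(· − p) − P(· − q). Its support lies within ρ/2 + ‖v‖ < ρ of p.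
  let G : Eucl 3 → ℝ := fun x => ∫ t in (0 : ℝ)..1, P (x - p - t • v)
  have hG : ContDiff ℝ ∞ G := by
    refine contDiff_parametric (F := fun x t => P (x - p - t • v)) (hP.comp ?_)
    exact (contDiff_fst.sub contDiff_const).sub (contDiff_snd.smul contDiff_const)
  have hGv : ∀ x, fderiv ℝ G x v = P (x - p) - P (x - q) := by
    intro x
    have hg : Continuous fun t : ℝ => P (x - p - t • v) :=
      hP.continuous.comp (continuous_const.sub (continuous_id.smul continuous_const))
    have h1 : HasDerivAt (fun s : ℝ => G (x + s • v)) (fderiv ℝ G x v) 0 := by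
      have h2 : HasDerivAt (fun s : ℝ => x + s • v) v 0 := by
        simpa using ((hasDerivAt_id (0 : ℝ)).smul_const v).const_add x
      have h3 : HasFDerivAt G (fderiv ℝ G x) (x + (0 : ℝ) • v) := by
        rw [zero_smul, add_zero]
        exact (hG.differentiable (by simp) x).hasFDerivAt
      exact h3.comp_hasDerivAt 0 h2
    -- Moving x along v only shifts the integration interval, so the derivative comes from the two
    -- endpoints.
    have h4 : (fun s : ℝ => G (x + s • v)) = fun s =>
        (∫ t in (0 : ℝ)..(1 - s), P (x - p - t • v)) - ∫ t in (0 : ℝ)..(0 - s),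
          P (x - p - t • v) := by
      ext s
      rw [intervalIntegral.integral_interval_sub_left (hg.intervalIntegrable _ _)
        (hg.intervalIntegrable _ _), ← intervalIntegral.integral_comp_sub_right]
      refine intervalIntegral.integral_congr fun t _ => ?_
      congr 1
      module
    have h5 : ∀ b : ℝ, HasDerivAt (fun s : ℝ => ∫ t in (0 : ℝ)..(b - s), P (x - p - t • v))
        (-P (x - p - b • v)) 0 := by
      intro b
      have h6 := (hg.integral_hasStrictDerivAt 0 (b - 0)).hasDerivAt
      have h7 := h6.scomp (0 : ℝ) ((hasDerivAt_id (0 : ℝ)).const_sub b)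
      exact h7.congr_deriv (by simp)
    rw [h4] at h1
    have h8 := h1.unique ((h5 1).sub (h5 0))
    rw [h8, one_smul, zero_smul, sub_zero]
    have : x - p - v = x - q := by simp [v]
    rw [this]
    ring
  refine ⟨field fun i x => G x * v i, contDiff_field fun i => hG.mul contDiff_const,
    ⟨Metric.closedBall p ρ, hO, isCompact_closedBall p ρ, fun x hx => ?_⟩, fun x => ?_⟩
  · have h0 : G x = 0 := by
      refine intervalIntegral.integral_zero_ae (Eventually.of_forall fun t ht => hP0 _ ?_)
      rw [uIoc_of_le zero_le_one] at ht
      rw [Metric.mem_closedBall, not_le, dist_eq_norm] at hx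
      have h1 := norm_sub_norm_le (x - p) (t • v)
      have h2 : ‖t • v‖ ≤ ‖v‖ := by
        rw [norm_smul, Real.norm_eq_abs, abs_of_pos ht.1]
        exact mul_le_of_le_one_left (norm_nonneg v) ht.2
      have h3 : ‖v‖ < ρ / 2 := hq
      linarith
    ext i
    simp [field, h0]
  · have h1 : ∀ i : Fin 3, partialD i (fun y => G y * v i) x = partialD i G x * v i := by
      intro i
      rw [partialD_mul i (hG.differentiable (by simp) x) (differentiableAt_const _)]
      simp [partialD]
    rw [← hGv x, ← sum_partialD_mul]
    exact Finset.sum_congr rfl fun i _ => h1 i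

/-- Transportability is symmetric and transitive, and each point is transportable to all nearby
ones. On a connected set such a relation holds for all pairs. -/
theorem transportable_of_isConnected (hO : IsOpen O) (hc : IsPreconnected O) (hp : p ∈ O)
    (hq : q ∈ O) : Transportable O p q := by
  refine hc.induction₂ (Transportable O) (fun x hx => ?_) (fun _ _ _ _ _ _ => Transportable.trans)
    (fun _ _ _ _ => Transportable.symm) hp hq
  obtain ⟨ρ, hρ, hball⟩ := Metric.nhds_basis_closedBall.mem_iff.1 (hO.mem_nhds hx)
  refine mem_nhdsWithin_of_mem_nhds (mem_of_superset (Metric.ball_mem_nhds x (half_pos hρ)) ?_)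
  intro y hy
  exact transportable_of_norm_lt hρ hball (by rwa [Metric.mem_ball, dist_eq_norm] at hy)

/-- A smooth function that is `0` on `(-∞, α]` and `1` on `[β, ∞)`. -/
def smoothStep (α β t : ℝ) : ℝ := Real.smoothTransition ((t - α) / (β - α))

theorem contDiff_smoothStep (α β : ℝ) : ContDiff ℝ ∞ (smoothStep α β) :=
  Real.smoothTransition.contDiff.comp ((contDiff_id.sub contDiff_const).div_const _)

theorem smoothStep_eq_zero {α β t : ℝ} (h : α < β) (ht : t ≤ α) : smoothStep α β t = 0 :=
  Real.smoothTransition.zero_of_nonpos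
    (div_nonpos_of_nonpos_of_nonneg (by linarith) (by linarith))

theorem smoothStep_eq_one {α β t : ℝ} (h : α < β) (ht : β ≤ t) : smoothStep α β t = 1 :=
  Real.smoothTransition.one_of_one_le ((one_le_div (by linarith)).2 (by linarith))

theorem deriv_smoothStep_eq_zero {α β t : ℝ} (h : α < β) (ht : t < α ∨ β < t) :
    deriv (smoothStep α β) t = 0 := by
  rcases ht with ht | ht
  · have : smoothStep α β =ᶠ[𝓝 t] fun _ => 0 := by
      filter_upwards [gt_mem_nhds ht] with s hs using smoothStep_eq_zero h hs.le
    rw [this.deriv_eq, deriv_const]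
  · have : smoothStep α β =ᶠ[𝓝 t] fun _ => 1 := by
      filter_upwards [lt_mem_nhds ht] with s hs using smoothStep_eq_one h hs.le
    rw [this.deriv_eq, deriv_const]

theorem norm_le_planeProj (x : Eucl 3) : ‖x‖ ≤ ‖planeProj x‖ + |x 2| := by
  have h1 : ‖embed (planeProj x)‖ = ‖planeProj x‖ := by
    rw [EuclideanSpace.norm_eq, EuclideanSpace.norm_eq]
    simp [Fin.sum_univ_three, Fin.sum_univ_two, embed]
  have h2 : x = embed (planeProj x) + x 2 • EuclideanSpace.single (2 : Fin 3) (1 : ℝ) := by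
    rw [← lift_eq, lift_planeProj]
  conv_lhs => rw [h2]
  refine (norm_add_le _ _).trans ?_
  rw [h1, norm_smul]
  simp

variable {Ω : Set (Eucl 2)}

/-- A solenoidal field that enters the fluid near `y` and leaves it near `y'`. -/
theorem exists_field_of_bumps (hdom : IsFluidShellDomain O Ω) {y y' : Eucl 2} (hy : y ∈ Ω)
    (hy' : y' ∈ Ω) : ∃ ε > 0, ∀ b : Eucl 2 → ℝ, ContDiff ℝ ∞ b → (∀ x, ε ≤ ‖x‖ → b x = 0) →
      ∃ φ ∈ smoothFields O Ω, ∀ z ∈ Ω, φ (embed z) 0 = 0 ∧ φ (embed z) 1 = 0 ∧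
        φ (embed z) 2 = b (z - y) - b (z - y') := by
  obtain ⟨r1, hr1, hb1⟩ := Metric.nhds_basis_closedBall.mem_iff.1 (hdom.isOpen_shell.mem_nhds hy)
  obtain ⟨r2, hr2, hb2⟩ := Metric.nhds_basis_closedBall.mem_iff.1 (hdom.isOpen_shell.mem_nhds hy')
  have hKΩ : Metric.closedBall y r1 ∪ Metric.closedBall y' r2 ⊆ Ω := union_subset hb1 hb2
  obtain ⟨h, hh, hlayer⟩ := exists_layer hdom
    ((isCompact_closedBall y r1).union (isCompact_closedBall y' r2)) hKΩ
  have hmem : ∀ z ∈ Metric.closedBall y r1 ∪ Metric.closedBall y' r2, lift z (-(h / 2)) ∈ O :=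
    fun z hz => hlayer z hz _ (by linarith) (by linarith)
  obtain ⟨ε, hε, H⟩ := transportable_of_isConnected hdom.isOpen_fluid
    hdom.isConnected_fluid.isPreconnected
    (hmem y (Or.inl (Metric.mem_closedBall_self hr1.le)))
    (hmem y' (Or.inr (Metric.mem_closedBall_self hr2.le)))
  -- The bound ε/4 keeps the mass density P below inside the ball of radius ε, its horizontal extent
  -- being at most ε/2. The bound h/4 keeps the transition zone of χ strictly between −h and 0.
  let ρ : ℝ := min (ε / 4) (h / 4)
  have hρ : 0 < ρ := lt_min (by positivity) (by positivity)
  have hρ1 : ρ ≤ ε / 4 := min_le_left _ _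
  have hρ2 : ρ ≤ h / 4 := min_le_right _ _
  let χ : ℝ → ℝ := smoothStep (-(h / 2) - ρ) (-(h / 2) + ρ)
  have hlt : -(h / 2) - ρ < -(h / 2) + ρ := by linarith
  have hχ : ContDiff ℝ ∞ χ := contDiff_smoothStep _ _
  refine ⟨min (ε / 2) (min r1 r2), lt_min (by positivity) (lt_min hr1 hr2), fun b hb hb0 => ?_⟩
  have hbε : ∀ x, ε / 2 ≤ ‖x‖ → b x = 0 := fun x hx => hb0 x ((min_le_left _ _).trans hx)
  have hbr1 : ∀ x, r1 ≤ ‖x‖ → b x = 0 := fun x hx =>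
    hb0 x (((min_le_right _ _).trans (min_le_left _ _)).trans hx)
  have hbr2 : ∀ x, r2 ≤ ‖x‖ → b x = 0 := fun x hx =>
    hb0 x (((min_le_right _ _).trans (min_le_right _ _)).trans hx)
  -- Translated to (y, −h/2), this is the divergence b(x' − y)χ'(x₃) of the vertical column
  -- χ(x₃)b(x' − y).
  let P : Eucl 3 → ℝ := fun x => b (planeProj x) * deriv χ (x 2 - h / 2)
  have hP : ContDiff ℝ ∞ P := (contDiff_comp_planeProj hb).mul
    ((contDiff_deriv hχ).comp ((contDiff_coord 2).sub contDiff_const))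
  have hP0 : ∀ x, ε ≤ ‖x‖ → P x = 0 := by
    intro x hx
    have h1 := norm_le_planeProj x
    by_cases h2 : ε / 2 ≤ ‖planeProj x‖
    · simp only [P, hbε _ h2, zero_mul]
    · have h3 : ρ < |x 2| := by linarith
      have h4 : deriv χ (x 2 - h / 2) = 0 := by
        refine deriv_smoothStep_eq_zero hlt ?_
        rcases lt_abs.1 h3 with h5 | h5
        · right; linarith
        · left; linarith
      simp only [P, h4, mul_zero]
  obtain ⟨F, hF, ⟨K, hKO, hK, hFK⟩, hdiv⟩ := H P hP hP0
  let B : Eucl 2 → ℝ := fun z => b (z - y) - b (z - y')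
  have hB : ContDiff ℝ ∞ B := (hb.comp (contDiff_id.sub contDiff_const)).sub
    (hb.comp (contDiff_id.sub contDiff_const))
  let f : Eucl 3 → ℝ := fun x => χ (x 2) * B (planeProj x)
  have s1 := contDiff_comp_two hχ
  have s2 := contDiff_comp_planeProj hB
  have hf : ContDiff ℝ ∞ f := s1.mul s2
  -- The vertical columns over y and y' carry the boundary values, and F cancels their divergence
  -- inside the fluid without touching the boundary.
  let Φ : Eucl 3 → Eucl 3 := field fun i x => (![0, 0, f] : Fin 3 → Eucl 3 → ℝ) i x - F x i
  have hFi := fun i => contDiff_component hF i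
  have hΦ : ContDiff ℝ ∞ Φ := by
    refine contDiff_field fun i => ?_
    fin_cases i
    · exact (contDiff_const (c := (0 : ℝ))).sub (hFi 0)
    · exact (contDiff_const (c := (0 : ℝ))).sub (hFi 1)
    · exact hf.sub (hFi 2)
  refine ⟨Φ, mem_smoothFields hΦ (C := {x : Eucl 3 | planeProj x ∈
      Metric.closedBall y r1 ∪ Metric.closedBall y' r2 ∧ -h ≤ x 2} ∪ K) ?_ ?_ ?_ ?_, ?_⟩
  · refine IsClosed.union (IsClosed.inter ?_ ?_) hK.isClosed
    · exact (Metric.isClosed_closedBall.union Metric.isClosed_closedBall).preimage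
        planeProj.continuous
    · exact isClosed_le continuous_const (contDiff_coord (n := 0) 2).continuous
  · refine Disjoint.union_left (disjoint_layer_wall hdom hKΩ hlayer) ?_
    rw [Set.disjoint_left]
    intro x hxK hxw
    have h2 := hxw.1
    rw [hdom.isOpen_fluid.frontier_eq] at h2
    exact h2.2 (hKO hxK)
  · intro x hx
    rw [mem_union, not_or, mem_ofPred_eq, not_and_or, not_le, mem_union, not_or] at hx
    have h0 : f x = 0 := by
      rcases hx.1 with hx1 | hx1
      · have e1 : b (planeProj x - y) = 0 := hbr1 _ (by
          have := hx1.1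
          rw [Metric.mem_closedBall, not_le, dist_eq_norm] at this
          exact this.le)
        have e2 : b (planeProj x - y') = 0 := hbr2 _ (by
          have := hx1.2
          rw [Metric.mem_closedBall, not_le, dist_eq_norm] at this
          exact this.le)
        simp only [f, B, e1, e2, sub_self, mul_zero]
      · have e1 : χ (x 2) = 0 := smoothStep_eq_zero hlt (by linarith)
        simp only [f, e1, zero_mul]
    have h1 := hFK x hx.2
    ext i
    fin_cases i <;> simp [Φ, field, h0, h1]
  · intro x _
    have e0 : ∀ i : Fin 3, ∀ g : Eucl 3 → ℝ, DifferentiableAt ℝ g x →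
        partialD i (fun x => g x - F x i) x = partialD i g x - partialD i (fun y => F y i) x := by
      intro i g hg
      rw [partialD, fderiv_fun_sub hg ((hFi i).differentiable (by simp) x)]
      rfl
    have e1 := e0 0 (fun _ => 0) (differentiableAt_const _)
    have e2 := e0 1 (fun _ => 0) (differentiableAt_const _)
    have e3 := e0 2 f (hf.differentiable (by simp) x)
    have e4 : ∀ i : Fin 3, partialD i (fun _ : Eucl 3 => (0 : ℝ)) x = 0 := fun i => by
      simp [partialD]
    have e5 : partialD 2 f x = deriv χ (x 2) * B (planeProj x) := by
      have := partialD_mul 2 (s1.differentiable (by simp) x) (s2.differentiable (by simp) x)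
      rw [partialD_comp_two hχ, partialD_comp_planeProj hB] at this
      simpa using this
    have e6 := hdiv x
    rw [Fin.sum_univ_three] at e6 ⊢
    have e7 : P (x - lift y (-(h / 2))) - P (x - lift y' (-(h / 2)))
        = deriv χ (x 2) * B (planeProj x) := by
      simp only [P, B, map_sub, planeProj_lift, PiLp.sub_apply, lift_two, sub_neg_eq_add,
        add_sub_cancel_right]
      ring
    change partialD 0 (fun x => 0 - F x 0) x + partialD 1 (fun x => 0 - F x 1) x
      + partialD 2 (fun x => f x - F x 2) x = 0
    rw [e1, e2, e3, e4, e4, e5]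
    linarith
  · intro z hz
    have h1 : F (embed z) = 0 := hFK _ fun hzK => by
      have h2 := hdom.shell_subset ⟨z, hz, rfl⟩
      rw [hdom.isOpen_fluid.frontier_eq] at h2
      exact h2.2 (hKO hzK)
    have h2 : f (embed z) = B z := by
      have h3 : χ 0 = 1 := smoothStep_eq_one hlt (by linarith)
      simp only [f]
      rw [← lift_zero, planeProj_lift, lift_two, h3, one_mul]
    refine ⟨?_, ?_, ?_⟩ <;> simp [Φ, field, h1, h2, B]

end Transport

end

end FluidShell

namespace FluidShell

noncomputable section

/-! ### Functionals that vanish on the traces of solenoidal fields -/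

section Traces

open Filter Topology

variable {O : Set (Eucl 3)} {Ω : Set (Eucl 2)}

/-- The displacement with smooth components `b`. -/
def testDisp (b : Fin 3 → Test Ω) : W Ω :=
  (Test.jet 1 (b 0), Test.jet 1 (b 1), Test.jet 2 (b 2))

/-- The functional vanishes on the smooth displacements with mean value zero that are traces of
smooth solenoidal fields. -/
def VanishesOnTraces (O : Set (Eucl 3)) (L : W Ω →L[ℝ] ℝ) : Prop :=
  ∀ φ ∈ smoothFields O Ω, ∀ b : Fin 3 → Test Ω, (∀ y ∈ Ω, ∀ j, φ (embed y) j = (b j).1 y) →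
    ∫ x, (b 2).1 x = 0 → L (testDisp b) = 0

variable {L : W Ω →L[ℝ] ℝ}

theorem exists_layer_test (hdom : IsFluidShellDomain O Ω) (c : Fin 2 → Test Ω) :
    ∃ h > 0, ∀ i, ∀ z ∈ tsupport (c i).1, ∀ t, -h ≤ t → t < 0 → lift z t ∈ O := by
  obtain ⟨h, hh, H⟩ := exists_layer hdom
    ((c 0).compact.isCompact.union (c 1).compact.isCompact)
    (union_subset (c 0).subset (c 1).subset)
  exact ⟨h, hh, Fin.forall_fin_two.2 ⟨fun z hz => H z (Or.inl hz), fun z hz => H z (Or.inr hz)⟩⟩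

/-- The profile γ(t) = −t near 0 has γ(0) = 0 and γ'(0) = −1, so the layer field has the trace (c₁;
c₂; 0). -/
theorem VanishesOnTraces.plane (hdom : IsFluidShellDomain O Ω) (hL : VanishesOnTraces O L)
    (c : Fin 2 → Test Ω) : L (Test.jet 1 (c 0), Test.jet 1 (c 1), 0) = 0 := by
  obtain ⟨h, hh, H⟩ := exists_layer_test hdom c
  let χ := smoothStep (-h) (-(h / 2))
  have hlt : -h < -(h / 2) := by linarith
  let γ : ℝ → ℝ := fun t => -t * χ t
  have hγ : ContDiff ℝ ∞ γ := contDiff_id.neg.mul (contDiff_smoothStep _ _)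
  have h1 : γ =ᶠ[𝓝 0] fun t => -t := by
    filter_upwards [lt_mem_nhds (show -(h / 2) < 0 by linarith)] with t ht
    simp only [γ, χ, smoothStep_eq_one hlt ht.le, mul_one]
  have h2 : deriv γ 0 = -1 := by
    rw [h1.deriv_eq]
    simp
  have h3 : γ 0 = 0 := by simp [γ]
  have := hL _ (layerField_mem_smoothFields hdom c H hγ fun t ht => by
    simp only [γ, χ, smoothStep_eq_zero hlt ht, mul_zero]) ![c 0, c 1, 0] (fun y hy j => by
      have h4 : embed y 2 = 0 := by rw [← lift_zero, lift_two]
      have h5 : planeProj (embed y) = y := by rw [← lift_zero, planeProj_lift]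
      fin_cases j <;> simp [field, h4, h5, h2, h3]) (by simp)
  have e : testDisp ![c 0, c 1, 0] = (Test.jet 1 (c 0), Test.jet 1 (c 1), 0) := by
    simp only [testDisp, Matrix.cons_val_zero, Matrix.cons_val_one, Matrix.cons_val, map_zero]
  rwa [e] at this

theorem integral_partialD (i : Fin 2) (c : Test Ω) : ∫ x, partialD i c.1 x = 0 := by
  have h := Test.integral_mul_partialD i (f := fun _ => 1) contDiff_const c
  simpa [partialD] using h

/-- A profile equal to 1 near 0 has γ(0) = 1 and γ'(0) = 0, so the layer field has the purely
transversal trace div c. With c in the single direction `i` this is the derivative. -/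
theorem VanishesOnTraces.deriv (hdom : IsFluidShellDomain O Ω) (hL : VanishesOnTraces O L)
    (i : Fin 2) (c : Test Ω) : L (0, 0, Test.jet 2 (Test.deriv i c)) = 0 := by
  obtain ⟨h, hh, H⟩ := exists_layer_test hdom (Pi.single i c)
  have hlt : -h < -(h / 2) := by linarith
  let χ := smoothStep (-h) (-(h / 2))
  have h2 : _root_.deriv χ 0 = 0 := deriv_smoothStep_eq_zero hlt (Or.inr (by linarith))
  have h3 : χ 0 = 1 := smoothStep_eq_one hlt (by linarith)
  have := hL _ (layerField_mem_smoothFields hdom (Pi.single i c) H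
    (contDiff_smoothStep (-h) (-(h / 2))) fun t ht => smoothStep_eq_zero hlt ht)
    ![0, 0, Test.deriv i c] (fun y hy j => by
      have h4 : embed y 2 = 0 := by rw [← lift_zero, lift_two]
      have h5 : planeProj (embed y) = y := by rw [← lift_zero, planeProj_lift]
      have h6 : ∀ k : Fin 2, partialD k (0 : Eucl 2 → ℝ) y = 0 := fun k => by simp [partialD]
      fin_cases j
      · simp [field, h4, h5, χ, h2]
      · simp [field, h4, h5, χ, h2]
      · have e : partialD 0 ((Pi.single i c : Fin 2 → Test Ω) 0).1 y
            + partialD 1 ((Pi.single i c : Fin 2 → Test Ω) 1).1 y = partialD i c.1 y := by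
          fin_cases i <;> simp [h6]
        have h7 : smoothStep (-h) (-(h / 2)) 0 = 1 := h3
        change smoothStep (-h) (-(h / 2)) (embed y 2) * (partialD 0
          ((Pi.single i c : Fin 2 → Test Ω) 0).1 (planeProj (embed y)) + partialD 1
          ((Pi.single i c : Fin 2 → Test Ω) 1).1 (planeProj (embed y))) = partialD i c.1 y
        rw [h4, h5, e, h7, one_mul]) (integral_partialD i c)
  have e : testDisp ![0, 0, Test.deriv i c] = (0, 0, Test.jet 2 (Test.deriv i c)) := by
    simp only [testDisp, Matrix.cons_val_zero, Matrix.cons_val_one, Matrix.cons_val, map_zero]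
  rwa [e] at this

/-- The functional on the transversal components. -/
def transL (L : W Ω →L[ℝ] ℝ) : H0 2 Ω →L[ℝ] ℝ :=
  L ∘L ContinuousLinearMap.inr ℝ (H0 1 Ω) (H0 1 Ω × H0 2 Ω) ∘L
    ContinuousLinearMap.inr ℝ (H0 1 Ω) (H0 2 Ω)

theorem transL_apply (w : H0 2 Ω) : transL L w = L (0, 0, w) := rfl

/-- Two translates of a bump differ by the trace of a flow through the fluid, and equal integrals
give the difference zero mean. This compares points in different components of Ω, which derivatives
on Ω alone cannot do. -/
theorem VanishesOnTraces.bumps (hdom : IsFluidShellDomain O Ω) (hL : VanishesOnTraces O L)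
    {y y' : Eucl 2} (hy : y ∈ Ω) (hy' : y' ∈ Ω) : ∃ ε > 0, ∀ b : Eucl 2 → ℝ, ContDiff ℝ ∞ b →
      (∀ x, ε ≤ ‖x‖ → b x = 0) → ∀ δ δ' : Test Ω, (∀ x, δ.1 x = b (x - y)) →
      (∀ x, δ'.1 x = b (x - y')) → transL L (Test.jet 2 δ) = transL L (Test.jet 2 δ') := by
  obtain ⟨ε, hε, H⟩ := exists_field_of_bumps hdom hy hy'
  refine ⟨ε, hε, fun b hb hb0 δ δ' hδ hδ' => ?_⟩
  obtain ⟨φ, hφ, hφΩ⟩ := H b hb hb0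
  have i1 : ∀ δ : Test Ω, Integrable δ.1 := fun δ =>
    δ.contDiff.continuous.integrable_of_hasCompactSupport δ.compact
  have e0 : ∫ x, (δ - δ').1 x = 0 := by
    have e1 : ∫ x, (δ - δ').1 x = (∫ x, δ.1 x) - ∫ x, δ'.1 x := integral_sub (i1 δ) (i1 δ')
    rw [e1, integral_congr_ae (Eventually.of_forall hδ),
      integral_congr_ae (Eventually.of_forall hδ'), integral_sub_right_eq_self (fun x => b x),
      integral_sub_right_eq_self (fun x => b x), sub_self]
  have := hL φ hφ ![0, 0, δ - δ'] (fun z hz j => by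
    obtain ⟨h0, h1, h2⟩ := hφΩ z hz
    fin_cases j
    · exact h0
    · exact h1
    · change φ (embed z) 2 = δ.1 z - δ'.1 z
      rw [h2, hδ, hδ']) e0
  have e : testDisp ![0, 0, δ - δ'] = (0, 0, Test.jet 2 (δ - δ')) := by
    simp only [testDisp, Matrix.cons_val_zero, Matrix.cons_val_one, Matrix.cons_val, map_zero]
  rw [e, ← transL_apply, map_sub, map_sub, sub_eq_zero] at this
  exact this

/-- Vanishing on derivatives makes the functional a multiple of the integral on each box, translated
bumps show that the multiples agree, and a cut-off argument globalizes the identity. -/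
theorem VanishesOnTraces.exists_eq_mul_integral (hdom : IsFluidShellDomain O Ω)
    (hL : VanishesOnTraces O L) :
    ∃ κ : ℝ, ∀ δ : Test Ω, transL L (Test.jet 2 δ) = κ * ∫ x, δ.1 x := by
  let T : Test Ω →ₗ[ℝ] ℝ := (transL L).toLinearMap ∘ₗ Test.jet 2
  have hT : ∀ i c, T (Test.deriv i c) = 0 := fun i c => hL.deriv hdom i c
  have hbox : ∀ a ∈ Ω, ∃ r > 0, box a r ⊆ Ω := fun a ha =>
    exists_box_subset (hdom.isOpen_shell.mem_nhds ha)
  choose! r hr hrΩ using hbox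
  have hloc := fun a (ha : a ∈ Ω) => exists_eq_mul_integral_of_box hT (hr a ha) (hrΩ a ha)
  choose! κ hκ using hloc
  have hconst : ∀ y ∈ Ω, ∀ y' ∈ Ω, κ y = κ y' := by
    intro y hy y' hy'
    obtain ⟨ε, hε, H⟩ := hL.bumps hdom hy hy'
    -- The bump must be small enough for the transport through the fluid and fit into both boxes.
    let s := min ε (min (r y) (r y'))
    have hs : 0 < s := lt_min hε (lt_min (hr y hy) (hr y' hy'))
    let B : ContDiffBump (0 : Eucl 2) := ⟨s / 2, s, by positivity, by linarith⟩
    let b : Eucl 2 → ℝ := B.normed volume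
    have hb : ContDiff ℝ ∞ b := ContDiffBump.contDiff_normed _
    have hb0 : ∀ x, s ≤ ‖x‖ → b x = 0 := by
      intro x hx
      by_contra hn
      have h1 : x ∈ Function.support b := hn
      rw [ContDiffBump.support_normed_eq, mem_ball_zero_iff] at h1
      exact absurd hx (not_le.2 h1)
    have hsub : ∀ a, s ≤ r a → ∀ x ∉ box a (r a), b (x - a) = 0 := by
      intro a ha x hx
      refine hb0 _ ?_
      rcases lt_or_lt_of_notMem_box hx with h | h
      · exact (ha.trans h.le).trans (PiLp.norm_apply_le (x - a) 0)
      · exact (ha.trans h.le).trans (PiLp.norm_apply_le (x - a) 1)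
    have hbs : ∀ a : Eucl 2, ContDiff ℝ ∞ fun x => b (x - a) := fun a =>
      hb.comp (contDiff_id.sub contDiff_const)
    have s1 : s ≤ r y := (min_le_right _ _).trans (min_le_left _ _)
    have s2 : s ≤ r y' := (min_le_right _ _).trans (min_le_right _ _)
    let δ : Test Ω := Test.ofCompact (isCompact_box y (r y)) (hrΩ y hy) _ (hbs y) (hsub y s1)
    let δ' : Test Ω := Test.ofCompact (isCompact_box y' (r y')) (hrΩ y' hy') _ (hbs y') (hsub y' s2)
    have h1 : T δ = T δ' := H b hb (fun x hx => hb0 x ((min_le_left _ _).trans hx)) δ δ'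
      (fun _ => rfl) fun _ => rfl
    have hint : ∀ a : Eucl 2, ∫ x, b (x - a) = 1 := fun a => by
      rw [integral_sub_right_eq_self (fun x => b x)]
      exact B.integral_normed
    have h2 : T δ = κ y * ∫ x, b (x - y) := hκ y hy δ (hsub y s1)
    have h3 : T δ' = κ y' * ∫ x, b (x - y') := hκ y' hy' δ' (hsub y' s2)
    rw [hint, mul_one] at h2 h3
    rw [← h2, ← h3, h1]
  have hglob : ∃ κ₀ : ℝ, ∀ a ∈ Ω, κ a = κ₀ := by
    rcases Ω.eq_empty_or_nonempty with h0 | ⟨a₀, ha₀⟩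
    · exact ⟨0, fun a ha => (h0 ▸ ha : a ∈ (∅ : Set (Eucl 2))).elim⟩
    · exact ⟨κ a₀, fun a ha => hconst a ha a₀ ha₀⟩
  obtain ⟨κ₀, hκ₀⟩ := hglob
  refine ⟨κ₀, fun δ => eq_mul_integral_of_local (T := T) (fun a ha => ?_) δ⟩
  refine ⟨interior (box a (r a)), isOpen_interior,
    mem_interior_iff_mem_nhds.2 (box_mem_nhds a (hr a ha)), fun δ hδ => ?_⟩
  rw [← hκ₀ a ha]
  exact hκ a ha δ fun x hx => image_eq_zero_of_notMem_tsupport fun h => hx (interior_subset (hδ h))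

theorem meanL_jet (hb : Bornology.IsBounded Ω) (δ : Test Ω) :
    meanL hb (Test.jet 2 δ) = ∫ x, δ.1 x := by
  rw [meanL_apply, fnL_jet, integral_congr_ae δ.coeFn_toL2]
  exact setIntegral_eq_integral_of_forall_compl_eq_zero fun x hx => δ.eq_zero hx

/-- A functional that vanishes on the traces of solenoidal fields vanishes on `Ŵ`. -/
theorem VanishesOnTraces.eq_zero (hdom : IsFluidShellDomain O Ω) (hL : VanishesOnTraces O L)
    {β : W Ω} (hβ : β ∈ What Ω) : L β = 0 := by
  have hb := isBounded_shell hdom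
  obtain ⟨κ, hκ⟩ := hL.exists_eq_mul_integral hdom
  -- The identity is extended to all of `H²₀`, and the mean value condition enters only at the end;
  -- density of test functions with zero mean is thus not needed.
  have h1 : ∀ w : H0 2 Ω, transL L w = κ * meanL hb w := fun w => by
    refine (denseRange_jet 2 Ω).induction_on (p := fun w => transL L w = κ * meanL hb w) w
      (isClosed_eq (transL L).continuous (continuous_const.mul (meanL hb).continuous)) fun δ => ?_
    rw [hκ, meanL_jet]
  have h2 : ∀ p : H0 1 Ω × H0 1 Ω, L (p.1, p.2, 0) = 0 := fun p => by
    refine ((denseRange_jet 1 Ω).prodMap (denseRange_jet 1 Ω)).induction_on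
      (p := fun p => L (p.1, p.2, 0) = 0) p (isClosed_eq (L.continuous.comp
        (continuous_fst.prodMk (continuous_snd.prodMk continuous_const))) continuous_const)
      fun c => ?_
    exact hL.plane hdom ![c.1, c.2]
  have h3 : β = (β.1, β.2.1, 0) + (0, 0, β.2.2) := by
    refine Prod.ext ?_ (Prod.ext ?_ ?_)
    · exact (add_zero _).symm
    · exact (add_zero _).symm
    · exact (zero_add _).symm
  have h4 : L (β.1, β.2.1, 0) = 0 := h2 (β.1, β.2.1)
  have h5 : L (0, 0, β.2.2) = κ * meanL hb β.2.2 := h1 β.2.2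
  have h6 : meanL hb β.2.2 = 0 := mem_whatSpace.1 ((mem_whatSpace_iff (hb := hb)).2 hβ)
  calc L β = L ((β.1, β.2.1, 0) + (0, 0, β.2.2)) := congrArg L h3
    _ = L (β.1, β.2.1, 0) + L (0, 0, β.2.2) := map_add L _ _
    _ = 0 := by rw [h4, h5, h6, mul_zero, add_zero]

end Traces

/-! ### Stationary solutions -/

section Stationary

open Filter Topology

theorem exists_denergy_clm {X Y : Type*} [NormedAddCommGroup X] [NormedSpace ℝ X]
    [NormedAddCommGroup Y] [InnerProductSpace ℝ Y] (c : ℝ) (Λ : X →L[ℝ] Y)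
    (A : Fin 3 → X →L[ℝ] Y) (B : Fin 3 → X →L[ℝ] X →L[ℝ] Y) (G : X →L[ℝ] ℝ) (u : X) :
    ∃ L : X →L[ℝ] ℝ, ∀ b, L b = denergyOf c Λ A B G u b := by
  let D : Fin 3 → X →L[ℝ] Y := fun i => A i + B i u
  let E := strainOf A B u
  refine ⟨innerSL ℝ (Λ u) ∘L Λ + ((2 : ℝ) • (innerSL ℝ (E 0) ∘L D 0)
    + (2 : ℝ) • (innerSL ℝ (E 1) ∘L D 1) + c • (innerSL ℝ (E 0 + E 1) ∘L (D 0 + D 1))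
    + innerSL ℝ (E 2) ∘L D 2) - G, fun b => rfl⟩

variable {O : Set (Eucl 3)} {Ω : Set (Eucl 2)} {ν μ : ℝ} {k1 k2 : Eucl 2 → ℝ} {g : Hm1 Ω}
  {v : V O Ω} {u : W Ω}

theorem exists_jet (ho : IsOpen O) (hb : Bornology.IsBounded O) {f : Eucl 3 → ℝ}
    (hf : ContDiff ℝ ∞ f) : ∃ U : Jet 1 O, IsJetOf f U := by
  have : IsFiniteMeasure (volume.restrict O) :=
    ⟨by rw [Measure.restrict_apply_univ]; exact hb.measure_lt_top⟩
  have h : ∀ I : JetIdx 3 1, MemLp (classicalDeriv f I) 2 (volume.restrict O) := fun I =>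
    (memLp_top_of_continuousOn ho hb (contDiff_classicalDeriv hf I).continuousOn).mono_exponent
      le_top
  exact ⟨WithLp.toLp 2 fun I => (h I).toLp _, fun I => (h I).coeFn_toLp⟩

/-- The trace of a smooth field. -/
theorem exists_hasTrace (hdom : IsFluidShellDomain O Ω) {φ : Eucl 3 → Eucl 3}
    (hφ : φ ∈ smoothFields O Ω) {b : Fin 3 → Test Ω}
    (h : ∀ y ∈ Ω, ∀ j, φ (embed y) j = (b j).1 y) :
    ∃ ψ : V O Ω, HasTrace ψ (testDisp b).comp := by
  choose U hU using fun j => exists_jet hdom.isOpen_fluid hdom.isBounded_fluid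
    (contDiff_component hφ.1 j)
  refine ⟨⟨WithLp.toLp 2 U, Submodule.le_topologicalClosure _
    (Submodule.subset_span ⟨φ, hφ, hU⟩)⟩, Submodule.le_topologicalClosure _
    (Submodule.subset_span ⟨φ, hφ, hU, fun j => ?_⟩)⟩
  have key : ∀ c : L2 Ω, c = Test.toL2 (b j) →
      (c : Eucl 2 → ℝ) =ᵐ[volume.restrict Ω] fun y => φ (embed y) j := by
    rintro c rfl
    filter_upwards [(b j).coeFn_toL2, ae_restrict_mem hdom.isOpen_shell.measurableSet] with y h1 h2
    rw [h1, h y h2]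
  refine key _ ?_
  fin_cases j
  · exact fnL_jet (b 0)
  · exact fnL_jet (b 1)
  · exact fnL_jet (b 2)

theorem formE_zero_left (ψ : V O Ω) : formE 0 ψ = 0 := by
  have h : ∀ i j : Fin 3, ip O
      (fun x => ((0 : V O Ω).1 j).pd i x + ((0 : V O Ω).1 i).pd j x)
      (fun x => (ψ.1 j).pd i x + (ψ.1 i).pd j x) = 0 := by
    intro i j
    refine integral_eq_zero_of_ae ?_
    filter_upwards [Lp.coeFn_zero ℝ 2 (volume.restrict O)] with x hx
    have h1 : ∀ i j : Fin 3, ((0 : V O Ω).1 j).pd i x = 0 := fun i j => hx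
    rw [h1, h1, add_zero, zero_mul, Pi.zero_apply]
  simp only [formE, h, Finset.sum_const_zero, mul_zero]

theorem IsStationarySolution.add_eq_zero (hμ : μ < 1) (hk1 : MemLp k1 ⊤ (volume.restrict Ω))
    (hk2 : MemLp k2 ⊤ (volume.restrict Ω)) (h : IsStationarySolution ν μ k1 k2 0 0 0 g v u)
    {ψ : V O Ω} {β : W Ω} (hβ : β ∈ What Ω) (hψ : HasTrace ψ β.comp) :
    ν * formE v ψ + vonKarman hk1 hk2 u β μ g = 0 := by
  have h1 := h.equation ψ β hβ hψ
  have h2 := formA_add_formQ u β hμ hk1 hk2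
  rw [← vonKarman_eq hk1 hk2 u β hμ g]
  simp only [zero_apply, sub_zero, zero_add] at h1
  linarith

/-- A stationary solution has vanishing velocity and solves the von Kármán equation. -/
theorem IsStationarySolution.eq_zero_and_solves (hdom : IsFluidShellDomain O Ω) (hν : 0 < ν)
    (hμ : μ < 1) (hk1 : ContinuousOn k1 (closure Ω)) (hk2 : ContinuousOn k2 (closure Ω))
    (h : IsStationarySolution ν μ k1 k2 0 0 0 g v u) :
    v = 0 ∧ SolvesVonKarman μ k1 k2 g u := by
  have ho := hdom.isOpen_shell
  have hb := isBounded_shell hdom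
  have m1 := memLp_top_of_continuousOn ho hb hk1
  have m2 := memLp_top_of_continuousOn ho hb hk2
  obtain ⟨L, hL⟩ : ∃ L : W Ω →L[ℝ] ℝ, ∀ b, L b = vonKarman m1 m2 u b μ g :=
    exists_denergy_clm _ _ _ _ _ _
  have heq : ∀ (ψ : V O Ω) (β : W Ω), β ∈ What Ω → HasTrace ψ β.comp →
      ν * formE v ψ + L β = 0 := fun ψ β hβ hψ => by
    rw [hL]
    exact h.add_eq_zero hμ m1 m2 hβ hψ
  -- Since v has zero trace, (ψ, β) = (v, 0) is admissible and the shell terms drop out.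
  have hv : v = 0 := by
    have h0 : (0 : W Ω) ∈ What Ω := (mem_whatSpace_iff (hb := hb)).1 (whatSpace hb).zero_mem
    have hc : (0 : W Ω).comp = 0 := by
      ext1 j
      fin_cases j <;> rfl
    have h1 := heq v 0 h0 (hc ▸ h.boundary)
    rw [map_zero, add_zero] at h1
    exact eq_zero_of_formE_eq_zero hdom ((mul_eq_zero.1 h1).resolve_left hν.ne')
  refine ⟨hv, fun β hβ => ?_⟩
  rw [vonKarman_eq m1 m2 u β hμ, ← hL]
  -- With v = 0 the equation says that the residual vanishes on every β in `Ŵ` that is a trace;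
  -- smooth traces already suffice.
  refine VanishesOnTraces.eq_zero hdom (fun φ hφ b hφb hint => ?_) hβ
  obtain ⟨ψ, hψ⟩ := exists_hasTrace hdom hφ hφb
  have hmem : testDisp b ∈ What Ω := by
    refine (mem_whatSpace_iff (hb := hb)).1 (mem_whatSpace.2 ?_)
    exact (meanL_jet hb (b 2)).trans hint
  have h1 := heq ψ _ hmem hψ
  rwa [hv, formE_zero_left, mul_zero, zero_add] at h1

end Stationary

end

end FluidShell

/-! ### The three assertions -/

theorem proposition3 (O : Set (FluidShell.Eucl 3)) (Ω : Set (FluidShell.Eucl 2))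
    (hdom : FluidShell.IsFluidShellDomain O Ω)
    (ν μ : ℝ) (hν : 0 < ν) (hμ0 : 0 < μ) (hμ1 : μ < 1 / 2)
    (k1 k2 : FluidShell.Eucl 2 → ℝ)
    (hk1 : ContinuousOn k1 (closure Ω)) (hk2 : ContinuousOn k2 (closure Ω))
    (g : FluidShell.Hm1 Ω) :
    (∀ (v : FluidShell.V O Ω) (u : FluidShell.W Ω),
      FluidShell.IsStationarySolution ν μ k1 k2 0 0 0 g v u →
        v = 0 ∧ FluidShell.SolvesVonKarman μ k1 k2 g u) ∧
    (∃ u ∈ FluidShell.What Ω, FluidShell.SolvesVonKarman μ k1 k2 g u) ∧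
    ((∀ x ∈ Ω, k1 x = 0 ∧ k2 x = 0) →
      Bornology.IsBounded
        {u : FluidShell.W Ω | u ∈ FluidShell.What Ω ∧ FluidShell.SolvesVonKarman μ k1 k2 g u}) := by
  have ho := hdom.isOpen_shell
  have hb := FluidShell.isBounded_shell hdom
  have hμ : μ < 1 := by linarith
  exact ⟨fun v u h => h.eq_zero_and_solves hdom hν hμ hk1 hk2,
    FluidShell.exists_solvesVonKarman ho hb hμ0 hμ hk1 hk2 g,
    FluidShell.isBounded_solutions ho hb hμ0 hμ hk1 hk2 g⟩
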